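/- **Mesh.** Let $d\in\{2,3\}$. Let $\mathcal T_h=\mathcal T_h^p\cup\mathcal T_h^a$ be a polytopic mesh in $\mathbb R^d$ whose elements are bounded, open, connected polytopes; $\mathcal T_h^p$ is a mesh of the poro-elastic domain $\Omega_p$ and $\mathcal T_h^a$ a mesh of the acoustic domain $\Omega_a$. The mesh faces $F$ are $(d-1)$-simplices. Let $h_\kappa$ be the diameter of $\kappa$ and $p_\kappa\ge1$ ($\kappa\in\mathcal T_h^p$), $r_\kappa\ge1$ ($\kappa\in\mathcal T_h^a$) polynomial degrees. The mesh is polytopic-regular with constant $c_{\rm reg}$: every $\kappa$ contains (in its closure) non-overlapping $d$-simplices $S_\kappa^F$, one for each mesh face $F\subset\partial\kappa$ and having $F$ as a face, with $h_\kappa\le c_{\rm reg}\,d\,|S_\kappa^F|/|F|$. Let $\mathcal F^p$ (resp. $\mathcal F^a$) be the set of faces between two elements of $\mathcal T_h^p$ (resp. $\mathcal T_h^a$) together with the Dirichlet boundary faces of $\Omega_p$ (resp. $\Omega_a$), and $\mathcal F^I$ the set of interface faces, i.e. those between an element of $\mathcal T_h^p$ and one of $\mathcal T_h^a$. The interface permeability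 $\tau$ is constant on each $F\in\mathcal F^I$, with values in $[0,1]$; $\mathcal F^{s}=\{F\in\mathcal F^I:\tau_F=0\}$ are the sealed faces, $\mathcal F^{o}=\mathcal F^I\setminus\mathcal F^s$, and $\zeta_\tau=(1-\tau)/\tau$ on $\mathcal F^o$. $\boldsymbol V_h^p$ is the space of vector fields on $\Omega_p$ that are polynomials of total degree $\le p_\kappa$ on each $\kappa\in\mathcal T_h^p$, $V_h^a$ the space of functions on $\Omega_a$ that are polynomials of total degree $\le r_\kappa$ on each $\kappa\in\mathcal T_h^a$. On a face between $\kappa^\pm$ with outward normals $\boldsymbol n^\pm$ put $[\![\psi]\!]=\psi^+\boldsymbol n^++\psi^-\boldsymbol n^-$, $[\![\boldsymbol v]\!]=\boldsymbol v^+\otimes\boldsymbol n^++\boldsymbol v^-\otimes\boldsymbol n^-$, $[\![\boldsymbol v]\!]_n=\boldsymbol v^+\cdot\boldsymbol n^++\boldsymbol v^-\cdot\boldsymbol n^-$, $\{\!\{q\}\!\}=(q^++q^-)/2$; on boundary faces $[\![\psi]\!]=\psi\boldsymbol n$, $[\![\boldsymbol v]\!]=\boldsymbol v\otimes\boldsymbol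 n$, $[\![\boldsymbol v]\!]_n=\boldsymbol v\cdot\boldsymbol n$, $\{\!\{q\}\!\}=q$. Let $\boldsymbol n_p$ be the normal on $\mathcal F^I$ pointing out of $\Omega_p$. All differential operators are elementwise, and $(\cdot,\cdot)_{\mathcal F}=\sum_{F\in\mathcal F}(\cdot,\cdot)_{L^2(F)}$. **Coefficients.** All are elementwise constant. On $\mathcal T_h^p$: $\rho_f,\rho_s,\lambda,\mu,\eta,k,m>0$, $0<\phi<1$, $a>1$, $0<\beta\le1$. On $\mathcal T_h^a$: $\rho_a,c>0$. Put $\rho=\phi\rho_f+(1-\phi)\rho_s$, $\rho_w=a\phi^{-1}\rho_f$, $\rho_u=\frac12\rho_s(1-\phi)$, $\mathbb D\boldsymbol\varepsilon=\lambda\,\mathrm{tr}(\boldsymbol\varepsilon)I+2\mu\boldsymbol\varepsilon$, $\boldsymbol\sigma(\boldsymbol u)=\mathbb D\boldsymbol\varepsilon(\boldsymbol u)$ with $\boldsymbol\varepsilon(\boldsymbol u)$ the symmetric gradient, and let $\overline{\mathbb D}_\kappa=|(\mathbb D|_\kappa)^{1/2}|^2$ be the operator norm on symmetric tensors. Let $0<\underline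 c$ and $\overline c$ be such that $\rho_u\ge\underline c$, $\eta/k\ge\underline c$, $\rho_f\le\overline c$, $a\le\overline c$ on $\mathcal T_h^p$ and $\rho_ac^{-2}\ge\underline c$ on $\mathcal T_h^a$. **Scheme.** On a face, the penalty functions are $$\eta_F=\sigma_0\max_\kappa\overline{\mathbb D}_\kappa p_\kappa^2h_\kappa^{-1},\qquad \gamma_F=m_0\max_\kappa m_\kappa p_\kappa^2h_\kappa^{-1},\qquad \chi_F=\rho_0\max_\kappa(\rho_a)_\kappa r_\kappa^2h_\kappa^{-1},$$ the maximum being over the elements that share $F$ (on $\mathcal F^s$, only over the element in $\mathcal T_h^p$). For the weak imposition of $\boldsymbol w\cdot\boldsymbol n_p=0$ on $\mathcal F^{s}$ let $j(\boldsymbol u,\boldsymbol w)$ denote one of $$\text{(A)}\quad j(\boldsymbol u,\boldsymbol w)=\boldsymbol w\cdot\boldsymbol n_p,\qquad\qquad\text{(B)}\quad j(\boldsymbol u,\boldsymbol w)=(\beta\boldsymbol u+\boldsymbol w)\cdot\boldsymbol n_p .$$ With $\boldsymbol X=\beta\boldsymbol u+\boldsymbol w$ and $\boldsymbol Y=\beta\boldsymbol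 v+\boldsymbol z$, define $$\mathcal M=(\rho\boldsymbol u+\rho_f\boldsymbol w,\boldsymbol v)_{\Omega_p}+(\rho_f\boldsymbol u+\rho_w\boldsymbol w,\boldsymbol z)_{\Omega_p}+(\rho_ac^{-2}\varphi,\psi)_{\Omega_a},$$ $$\begin{aligned}\mathcal A_h={}&(\boldsymbol\sigma(\boldsymbol u),\boldsymbol\varepsilon(\boldsymbol v))_{\mathcal T_h^p}-(\{\!\{\boldsymbol\sigma(\boldsymbol u)\}\!\},[\![\boldsymbol v]\!])_{\mathcal F^p}-([\![\boldsymbol u]\!],\{\!\{\boldsymbol\sigma(\boldsymbol v)\}\!\})_{\mathcal F^p}+(\eta_F[\![\boldsymbol u]\!],[\![\boldsymbol v]\!])_{\mathcal F^p}\\ &+(m\nabla\!\cdot\!\boldsymbol X,\nabla\!\cdot\!\boldsymbol Y)_{\mathcal T_h^p}-(\{\!\{m\nabla\!\cdot\!\boldsymbol X\}\!\},[\![\boldsymbol Y]\!]_n)_{\mathcal F^p}-([\![\boldsymbol X]\!]_n,\{\!\{m\nabla\!\cdot\!\boldsymbol Y\}\!\})_{\mathcal F^p}+(\gamma_F[\![\boldsymbol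 X]\!]_n,[\![\boldsymbol Y]\!]_n)_{\mathcal F^p}\\ &-(m\nabla\!\cdot\!\boldsymbol X,j(\boldsymbol v,\boldsymbol z))_{\mathcal F^s}-(j(\boldsymbol u,\boldsymbol w),m\nabla\!\cdot\!\boldsymbol Y)_{\mathcal F^s}+(\gamma_F\,j(\boldsymbol u,\boldsymbol w),j(\boldsymbol v,\boldsymbol z))_{\mathcal F^s}\\ &+(\rho_a\nabla\varphi,\nabla\psi)_{\mathcal T_h^a}-(\{\!\{\rho_a\nabla\varphi\}\!\},[\![\psi]\!])_{\mathcal F^a}-([\![\varphi]\!],\{\!\{\rho_a\nabla\psi\}\!\})_{\mathcal F^a}+(\chi_F[\![\varphi]\!],[\![\psi]\!])_{\mathcal F^a},\end{aligned}$$ $$\mathcal B(\boldsymbol w,\boldsymbol z)=(\eta k^{-1}\boldsymbol w,\boldsymbol z)_{\Omega_p}+(\zeta_\tau\boldsymbol w\cdot\boldsymbol n_p,\boldsymbol z\cdot\boldsymbol n_p)_{\mathcal F^o},\qquad \mathcal C_h(\varphi,\boldsymbol v)=(\rho_a\varphi,\boldsymbol v\cdot\boldsymbol n_p)_{\mathcal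 F^I}.$$ Let $T>0$, $\boldsymbol f,\boldsymbol g\in L^2((0,T];\boldsymbol L^2(\Omega_p))$, $h\in L^2((0,T];L^2(\Omega_a))$. A semi-discrete solution is a $C^1$ function $(\boldsymbol u_h,\boldsymbol w_h,\varphi_h):[0,T]\to\boldsymbol V_h^p\times\boldsymbol V_h^p\times V_h^a$ (with any initial values) whose time derivative is absolutely continuous and which satisfies, for a.e. $t\in(0,T]$ and all $(\boldsymbol v,\boldsymbol z,\psi)\in\boldsymbol V_h^p\times\boldsymbol V_h^p\times V_h^a$, $$\begin{aligned}&\mathcal M((\partial_{tt}\boldsymbol u_h,\partial_{tt}\boldsymbol w_h,\partial_{tt}\varphi_h),(\boldsymbol v,\boldsymbol z,\psi))+\mathcal A_h((\boldsymbol u_h,\boldsymbol w_h,\varphi_h),(\boldsymbol v,\boldsymbol z,\psi))+\mathcal B(\partial_t\boldsymbol w_h,\boldsymbol z)\\&\quad+\mathcal C_h(\partial_t\varphi_h,\boldsymbol v+\boldsymbol z)-\mathcal C_h(\psi,\partial_t(\boldsymbol u_h+\boldsymbol w_h))=(\boldsymbol f,\boldsymbol v)_{\Omega_p}+(\boldsymbol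 g,\boldsymbol z)_{\Omega_p}+(h,\psi)_{\Omega_a}.\end{aligned}$$ **Energy norm.** $$\begin{aligned}\|(\boldsymbol u,\boldsymbol w,\varphi)(t)\|_{\mathbb E}^2={}&\|\rho_u^{1/2}\partial_t\boldsymbol u(t)\|_{\Omega_p}^2+\|(\rho_f\phi)^{1/2}\partial_t(\boldsymbol u+\phi^{-1}\boldsymbol w)(t)\|_{\Omega_p}^2+\|\mathbb D^{1/2}\boldsymbol\varepsilon(\boldsymbol u(t))\|_{\mathcal T_h^p}^2+\|\eta_F^{1/2}[\![\boldsymbol u(t)]\!]\|_{\mathcal F^p}^2\\ &+\|m^{1/2}\nabla\!\cdot(\beta\boldsymbol u+\boldsymbol w)(t)\|_{\mathcal T_h^p}^2+\|\gamma_F^{1/2}[\![(\beta\boldsymbol u+\boldsymbol w)(t)]\!]_n\|_{\mathcal F^p}^2+\|(\eta/k)^{1/2}\boldsymbol w(0)\|_{\Omega_p}^2\\ &+\int_0^t\|(\eta/k)^{1/2}\partial_t\boldsymbol w(s)\|_{\Omega_p}^2ds+\|\rho_a^{1/2}c^{-1}\partial_t\varphi(t)\|_{\Omega_a}^2+\|\rho_a^{1/2}\nabla\varphi(t)\|_{\mathcal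 T_h^a}^2+\|\chi_F^{1/2}[\![\varphi(t)]\!]\|_{\mathcal F^a}^2\\ &+\|\gamma_F^{1/2}j(\boldsymbol u(t),\boldsymbol w(t))\|_{\mathcal F^s}^2+\int_0^t\|\zeta_\tau^{1/2}\partial_t\boldsymbol w(s)\cdot\boldsymbol n_p\|_{\mathcal F^o}^2ds.\end{aligned}$$ **Proposition.** Given $d$ and $c_{\rm reg}$ there are thresholds $\sigma_*,m_*,\rho_*>0$, and given moreover $\underline c,\overline c$ there is a function $C:\mathbb R\to(0,\infty)$, such that for every such mesh, degrees, coefficients, $\tau$, for both choices (A), (B), for all $\sigma_0\ge\sigma_*$, $m_0\ge m_*$, $\rho_0\ge\rho_*$, all $T$ and all sources, every semi-discrete solution satisfies for all $t\in(0,T]$ $$\|(\boldsymbol u_h,\boldsymbol w_h,\varphi_h)(t)\|_{\mathbb E}^2\le C(t)\Big(\|(\boldsymbol u_h,\boldsymbol w_h,\varphi_h)(0)\|_{\mathbb E}^2+\int_0^t\big(\|\boldsymbol f(s)\|_{\Omega_p}^2+\|\boldsymbol g(s)\|_{\Omega_p}^2+\|h(s)\|_{\Omega_a}^2\big)ds\Big).$$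 In particular $C(t)$ depends only on $t,d,c_{\rm reg}$ and the material bounds, not on $\tau$, the mesh, the degrees or the penalty parameters. The scheme is dissipative: if $\boldsymbol f=\boldsymbol g=0$ and $h=0$, then $\|(\boldsymbol u_h,\boldsymbol w_h,\varphi_h)(t)\|_{\mathbb E}\le C(t)\,\|(\boldsymbol u_h,\boldsymbol w_h,\varphi_h)(0)\|_{\mathbb E}$. -/

import Mathlib

open MeasureTheory Set Topology
open scoped BigOperators

noncomputable section

namespace PoroAcoustic

/-! ## Polytopic meshes -/

/-- Points of `ℝ^d` with the Euclidean norm. -/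
abbrev Pt (d : ℕ) := EuclideanSpace ℝ (Fin d)

/-- Real polynomials in the `d` space variables. -/
abbrev Poly (d : ℕ) := MvPolynomial (Fin d) ℝ

/-- A polytopic mesh in `ℝ^d`. The elements `cell κ` are bounded connected open sets whose
boundary is the union of the mesh faces adjacent to `κ`; the faces are nondegenerate
`(d-1)`-simplices (segments if `d = 2`, planar triangles if `d = 3`) with pairwise disjoint relative
interiors. A face `F` lies on the boundary of `plus F` (the element `κ⁺`) and, when it is an
internal face, of a second element `κ⁻`, in which case `minus F = some κ⁻`; for a boundary face
`minus F = none`. `normal F` is the unit normal `n⁺` of `F` that points out of `κ⁺` (so `n⁻ = -n⁺`).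
Hanging nodes are allowed, and neither the number nor the size of the faces of an element is
restricted. -/
structure PolytopicMesh (d : ℕ) where
  Elem : Type
  Face : Type
  [fintypeElem : Fintype Elem]
  [fintypeFace : Fintype Face]
  cell : Elem → Set (Pt d)
  face : Face → Affine.Simplex ℝ (Pt d) (d - 1)
  plus : Face → Elem
  minus : Face → Option Elem
  normal : Face → Pt d
  isOpen_cell : ∀ κ, IsOpen (cell κ)
  isConnected_cell : ∀ κ, IsConnected (cell κ)
  isBounded_cell : ∀ κ, Bornology.IsBounded (cell κ)
  disjoint_cell : Pairwise fun κ κ' => Disjoint (cell κ) (cell κ')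
  minus_ne_plus : ∀ F, minus F ≠ some (plus F)
  frontier_cell : ∀ κ, frontier (cell κ) =
    ⋃ F ∈ {F | plus F = κ ∨ minus F = some κ}, (face F).closedInterior
  disjoint_face : Pairwise fun F G => Disjoint (face F).interior (face G).interior
  norm_normal : ∀ F, ‖normal F‖ = 1
  normal_orthogonal : ∀ F i j, inner ℝ (normal F) ((face F).points i - (face F).points j) = 0
  normal_plus : ∀ F, ∀ x ∈ (face F).interior,
    ∀ᶠ s : ℝ in 𝓝[>] 0, x - s • normal F ∈ cell (plus F)
  normal_minus : ∀ F κ, minus F = some κ → ∀ x ∈ (face F).interior,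
    ∀ᶠ s : ℝ in 𝓝[>] 0, x + s • normal F ∈ cell κ
  normal_boundary : ∀ F, minus F = none → ∀ x ∈ (face F).interior,
    ∀ᶠ s : ℝ in 𝓝[>] 0, x + s • normal F ∉ ⋃ κ, closure (cell κ)

attribute [instance] PolytopicMesh.fintypeElem PolytopicMesh.fintypeFace

/-- The mesh faces contained in the boundary of the element `κ`. -/
def PolytopicMesh.facesOf {d : ℕ} (M : PolytopicMesh d) (κ : M.Elem) : Set M.Face :=
  {F | M.plus F = κ ∨ M.minus F = some κ}

/-- The diameter `h_κ`. -/
def PolytopicMesh.diam {d : ℕ} (M : PolytopicMesh d) (κ : M.Elem) : ℝ :=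
  Metric.diam (M.cell κ)

/-- Polytopic regularity with constant `c`: for each element `κ` there are non-overlapping
`d`-simplices `S_κ^F ⊆ closure κ`, one for each face `F` of `κ`, such that `F` is a face of `S_κ^F`
and `h_κ ≤ c * d * |S_κ^F| / |F|`. Here `μHE[d-1]` is the `(d-1)`-dimensional surface measure. -/
def PolytopicMesh.IsPolytopicRegular {d : ℕ} (M : PolytopicMesh d) (c : ℝ) : Prop :=
  ∀ κ : M.Elem, ∃ S : M.Face → Affine.Simplex ℝ (Pt d) d,
    (∀ F ∈ M.facesOf κ,
      range (M.face F).points ⊆ range (S F).points ∧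
      (S F).closedInterior ⊆ closure (M.cell κ) ∧
      M.diam κ ≤ c * (d * volume.real (S F).closedInterior
        * (μHE[d - 1].real (M.face F).closedInterior)⁻¹)) ∧
    (∀ F ∈ M.facesOf κ, ∀ G ∈ M.facesOf κ, F ≠ G → Disjoint (S F).interior (S G).interior)

/-- The mesh of the coupled problem, with its polynomial degrees. The elements in `poro` form the
mesh of the poro-elastic domain `Ω_p`, all others form the mesh of the acoustic domain `Ω_a`.
`dirichlet` is the set of boundary faces on `Γ_pD ∪ Γ_aD`; the other boundary faces are on
`Γ_pN ∪ Γ_aN`. The faces between a poro-elastic and an acoustic element form the interface; the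
labelling `κ⁺`, `κ⁻` of their two elements is chosen such that `κ⁺` is the poro-elastic one, so
that `normal` equals `n_p` on the interface. `deg` is the degree `p_h` on `Ω_p` and `r_h` on
`Ω_a`. -/
structure CoupledMesh (d : ℕ) extends PolytopicMesh d where
  poro : Set Elem
  dirichlet : Set Face
  dirichlet_boundary : ∀ F ∈ dirichlet, minus F = none
  interface_plus : ∀ F κ, minus F = some κ → κ ∈ poro → plus F ∈ poro
  deg : Elem → ℕ
  one_le_deg : ∀ κ, 1 ≤ deg κ

namespace CoupledMesh

variable {d : ℕ} (M : CoupledMesh d)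

open Classical in
/-- The elements of `𝒯_h^p`. -/
def poroElems : Finset M.Elem := Finset.univ.filter fun κ => κ ∈ M.poro

open Classical in
/-- The elements of `𝒯_h^a`. -/
def acouElems : Finset M.Elem := Finset.univ.filter fun κ => κ ∉ M.poro

/-- The poro-elastic domain `Ω_p`, up to the mesh skeleton, which has measure zero. -/
def poroDomain : Set (Pt d) := ⋃ κ ∈ M.poroElems, M.cell κ

/-- The acoustic domain `Ω_a`, up to the mesh skeleton, which has measure zero. -/
def acouDomain : Set (Pt d) := ⋃ κ ∈ M.acouElems, M.cell κ

open Classical in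
/-- `ℱ_h^{pi} ∪ ℱ_h^{pD}`: internal faces between two poro-elastic elements, and Dirichlet faces
of `Ω_p`. -/
def poroFaces : Finset M.Face := Finset.univ.filter fun F =>
  M.plus F ∈ M.poro ∧ ((∃ κ ∈ M.poro, M.minus F = some κ) ∨ F ∈ M.dirichlet)

open Classical in
/-- `ℱ_h^{ai} ∪ ℱ_h^{aD}`: internal faces between two acoustic elements, and Dirichlet faces of
`Ω_a`. -/
def acouFaces : Finset M.Face := Finset.univ.filter fun F =>
  M.plus F ∉ M.poro ∧ ((∃ κ, κ ∉ M.poro ∧ M.minus F = some κ) ∨ F ∈ M.dirichlet)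

open Classical in
/-- The interface faces `ℱ_h^I`. -/
def interfaceFaces : Finset M.Face := Finset.univ.filter fun F =>
  M.plus F ∈ M.poro ∧ ∃ κ, κ ∉ M.poro ∧ M.minus F = some κ

open Classical in
/-- The sealed interface faces `ℱ_h^{Is}`, where the permeability `τ` vanishes. -/
def sealedFaces (τ : M.Face → ℝ) : Finset M.Face := M.interfaceFaces.filter fun F => τ F = 0

open Classical in
/-- The remaining interface faces `ℱ_h^{Io}`. -/
def openFaces (τ : M.Face → ℝ) : Finset M.Face := M.interfaceFaces.filter fun F => τ F ≠ 0

/-! ## Piecewise polynomials, jumps and averages -/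

/-- Elementwise polynomial scalar functions. -/
abbrev SField := M.Elem → Poly d

/-- Elementwise polynomial vector fields. -/
abbrev VField := M.Elem → Fin d → Poly d

/-- `v ∈ 𝑽_h^p`: total degree at most `p_κ` on the elements of `𝒯_h^p`, and `v` is extended by
zero to the other elements. -/
def IsPoroDiscrete (v : M.VField) : Prop :=
  (∀ κ ∈ M.poro, ∀ i, (v κ i).totalDegree ≤ M.deg κ) ∧ ∀ κ, κ ∉ M.poro → v κ = 0

/-- `ψ ∈ V_h^a`: total degree at most `r_κ` on the elements of `𝒯_h^a`, and `ψ` is extended by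
zero to the other elements. -/
def IsAcouDiscrete (ψ : M.SField) : Prop :=
  (∀ κ, κ ∉ M.poro → (ψ κ).totalDegree ≤ M.deg κ) ∧ ∀ κ ∈ M.poro, ψ κ = 0

end CoupledMesh

/-- The value of a polynomial at a point. -/
def val {d : ℕ} (q : Poly d) (x : Pt d) : ℝ := MvPolynomial.eval (fun i => x i) q

namespace CoupledMesh

variable {d : ℕ} (M : CoupledMesh d)

/-- The elementwise divergence. -/
def dvg (v : M.VField) : M.SField := fun κ => ∑ i, MvPolynomial.pderiv i (v κ i)

/-- The elementwise gradient. -/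
def grad (ψ : M.SField) : M.VField := fun κ i => MvPolynomial.pderiv i (ψ κ)

/-- The elementwise symmetric gradient `ε(v)`. -/
def strain (v : M.VField) (i j : Fin d) : M.SField := fun κ =>
  MvPolynomial.C (1 / 2) * (MvPolynomial.pderiv j (v κ i) + MvPolynomial.pderiv i (v κ j))

/-- The sum `ψ⁺ν⁺ + ψ⁻ν⁻` over the elements that share `F`, at a point of `F`, along one coordinate
of the normals: component `i` of `⟦ψ⟧`. On a boundary face this is `ψ n`. -/
def jump (ψ : M.SField) (F : M.Face) (i : Fin d) (x : Pt d) : ℝ :=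
  match M.minus F with
  | none => val (ψ (M.plus F)) x * M.normal F i
  | some κ => val (ψ (M.plus F)) x * M.normal F i + val (ψ κ) x * (-M.normal F i)

/-- The tensor jump `⟦v⟧ = v⁺ ⊗ n⁺ + v⁻ ⊗ n⁻`, component `(i, j)`. -/
def jumpT (v : M.VField) (F : M.Face) (i j : Fin d) (x : Pt d) : ℝ :=
  M.jump (fun κ => v κ i) F j x

/-- The normal jump `⟦v⟧_n = v⁺ · n⁺ + v⁻ · n⁻`. -/
def jumpN (v : M.VField) (F : M.Face) (x : Pt d) : ℝ :=
  ∑ i, M.jump (fun κ => v κ i) F i x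

/-- The average `(ψ⁺ + ψ⁻)/2`; on a boundary face this is `ψ`. -/
def avg (ψ : M.SField) (F : M.Face) (x : Pt d) : ℝ :=
  match M.minus F with
  | none => val (ψ (M.plus F)) x
  | some κ => (val (ψ (M.plus F)) x + val (ψ κ) x) / 2

/-- `v · n⁺`, with the trace of `v` taken from `κ⁺`; on the interface this is `v · n_p`. -/
def flux (v : M.VField) (F : M.Face) (x : Pt d) : ℝ :=
  ∑ i, val (v (M.plus F) i) x * M.normal F i

/-- The trace of `ψ` from the element `κ⁻`; on the interface this is the acoustic side. -/
def traceMinus (ψ : M.SField) (F : M.Face) (x : Pt d) : ℝ :=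
  match M.minus F with
  | none => 0
  | some κ => val (ψ κ) x

/-- The integral over an element. -/
def cellInt (κ : M.Elem) (q : Pt d → ℝ) : ℝ := ∫ x in M.cell κ, q x

/-- The surface integral over a face. -/
def faceInt (F : M.Face) (q : Pt d → ℝ) : ℝ := ∫ x in (M.face F).closedInterior, q x ∂μHE[d - 1]

/-- The maximum of an elementwise quantity over the elements that share the face. -/
def faceMax (q : M.Elem → ℝ) (F : M.Face) : ℝ :=
  match M.minus F with
  | none => q (M.plus F)
  | some κ => max (q (M.plus F)) (q κ)

end CoupledMesh

/-! ## Material coefficients -/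

/-- The coefficients, constant on each element: fluid and solid densities, porosity, tortuosity,
Biot coefficient, Lamé parameters, dynamic viscosity, absolute permeability and Biot modulus (used
on the poro-elastic elements), and density and wave velocity of the acoustic medium (used on the
acoustic elements). -/
structure Coeffs {d : ℕ} (M : CoupledMesh d) where
  rhoF : M.Elem → ℝ
  rhoS : M.Elem → ℝ
  phi : M.Elem → ℝ
  tort : M.Elem → ℝ
  beta : M.Elem → ℝ
  lam : M.Elem → ℝ
  mu : M.Elem → ℝ
  visc : M.Elem → ℝ
  perm : M.Elem → ℝ
  biot : M.Elem → ℝ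
  rhoA : M.Elem → ℝ
  vel : M.Elem → ℝ

/-- The three penalty parameters `σ₀`, `m₀`, `ρ₀`. -/
structure Penalties where
  sigma0 : ℝ
  m0 : ℝ
  rho0 : ℝ

/-- The two ways to impose the condition `w · n_p = 0` weakly on the sealed part of the interface:
the terms on `ℱ_h^{Is}` act on `w · n_p`, or on `(β u + w) · n_p`. -/
inductive SealedTerm
  | filtration
  | total

/-- `|𝔻^{1/2}|²`, i.e. the maximum of `ε : 𝔻 ε = |𝔻^{1/2} ε|²` over symmetric tensors `ε` of unit
Frobenius norm, where `𝔻 ε = λ tr(ε) I + 2 μ ε`. -/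
def stiffnessNorm (d : ℕ) (lam mu : ℝ) : ℝ :=
  sSup {r | ∃ e : Fin d → Fin d → ℝ, (∀ i j, e i j = e j i) ∧ ∑ i, ∑ j, e i j ^ 2 = 1 ∧
    r = ∑ i, ∑ j, (lam * (∑ k, e k k) * (if i = j then 1 else 0) + 2 * mu * e i j) * e i j}

namespace Coeffs

variable {d : ℕ} {M : CoupledMesh d} (c : Coeffs M)

/-- Average density `ρ = φ ρ_f + (1 - φ) ρ_s`. -/
def rho (κ : M.Elem) : ℝ := c.phi κ * c.rhoF κ + (1 - c.phi κ) * c.rhoS κ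

/-- `ρ_w = a φ⁻¹ ρ_f`. -/
def rhoW (κ : M.Elem) : ℝ := c.tort κ * (c.phi κ)⁻¹ * c.rhoF κ

/-- `ρ_u = ρ_s (1 - φ) / 2`. -/
def rhoU (κ : M.Elem) : ℝ := c.rhoS κ * (1 - c.phi κ) / 2

/-- The physical requirements on the coefficients, together with the bounds `lo` and `hi` on which
the stability constant may depend. -/
structure IsAdmissible (lo hi : ℝ) : Prop where
  poro_pos : ∀ κ ∈ M.poro, 0 < c.rhoF κ ∧ 0 < c.rhoS κ ∧ 0 < c.lam κ ∧ 0 < c.mu κ ∧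
    0 < c.visc κ ∧ 0 < c.perm κ ∧ 0 < c.biot κ
  phi_mem : ∀ κ ∈ M.poro, 0 < c.phi κ ∧ c.phi κ < 1
  one_lt_tort : ∀ κ ∈ M.poro, 1 < c.tort κ
  beta_mem : ∀ κ ∈ M.poro, 0 < c.beta κ ∧ c.beta κ ≤ 1
  acou_pos : ∀ κ, κ ∉ M.poro → 0 < c.rhoA κ ∧ 0 < c.vel κ
  poro_bounds : ∀ κ ∈ M.poro, lo ≤ c.rhoU κ ∧ lo ≤ c.visc κ / c.perm κ ∧
    c.rhoF κ ≤ hi ∧ c.tort κ ≤ hi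
  acou_bounds : ∀ κ, κ ∉ M.poro → lo ≤ c.rhoA κ / c.vel κ ^ 2

/-- The stress `σ(u) = λ (∇·u) I + 2 μ ε(u)`, elementwise. -/
def stress (v : M.VField) (i j : Fin d) : M.SField := fun κ =>
  MvPolynomial.C (c.lam κ) * M.dvg v κ * (if i = j then 1 else 0)
    + MvPolynomial.C (2 * c.mu κ) * M.strain v i j κ

/-- `m ∇·v`, elementwise. -/
def mDvg (v : M.VField) : M.SField := fun κ => MvPolynomial.C (c.biot κ) * M.dvg v κ

/-- `β u + w`, elementwise. -/
def tot (u w : M.VField) : M.VField := fun κ i => MvPolynomial.C (c.beta κ) * u κ i + w κ i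

/-- `ρ_a ∇ψ`, elementwise. -/
def rhoGrad (ψ : M.SField) : M.VField := fun κ i => MvPolynomial.C (c.rhoA κ) * M.grad ψ κ i

/-- `ρ_a ψ`, elementwise. -/
def rhoMul (ψ : M.SField) : M.SField := fun κ => MvPolynomial.C (c.rhoA κ) * ψ κ

/-- The penalization function `η` of the elastic form. -/
def etaPen (P : Penalties) (F : M.Face) : ℝ :=
  P.sigma0 * M.faceMax
    (fun κ => stiffnessNorm d (c.lam κ) (c.mu κ) * (M.deg κ : ℝ) ^ 2 * (M.diam κ)⁻¹) F

/-- The penalization function `γ` on internal and Dirichlet faces of `Ω_p`. -/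
def gammaPen (P : Penalties) (F : M.Face) : ℝ :=
  P.m0 * M.faceMax (fun κ => c.biot κ * (M.deg κ : ℝ) ^ 2 * (M.diam κ)⁻¹) F

/-- The penalization function `γ` on sealed interface faces, which are boundary faces of `Ω_p`:
only the poro-elastic element counts. -/
def gammaSealed (P : Penalties) (F : M.Face) : ℝ :=
  P.m0 * (c.biot (M.plus F) * (M.deg (M.plus F) : ℝ) ^ 2 * (M.diam (M.plus F))⁻¹)

/-- The penalization function `χ` of the acoustic form. -/
def chiPen (P : Penalties) (F : M.Face) : ℝ :=
  P.rho0 * M.faceMax (fun κ => c.rhoA κ * (M.deg κ : ℝ) ^ 2 * (M.diam κ)⁻¹) F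

/-- The normal component that the sealed-face terms act on. -/
def sealedFlux (S : SealedTerm) (u w : M.VField) (F : M.Face) (x : Pt d) : ℝ :=
  match S with
  | .filtration => M.flux w F x
  | .total => M.flux (c.tot u w) F x

/-! ## The bilinear forms -/

/-- `ℳ((u,w,φ),(v,z,ψ))`. -/
def massForm (u w : M.VField) (φ : M.SField) (v z : M.VField) (ψ : M.SField) : ℝ :=
  ∑ κ ∈ M.poroElems, M.cellInt κ (fun x => ∑ i,
    ((c.rho κ * val (u κ i) x + c.rhoF κ * val (w κ i) x) * val (v κ i) x
      + (c.rhoF κ * val (u κ i) x + c.rhoW κ * val (w κ i) x) * val (z κ i) x))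
  + ∑ κ ∈ M.acouElems, M.cellInt κ (fun x =>
      c.rhoA κ * (c.vel κ ^ 2)⁻¹ * val (φ κ) x * val (ψ κ) x)

/-- `𝒜_h^e(u,v)`. -/
def elasticForm (P : Penalties) (u v : M.VField) : ℝ :=
  ∑ κ ∈ M.poroElems, M.cellInt κ (fun x =>
      ∑ i, ∑ j, val (c.stress u i j κ) x * val (M.strain v i j κ) x)
  - ∑ F ∈ M.poroFaces, M.faceInt F (fun x =>
      ∑ i, ∑ j, M.avg (c.stress u i j) F x * M.jumpT v F i j x)
  - ∑ F ∈ M.poroFaces, M.faceInt F (fun x =>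
      ∑ i, ∑ j, M.jumpT u F i j x * M.avg (c.stress v i j) F x)
  + ∑ F ∈ M.poroFaces, M.faceInt F (fun x =>
      c.etaPen P F * ∑ i, ∑ j, M.jumpT u F i j x * M.jumpT v F i j x)

/-- The pore-pressure form applied to `β u + w` and `β v + z`, with its terms on the sealed part of
the interface. -/
def poreForm (P : Penalties) (S : SealedTerm) (τ : M.Face → ℝ) (u w v z : M.VField) : ℝ :=
  ∑ κ ∈ M.poroElems, M.cellInt κ (fun x =>
      c.biot κ * val (M.dvg (c.tot u w) κ) x * val (M.dvg (c.tot v z) κ) x)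
  - (∑ F ∈ M.poroFaces, M.faceInt F (fun x =>
        M.avg (c.mDvg (c.tot u w)) F x * M.jumpN (c.tot v z) F x)
     + ∑ F ∈ M.sealedFaces τ, M.faceInt F (fun x =>
        val (c.mDvg (c.tot u w) (M.plus F)) x * c.sealedFlux S v z F x))
  - (∑ F ∈ M.poroFaces, M.faceInt F (fun x =>
        M.jumpN (c.tot u w) F x * M.avg (c.mDvg (c.tot v z)) F x)
     + ∑ F ∈ M.sealedFaces τ, M.faceInt F (fun x =>
        c.sealedFlux S u w F x * val (c.mDvg (c.tot v z) (M.plus F)) x))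
  + (∑ F ∈ M.poroFaces, M.faceInt F (fun x =>
        c.gammaPen P F * M.jumpN (c.tot u w) F x * M.jumpN (c.tot v z) F x)
     + ∑ F ∈ M.sealedFaces τ, M.faceInt F (fun x =>
        c.gammaSealed P F * c.sealedFlux S u w F x * c.sealedFlux S v z F x))

/-- `𝒜_h^a(φ,ψ)`. -/
def acousticForm (P : Penalties) (φ ψ : M.SField) : ℝ :=
  ∑ κ ∈ M.acouElems, M.cellInt κ (fun x =>
      ∑ i, val (c.rhoGrad φ κ i) x * val (M.grad ψ κ i) x)
  - ∑ F ∈ M.acouFaces, M.faceInt F (fun x =>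
      ∑ i, M.avg (fun κ => c.rhoGrad φ κ i) F x * M.jump ψ F i x)
  - ∑ F ∈ M.acouFaces, M.faceInt F (fun x =>
      ∑ i, M.jump φ F i x * M.avg (fun κ => c.rhoGrad ψ κ i) F x)
  + ∑ F ∈ M.acouFaces, M.faceInt F (fun x =>
      c.chiPen P F * ∑ i, M.jump φ F i x * M.jump ψ F i x)

/-- `𝒜_h((u,w,φ),(v,z,ψ))`. -/
def stiffForm (P : Penalties) (S : SealedTerm) (τ : M.Face → ℝ)
    (u w : M.VField) (φ : M.SField) (v z : M.VField) (ψ : M.SField) : ℝ :=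
  c.elasticForm P u v + c.poreForm P S τ u w v z + c.acousticForm P φ ψ

/-- `ℬ(w,z) = (η k⁻¹ w, z)_{Ω_p} + (ζ_τ w·n_p, z·n_p)` with `ζ_τ = τ⁻¹ (1 - τ)`. -/
def dampForm (τ : M.Face → ℝ) (w z : M.VField) : ℝ :=
  ∑ κ ∈ M.poroElems, M.cellInt κ (fun x =>
      c.visc κ / c.perm κ * ∑ i, val (w κ i) x * val (z κ i) x)
  + ∑ F ∈ M.openFaces τ, M.faceInt F (fun x =>
      (τ F)⁻¹ * (1 - τ F) * M.flux w F x * M.flux z F x)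

/-- `𝒞_h(φ,v) = (ρ_a φ, v·n_p)` on the interface. -/
def couplingForm (φ : M.SField) (v : M.VField) : ℝ :=
  ∑ F ∈ M.interfaceFaces, M.faceInt F (fun x =>
    M.traceMinus (c.rhoMul φ) F x * M.flux v F x)

/-! ## Energy -/

/-- `‖v‖²_{DG,e}`; here `|𝔻^{1/2} ε(v)|² = σ(v) : ε(v)`. -/
def dgElastic (P : Penalties) (v : M.VField) : ℝ :=
  ∑ κ ∈ M.poroElems, M.cellInt κ (fun x =>
      ∑ i, ∑ j, val (c.stress v i j κ) x * val (M.strain v i j κ) x)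
  + ∑ F ∈ M.poroFaces, M.faceInt F (fun x =>
      c.etaPen P F * ∑ i, ∑ j, M.jumpT v F i j x ^ 2)

/-- `|z|²_{DG,p}`. -/
def dgPore (P : Penalties) (z : M.VField) : ℝ :=
  ∑ κ ∈ M.poroElems, M.cellInt κ (fun x => c.biot κ * val (M.dvg z κ) x ^ 2)
  + ∑ F ∈ M.poroFaces, M.faceInt F (fun x => c.gammaPen P F * M.jumpN z F x ^ 2)

/-- `‖ψ‖²_{DG,a}`. -/
def dgAcoustic (P : Penalties) (ψ : M.SField) : ℝ :=
  ∑ κ ∈ M.acouElems, M.cellInt κ (fun x => c.rhoA κ * ∑ i, val (M.grad ψ κ i) x ^ 2)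
  + ∑ F ∈ M.acouFaces, M.faceInt F (fun x =>
      c.chiPen P F * ∑ i, M.jump ψ F i x ^ 2)

end Coeffs

/-! ## The semi-discrete problem -/

/-- The discrete unknowns `(u_h, w_h, φ_h)` as functions of time, with their first and second time
derivatives. -/
structure Traj {d : ℕ} (M : CoupledMesh d) where
  u : ℝ → M.VField
  w : ℝ → M.VField
  φ : ℝ → M.SField
  ut : ℝ → M.VField
  wt : ℝ → M.VField
  φt : ℝ → M.SField
  utt : ℝ → M.VField
  wtt : ℝ → M.VField
  φtt : ℝ → M.SField

/-- The polynomial-valued function `q` of time is absolutely continuous on `[0,T]` (coefficient by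
coefficient) with a.e. derivative `qt`. -/
def IsPrimitive {d : ℕ} (T : ℝ) (q qt : ℝ → Poly d) : Prop :=
  ∀ α, IntervalIntegrable (fun s => (qt s).coeff α) volume 0 T ∧
    ∀ t ∈ Icc 0 T, (q t).coeff α = (q 0).coeff α + ∫ s in (0 : ℝ)..t, (qt s).coeff α

/-- `X` solves the semi-discrete problem on `[0,T]` with sources `f`, `g`, `h`: the unknowns are
continuously differentiable in time, with absolutely continuous first time derivative, take values
in `𝑽_h^p × 𝑽_h^p × V_h^a`, and satisfy the variational equation at almost every time (the sources
are only square integrable in time). The initial data may be any elements of the discrete spaces. -/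
structure IsSolution {d : ℕ} {M : CoupledMesh d} (c : Coeffs M) (P : Penalties) (S : SealedTerm)
    (τ : M.Face → ℝ) (T : ℝ) (f g : ℝ → Pt d → Pt d) (h : ℝ → Pt d → ℝ) (X : Traj M) : Prop where
  u_mem : ∀ t ∈ Icc 0 T, M.IsPoroDiscrete (X.u t)
  w_mem : ∀ t ∈ Icc 0 T, M.IsPoroDiscrete (X.w t)
  φ_mem : ∀ t ∈ Icc 0 T, M.IsAcouDiscrete (X.φ t)
  u_deriv : ∀ κ i, IsPrimitive T (fun t => X.u t κ i) (fun t => X.ut t κ i)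
  w_deriv : ∀ κ i, IsPrimitive T (fun t => X.w t κ i) (fun t => X.wt t κ i)
  φ_deriv : ∀ κ, IsPrimitive T (fun t => X.φ t κ) (fun t => X.φt t κ)
  ut_deriv : ∀ κ i, IsPrimitive T (fun t => X.ut t κ i) (fun t => X.utt t κ i)
  wt_deriv : ∀ κ i, IsPrimitive T (fun t => X.wt t κ i) (fun t => X.wtt t κ i)
  φt_deriv : ∀ κ, IsPrimitive T (fun t => X.φt t κ) (fun t => X.φtt t κ)
  equation : ∀ᵐ t ∂(volume.restrict (Ioc 0 T)), ∀ (v z : M.VField) (ψ : M.SField),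
    M.IsPoroDiscrete v → M.IsPoroDiscrete z → M.IsAcouDiscrete ψ →
      c.massForm (X.utt t) (X.wtt t) (X.φtt t) v z ψ
        + c.stiffForm P S τ (X.u t) (X.w t) (X.φ t) v z ψ
        + c.dampForm τ (X.wt t) z
        + (c.couplingForm (X.φt t) (v + z) - c.couplingForm ψ (X.ut t + X.wt t))
      = ∑ κ ∈ M.poroElems, M.cellInt κ (fun x => ∑ i, f t x i * val (v κ i) x)
        + ∑ κ ∈ M.poroElems, M.cellInt κ (fun x => ∑ i, g t x i * val (z κ i) x)
        + ∑ κ ∈ M.acouElems, M.cellInt κ (fun x => h t x * val (ψ κ) x)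

/-- The square of the energy norm `‖(u,w,φ)(t)‖_𝔼`. The sealed-face term measures the same normal
component that the scheme penalizes there. -/
def energySq {d : ℕ} {M : CoupledMesh d} (c : Coeffs M) (P : Penalties) (S : SealedTerm)
    (τ : M.Face → ℝ) (X : Traj M) (t : ℝ) : ℝ :=
  ∑ κ ∈ M.poroElems, M.cellInt κ (fun x => c.rhoU κ * ∑ i, val (X.ut t κ i) x ^ 2)
  + ∑ κ ∈ M.poroElems, M.cellInt κ (fun x => c.rhoF κ * c.phi κ *
      ∑ i, (val (X.ut t κ i) x + (c.phi κ)⁻¹ * val (X.wt t κ i) x) ^ 2)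
  + c.dgElastic P (X.u t)
  + c.dgPore P (c.tot (X.u t) (X.w t))
  + ∑ κ ∈ M.poroElems, M.cellInt κ (fun x =>
      c.visc κ / c.perm κ * ∑ i, val (X.w 0 κ i) x ^ 2)
  + (∫ s in (0 : ℝ)..t, ∑ κ ∈ M.poroElems, M.cellInt κ (fun x =>
      c.visc κ / c.perm κ * ∑ i, val (X.wt s κ i) x ^ 2))
  + ∑ κ ∈ M.acouElems, M.cellInt κ (fun x =>
      c.rhoA κ * (c.vel κ ^ 2)⁻¹ * val (X.φt t κ) x ^ 2)
  + c.dgAcoustic P (X.φ t)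
  + ∑ F ∈ M.sealedFaces τ, M.faceInt F (fun x =>
      c.gammaSealed P F * c.sealedFlux S (X.u t) (X.w t) F x ^ 2)
  + (∫ s in (0 : ℝ)..t, ∑ F ∈ M.openFaces τ, M.faceInt F (fun x =>
      (τ F)⁻¹ * (1 - τ F) * M.flux (X.wt s) F x ^ 2))

/-- The energy norm `‖(u,w,φ)(t)‖_𝔼`. -/
def energyNorm {d : ℕ} {M : CoupledMesh d} (c : Coeffs M) (P : Penalties) (S : SealedTerm)
    (τ : M.Face → ℝ) (X : Traj M) (t : ℝ) : ℝ :=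
  Real.sqrt (energySq c P S τ X t)

/-- The source terms are in `L²((0,T]; L²)`. -/
structure IsSource {d : ℕ} (M : CoupledMesh d) (T : ℝ)
    (f g : ℝ → Pt d → Pt d) (h : ℝ → Pt d → ℝ) : Prop where
  f_mem : MemLp (fun y : ℝ × Pt d => f y.1 y.2) 2
    ((volume.restrict (Ioc 0 T)).prod (volume.restrict M.poroDomain))
  g_mem : MemLp (fun y : ℝ × Pt d => g y.1 y.2) 2
    ((volume.restrict (Ioc 0 T)).prod (volume.restrict M.poroDomain))
  h_mem : MemLp (fun y : ℝ × Pt d => h y.1 y.2) 2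
    ((volume.restrict (Ioc 0 T)).prod (volume.restrict M.acouDomain))

end PoroAcoustic

end

/-! The proof is the energy method, combined with an equivalence between the discrete energy and the
energy norm whose constants do not see the mesh, the degrees, `τ` or the penalty parameters.

Energy balance. Testing the scheme with the velocity `(ut, wt, φt)` makes the two coupling terms
cancel. Since `ℳ` and `𝒜_h` are symmetric, half of `ℳ(velocity, velocity) + 𝒜_h(state, state)` has
as derivative the power of the sources minus the damping `ℬ(wt, wt)` (`isScalarPrimitive_energy`).
By Young's inequality `f` and `h` are paid for by kinetic energy and `g` by half of the viscous
damping (`source_le`), and Gronwall's inequality gives the factor `exp t` (`energy_le`). The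
velocity is only absolutely continuous in time, so all of this is done with primitives: paths in
finite-dimensional spaces of polynomials and a product rule for bilinear forms (`IsPath.bilin`).

Kinetic energy. Completing the square in the poro-elastic mass density leaves a remainder that is
nonnegative because `a > 1`, and that is bounded by the kinetic part of the norm uniformly in the
porosity (`kinetic_le_massForm`, `massForm_le_kinetic`).

Potential energy. On the diagonal, `𝒜_h` differs from the squared DG norms only by twice the
consistency terms on the faces. These are at most half of the norms once the penalties exceed a
threshold (`abs_consistency_le`, `abs_stiffForm_sub_le`). The tool is a trace inequality that is
quadratic in the degree and independent of the shape of the elements: an end-point bound for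
univariate polynomials from Legendre expansion (`sq_eval_zero_le`), integrated along the segments
from a face to the opposite vertex of a simplex (`simplex_trace`), then summed over the
non-overlapping simplices of an element (`IsPolytopicRegular.trace`). The disjointness of these
simplices makes the number of faces irrelevant. -/

noncomputable section

namespace PoroAcoustic

/-! ## A one-dimensional trace inequality for polynomials -/

section Legendre

open Polynomial

/-- The shifted Legendre polynomial with real coefficients. -/
def legendre (n : ℕ) : ℝ[X] := (shiftedLegendre n).map (Int.castRingHom ℝ)

theorem degree_legendre (n : ℕ) : (legendre n).degree = n := by
  rw [legendre, degree_map_eq_of_injective (RingHom.injective_int _), degree_shiftedLegendre]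

theorem eval_legendre_zero (n : ℕ) : (legendre n).eval 0 = 1 := by
  rw [← coeff_zero_eq_eval_zero, legendre, coeff_map, coeff_shiftedLegendre]
  simp

theorem eval_legendre_one_sq (n : ℕ) : (legendre n).eval 1 ^ 2 = 1 := by
  have h := shiftedLegendre_eval_symm n (1 : ℝ)
  have e : ∀ x : ℝ, aeval x (shiftedLegendre n) = (legendre n).eval x := fun x => by
    rw [legendre, eval_map, aeval_def]; rfl
  rw [e, e, sub_self, eval_legendre_zero, mul_one] at h
  rw [h, ← pow_mul, mul_comm, pow_mul]
  simp

theorem factorial_mul_legendre (n : ℕ) :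
    C (n.factorial : ℝ) * legendre n = derivative^[n] (X ^ n * (1 - X) ^ n) := by
  have h := congrArg (Polynomial.map (Int.castRingHom ℝ)) (factorial_mul_shiftedLegendre_eq n)
  rw [← Polynomial.iterate_derivative_map] at h
  simpa [legendre] using h

theorem integral_derivative (q : ℝ[X]) :
    ∫ t in (0 : ℝ)..1, q.derivative.eval t = q.eval 1 - q.eval 0 :=
  intervalIntegral.integral_eq_sub_of_hasDerivAt (fun t _ => q.hasDerivAt t)
    (q.derivative.continuous.intervalIntegrable _ _)

/-- Repeated integration by parts moves all derivatives onto `q`, whose degree is too small to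
survive them. With `k = n` and Rodrigues' formula this is the orthogonality of `legendre n` to lower
degrees. -/
theorem integral_mul_iterate_derivative (n : ℕ) : ∀ k ≤ n, ∀ q : ℝ[X], q.degree < k →
    ∫ t in (0 : ℝ)..1, (q * derivative^[k] (X ^ n * (1 - X) ^ n)).eval t = 0 := by
  intro k
  induction k with
  | zero =>
    intro _ q hq
    have : q = 0 := by simpa using hq
    simp [this]
  | succ k ih =>
    intro hk q hq
    set w : ℝ[X] := derivative^[k] (X ^ n * (1 - X) ^ n) with hw
    -- Each derivative lowers the order of the zeros at 0 and 1 by at most one; as `k < n`, both end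
    -- points are still zeros and no boundary term arises.
    have h0 : w.eval 0 = 0 := by
      have : (X : ℝ[X]) ^ (n - k) ∣ w :=
        pow_sub_dvd_iterate_derivative_of_pow_dvd k (Dvd.intro _ rfl)
      obtain ⟨r, hr⟩ := this
      rw [hr]; simp [show n - k ≠ 0 by omega]
    have h1 : w.eval 1 = 0 := by
      have : (1 - X : ℝ[X]) ^ (n - k) ∣ w :=
        pow_sub_dvd_iterate_derivative_of_pow_dvd k (Dvd.intro_left _ rfl)
      obtain ⟨r, hr⟩ := this
      rw [hr]; simp [show n - k ≠ 0 by omega]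
    have hd := integral_derivative (q * w)
    have hq' : q.derivative.degree < k := by
      by_cases hq0 : q = 0
      · simp [hq0]
      · have h2 := degree_derivative_lt hq0
        rw [degree_eq_natDegree hq0] at h2 hq
        by_cases hq1 : q.derivative = 0
        · simp [hq1]
        · rw [degree_eq_natDegree hq1] at h2 ⊢
          norm_cast at h2 hq ⊢
          omega
    have := ih (by omega) _ hq'
    rw [Function.iterate_succ_apply', ← hw]
    rw [derivative_mul] at hd
    simp only [eval_add] at hd
    rw [intervalIntegral.integral_add ((Polynomial.continuous _).intervalIntegrable _ _)
      ((Polynomial.continuous _).intervalIntegrable _ _), this] at hd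
    simpa [h0, h1] using hd

theorem integral_mul_legendre (n : ℕ) (q : ℝ[X]) (hq : q.degree < n) :
    ∫ t in (0 : ℝ)..1, q.eval t * (legendre n).eval t = 0 := by
  have h := integral_mul_iterate_derivative n n le_rfl q hq
  rw [← factorial_mul_legendre] at h
  have : ∀ t : ℝ, (q * (C (n.factorial : ℝ) * legendre n)).eval t
      = (n.factorial : ℝ) * (q.eval t * (legendre n).eval t) := fun t => by
    simp only [eval_mul, eval_C]; ring
  simp only [this, intervalIntegral.integral_const_mul] at h
  exact (mul_eq_zero.1 h).resolve_left (by positivity)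

/-- The leading terms of `X L'` and `n L` agree, so `X L' - n L` is orthogonal to `L`. Integrating
`(X L²)' = L² + 2 X L L'` over `[0,1]` then gives `(2n+1) ∫ L² = L(1)² = 1`. -/
theorem integral_legendre_sq (n : ℕ) :
    (2 * n + 1) * ∫ t in (0 : ℝ)..1, (legendre n).eval t ^ 2 = 1 := by
  set L := legendre n with hL
  have hdeg : (X * L.derivative - C (n : ℝ) * L).degree < (n : WithBot ℕ) := by
    have hnat : L.natDegree = n := natDegree_eq_of_degree_eq_some (degree_legendre n)
    rw [degree_lt_iff_coeff_zero]
    intro m hm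
    rcases Nat.lt_or_ge n m with h | h
    · obtain ⟨m, rfl⟩ : ∃ k, m = k + 1 := ⟨m - 1, by omega⟩
      have : L.coeff (m + 1) = 0 := coeff_eq_zero_of_natDegree_lt (by omega)
      simp [coeff_X_mul, coeff_derivative, this]
    · have : m = n := le_antisymm h hm
      subst this
      rcases m with _ | m
      · simp
      · rw [coeff_sub, coeff_X_mul, coeff_derivative, coeff_C_mul]
        push_cast
        ring
  have h0 := integral_mul_legendre n _ hdeg
  have hd := integral_derivative (X * L * L)
  have e1 : ∀ t : ℝ, (X * L * L).derivative.eval t = (2 * n + 1) * L.eval t ^ 2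
      + 2 * ((X * L.derivative - C (n : ℝ) * L).eval t * L.eval t) := fun t => by
    simp; ring
  simp only [e1] at hd
  rw [intervalIntegral.integral_add (Continuous.intervalIntegrable (by fun_prop) _ _)
      (Continuous.intervalIntegrable (by fun_prop) _ _), intervalIntegral.integral_const_mul,
      intervalIntegral.integral_const_mul, h0] at hd
  have := eval_legendre_one_sq n
  rw [← hL] at this
  simp at hd
  linarith

/-- Induction on the degree: the top Legendre component `a L` is split off orthogonally, and it
contributes exactly `a` to the value at 0. The constant is the sum of the odd numbers `2k+1` for `k
≤ n`, which is `(n+1)²`. -/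
theorem sq_eval_zero_le (n : ℕ) : ∀ p : ℝ[X], p.natDegree ≤ n →
    p.eval 0 ^ 2 ≤ (n + 1) ^ 2 * ∫ t in (0 : ℝ)..1, p.eval t ^ 2 := by
  induction n with
  | zero =>
    intro p hp
    rw [eq_C_of_natDegree_le_zero hp]
    simp
  | succ n ih =>
    intro p hp
    set L := legendre (n + 1) with hL
    have hnat : L.natDegree = n + 1 := natDegree_eq_of_degree_eq_some (degree_legendre _)
    have hlc : L.coeff (n + 1) ≠ 0 := by
      rw [← hnat]; exact leadingCoeff_ne_zero.2 (fun h => by simp [h] at hnat)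
    set a : ℝ := p.coeff (n + 1) / L.coeff (n + 1) with ha
    set q : ℝ[X] := p - C a * L with hq
    have hqdeg : q.degree < (n + 1 : ℕ) := by
      rw [degree_lt_iff_coeff_zero]
      intro m hm
      rcases Nat.lt_or_ge (n + 1) m with h | h
      · simp [hq, coeff_eq_zero_of_natDegree_lt (show p.natDegree < m by omega),
          coeff_eq_zero_of_natDegree_lt (show L.natDegree < m by omega)]
      · have : m = n + 1 := le_antisymm h hm
        subst this
        simp [hq, ha, hlc]
    have hqnat : q.natDegree ≤ n := by
      rw [natDegree_le_iff_degree_le]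
      by_cases hq0 : q = 0
      · simp [hq0]
      · rw [degree_eq_natDegree hq0] at hqdeg ⊢
        exact_mod_cast Nat.lt_succ_iff.1 (by exact_mod_cast hqdeg)
    have h0 := integral_mul_legendre (n + 1) q hqdeg
    have h1 := integral_legendre_sq (n + 1)
    have h2 := ih q hqnat
    rw [← hL] at h0 h1
    have hp' : ∀ t, p.eval t = q.eval t + a * L.eval t := fun t => by simp [hq]
    have hI : ∫ t in (0 : ℝ)..1, p.eval t ^ 2 = (∫ t in (0 : ℝ)..1, q.eval t ^ 2)
        + a ^ 2 * ∫ t in (0 : ℝ)..1, L.eval t ^ 2 := by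
      have e : ∀ t, p.eval t ^ 2 = q.eval t ^ 2 + 2 * a * (q.eval t * L.eval t)
          + a ^ 2 * L.eval t ^ 2 := fun t => by rw [hp']; ring
      simp only [e]
      rw [intervalIntegral.integral_add (Continuous.intervalIntegrable (by fun_prop) _ _)
        (Continuous.intervalIntegrable (by fun_prop) _ _),
        intervalIntegral.integral_add (Continuous.intervalIntegrable (by fun_prop) _ _)
        (Continuous.intervalIntegrable (by fun_prop) _ _),
        intervalIntegral.integral_const_mul, intervalIntegral.integral_const_mul, h0]
      ring
    rw [hI, hp' 0, eval_legendre_zero, mul_one]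
    set x := q.eval 0
    set A := ∫ t in (0 : ℝ)..1, q.eval t ^ 2
    set B := ∫ t in (0 : ℝ)..1, L.eval t ^ 2
    push_cast at h1 ⊢
    set m : ℝ := n + 1 with hm
    have hmpos : 0 < m := by positivity
    have hB : B = (2 * m + 1)⁻¹ := by
      field_simp
      linarith
    rw [hB]
    have hA : x ^ 2 / m ^ 2 ≤ A := by
      rw [div_le_iff₀ (by positivity)]; linarith
    -- Cauchy–Schwarz with the weights `m²` and `2m+1`, whose sum is `(m+1)²`; the defect is an
    -- explicit square.
    calc (x + a) ^ 2 ≤ (m + 1) ^ 2 * (x ^ 2 / m ^ 2 + a ^ 2 * (2 * m + 1)⁻¹) := by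
          have : (m + 1) ^ 2 * (x ^ 2 / m ^ 2 + a ^ 2 * (2 * m + 1)⁻¹) - (x + a) ^ 2
              = (x * (2 * m + 1) - a * m ^ 2) ^ 2 / (m ^ 2 * (2 * m + 1)) := by
            field_simp; ring
          have h3 : 0 ≤ (x * (2 * m + 1) - a * m ^ 2) ^ 2 / (m ^ 2 * (2 * m + 1)) := by positivity
          linarith
      _ ≤ _ := by gcongr

/-- The value of a polynomial of degree `≤ n` at an end point is controlled by a weighted
`L²` norm, with the weight that appears in cone coordinates. -/
theorem sq_eval_zero_le_weighted (n k : ℕ) (hn : 1 ≤ n) (p : ℝ[X]) (hp : p.natDegree ≤ n) :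
    p.eval 0 ^ 2 ≤ 2 ^ (k + 3) * n ^ 2 * ∫ t in (0 : ℝ)..1, (1 - t) ^ k * p.eval t ^ 2 := by
  -- The unweighted bound is applied on `[0,1/2]`, where the weight `(1-t)^k` is at least `2^(-k)`.
  have h := sq_eval_zero_le n (p.comp (C (1 / 2) * X)) (by
    refine natDegree_comp_le.trans ?_
    have : (C (1 / 2 : ℝ) * X : ℝ[X]).natDegree ≤ 1 := (natDegree_C_mul_le _ _).trans natDegree_X_le
    nlinarith)
  have e : ∫ t in (0 : ℝ)..1, (p.comp (C (1 / 2) * X)).eval t ^ 2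
      = 2 * ∫ t in (0 : ℝ)..(1 / 2), p.eval t ^ 2 := by
    have := intervalIntegral.integral_comp_mul_left (a := 0) (b := 1) (fun t => p.eval t ^ 2)
      (c := (1 / 2 : ℝ)) (by norm_num)
    simp only [eval_comp, eval_mul, eval_C, eval_X]
    rw [this]; norm_num
  have hint : ∀ a b : ℝ, IntervalIntegrable (fun t : ℝ => (1 - t) ^ k * p.eval t ^ 2) volume a b :=
    fun a b => Continuous.intervalIntegrable (by fun_prop) _ _
  have h1 : (1 / 2 : ℝ) ^ k * ∫ t in (0 : ℝ)..(1 / 2), p.eval t ^ 2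
      ≤ ∫ t in (0 : ℝ)..(1 / 2), (1 - t) ^ k * p.eval t ^ 2 := by
    rw [← intervalIntegral.integral_const_mul]
    refine intervalIntegral.integral_mono_on (by norm_num)
      (Continuous.intervalIntegrable (by fun_prop) _ _) (hint _ _) fun t ht => ?_
    have : (1 / 2 : ℝ) ≤ 1 - t := by linarith [ht.2]
    gcongr
  have h2 : ∫ t in (0 : ℝ)..(1 / 2), (1 - t) ^ k * p.eval t ^ 2
      ≤ ∫ t in (0 : ℝ)..1, (1 - t) ^ k * p.eval t ^ 2 := by
    rw [← intervalIntegral.integral_add_adjacent_intervals (hint 0 (1 / 2)) (hint (1 / 2) 1)]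
    have : 0 ≤ ∫ t in (1 / 2 : ℝ)..1, (1 - t) ^ k * p.eval t ^ 2 :=
      intervalIntegral.integral_nonneg (by norm_num) fun t ht =>
        mul_nonneg (pow_nonneg (by linarith [ht.2]) _) (sq_nonneg _)
    linarith
  rw [e] at h
  simp only [eval_comp, eval_mul, eval_C, eval_X, mul_zero] at h
  set I := ∫ t in (0 : ℝ)..1, (1 - t) ^ k * p.eval t ^ 2
  set J := ∫ t in (0 : ℝ)..(1 / 2), p.eval t ^ 2 with hJ
  have hJ0 : 0 ≤ J := intervalIntegral.integral_nonneg (by norm_num) fun t _ => sq_nonneg _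
  have h3 : J ≤ 2 ^ k * I := by
    have : (1 / 2 : ℝ) ^ k * J ≤ I := h1.trans h2
    rw [one_div, inv_pow, inv_mul_le_iff₀ (by positivity)] at this
    exact this
  have hn' : (1 : ℝ) ≤ n := by exact_mod_cast hn
  -- The factor `2^(k+3)`: 4 from `(n+1)² ≤ (2n)²`, 2 from the rescaling of the interval, `2^k` from
  -- the weight.
  calc p.eval 0 ^ 2 ≤ (n + 1) ^ 2 * (2 * J) := h
    _ ≤ (n + n) ^ 2 * (2 * J) := by gcongr
    _ = 8 * n ^ 2 * J := by ring
    _ ≤ 8 * n ^ 2 * (2 ^ k * I) := by gcongr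
    _ = _ := by ring

end Legendre

/-! ## Cone coordinates and the trace inequality on a simplex -/

section Cone

variable {E V : Type*} [NormedAddCommGroup E] [InnerProductSpace ℝ E] [FiniteDimensional ℝ E]
  [MeasurableSpace E] [BorelSpace E]
  [NormedAddCommGroup V] [InnerProductSpace ℝ V] [FiniteDimensional ℝ V]
  [MeasurableSpace V] [BorelSpace V]

theorem lintegral_eq_smul_lintegral_smul {h : E → ENNReal} (hh : Measurable h) {r : ℝ}
    (hr : 0 < r) :
    ∫⁻ x, h x = ENNReal.ofReal (r ^ Module.finrank ℝ E) * ∫⁻ y, h (r • y) := by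
  have hm := Measure.map_addHaar_smul (volume : Measure E) hr.ne'
  have h1 : ∫⁻ y, h (r • y) = ∫⁻ x, h x ∂(Measure.map (r • ·) (volume : Measure E)) :=
    (lintegral_map hh (measurable_const_smul r)).symm
  rw [h1, hm, lintegral_smul_measure, smul_eq_mul, ← mul_assoc, ← ENNReal.ofReal_mul (by positivity),
    abs_of_nonneg (by positivity), mul_inv_cancel₀ (by positivity), ENNReal.ofReal_one, one_mul]

/-- Integration in cone coordinates over the cone with apex `a` and base `b + L(K)`. -/
theorem lintegral_cone (L : E →ₗᵢ[ℝ] V) (a b : V) (hrank : Module.finrank ℝ V = Module.finrank ℝ E + 1)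
    (hab : a - b ∉ LinearMap.range L.toLinearMap) {K : Set E} (hK : MeasurableSet K) {S : Set V}
    (hSm : MeasurableSet S)
    (hS : S = {z | ∃ y ∈ K, ∃ t ∈ Icc (0 : ℝ) 1, z = (1 - t) • (b + L y) + t • a}) :
    ∃ c : ENNReal, c ≠ ⊤ ∧ ∀ g : V → ENNReal, Measurable g →
      ∫⁻ z in S, g z = c * ∫⁻ y in K, ∫⁻ t in Icc (0 : ℝ) 1,
        ENNReal.ofReal ((1 - t) ^ Module.finrank ℝ E) * g ((1 - t) • (b + L y) + t • a) := by
  set n := Module.finrank ℝ E with hn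
  -- In the coordinates `b + A (t, x)` the slice of the cone at height `t` is `(1 - t) • K`;
  -- rescaling it to `K` produces the weight `(1-t)^n`. The map is invertible because `a - b` is
  -- transversal to the base.
  let A : ℝ × E →ₗ[ℝ] V := LinearMap.coprod (LinearMap.toSpanSingleton ℝ V (a - b)) L.toLinearMap
  have hA : ∀ t x, A (t, x) = t • (a - b) + L x := fun t x => by simp [A]
  have hinj : Function.Injective A := by
    rw [← LinearMap.ker_eq_bot, LinearMap.ker_eq_bot']
    rintro ⟨t, x⟩ h
    rw [hA] at h
    have ht : t = 0 := by
      by_contra ht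
      refine hab ⟨(-t⁻¹) • x, ?_⟩
      have : L x = -(t • (a - b)) := by rw [eq_neg_iff_add_eq_zero, add_comm]; exact h
      simp [this, smul_smul, inv_mul_cancel₀ ht]
    subst ht
    have : L x = 0 := by simpa using h
    have hx : x = 0 := L.injective (by simpa using this)
    simp [hx]
  let Ae : (ℝ × E) ≃L[ℝ] V := (LinearMap.linearEquivOfInjective A hinj (by
    rw [hrank]; simp [n, add_comm])).toContinuousLinearEquiv
  have hAe : ∀ t x, Ae (t, x) = t • (a - b) + L x := fun t x => hA t x
  let ν : Measure (ℝ × E) := (volume : Measure ℝ).prod (volume : Measure E)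
  have : (Measure.map Ae ν).IsAddHaarMeasure := Ae.isAddHaarMeasure_map ν
  -- Uniqueness of Haar measure yields the Jacobian of `Ae` as an unspecified constant. Its value is
  -- not needed, since it cancels in `simplex_trace`.
  have hvol := Measure.isAddLeftInvariant_eq_smul (volume : Measure V) (Measure.map Ae ν)
  refine ⟨_, ENNReal.coe_ne_top (r := (volume : Measure V).addHaarScalarFactor (Measure.map Ae ν)),
    fun g hg => ?_⟩
  set c := (volume : Measure V).addHaarScalarFactor (Measure.map Ae ν)
  have hpt : ∀ (t : ℝ) (y : E), b + Ae (t, (1 - t) • y) = (1 - t) • (b + L y) + t • a := by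
    intro t y
    rw [hAe, map_smul]
    module
  have hmem : ∀ (t : ℝ) (x : E), b + Ae (t, x) ∈ S → t ∈ Icc (0 : ℝ) 1 := by
    intro t x h
    rw [hS] at h
    obtain ⟨y, -, s, hs, h⟩ := h
    rw [← hpt] at h
    have := Ae.injective (add_left_cancel h)
    rw [Prod.mk.injEq] at this
    rw [this.1]; exact hs
  have hmem' : ∀ (t : ℝ) (y : E), t ∈ Ico (0 : ℝ) 1 → (b + Ae (t, (1 - t) • y) ∈ S ↔ y ∈ K) := by
    intro t y ht
    rw [hS]
    constructor
    · rintro ⟨y', hy', s, hs, h⟩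
      rw [← hpt] at h
      have := Ae.injective (add_left_cancel h)
      rw [Prod.mk.injEq] at this
      obtain ⟨rfl, h2⟩ := this
      have : y = y' := smul_right_injective E (show (1 - t) ≠ 0 by linarith [ht.2]) h2
      rwa [this]
    · intro hy
      exact ⟨y, hy, t, ⟨ht.1, ht.2.le⟩, hpt t y⟩
  have hind : Measurable (S.indicator g) := hg.indicator hSm
  have hAm : Measurable fun p : ℝ × E => b + Ae p := by
    exact (measurable_const_add b).comp Ae.continuous.measurable
  have hindb : Measurable fun z => S.indicator g (b + z) := hind.comp (measurable_const_add b)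
  have hindA : Measurable fun p : ℝ × E => S.indicator g (b + Ae p) := hind.comp hAm
  calc ∫⁻ z in S, g z = ∫⁻ z, S.indicator g z := (lintegral_indicator hSm g).symm
    _ = ∫⁻ z, S.indicator g (b + z) := (lintegral_add_left_eq_self _ b).symm
    _ = c * ∫⁻ z, S.indicator g (b + z) ∂(Measure.map Ae ν) := by
        conv_lhs => rw [hvol]
        rw [ENNReal.smul_def, lintegral_smul_measure, smul_eq_mul]
    _ = c * ∫⁻ p, S.indicator g (b + Ae p) ∂ν := by
        rw [lintegral_map hindb Ae.continuous.measurable]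
    _ = c * ∫⁻ t, ∫⁻ x, S.indicator g (b + Ae (t, x)) := by
        rw [lintegral_prod _ hindA.aemeasurable]
    _ = c * ∫⁻ t in Icc (0 : ℝ) 1, ∫⁻ y in K,
          ENNReal.ofReal ((1 - t) ^ n) * g ((1 - t) • (b + L y) + t • a) := by
        congr 1
        rw [← lintegral_indicator measurableSet_Icc]
        -- At `t = 1` the slice shrinks to the apex and cannot be rescaled; this single height is
        -- negligible.
        have h1 : ∀ᵐ t : ℝ, t ≠ 1 := by simp [ae_iff]
        refine lintegral_congr_ae (h1.mono fun t ht1 => ?_)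
        dsimp only
        by_cases ht : t ∈ Icc (0 : ℝ) 1
        · have ht' : t ∈ Ico (0 : ℝ) 1 := ⟨ht.1, lt_of_le_of_ne ht.2 ht1⟩
          have hindt : Measurable fun x : E => S.indicator g (b + Ae (t, x)) :=
            hindA.comp measurable_prodMk_left
          rw [indicator_of_mem ht, lintegral_eq_smul_lintegral_smul
            hindt (sub_pos.2 ht'.2),
            ← lintegral_indicator hK, ← lintegral_const_mul]
          · refine lintegral_congr fun y => ?_
            by_cases hy : y ∈ K
            · rw [indicator_of_mem hy, indicator_of_mem ((hmem' t y ht').2 hy), hpt]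
            · rw [indicator_of_notMem hy, indicator_of_notMem fun h => hy ((hmem' t y ht').1 h),
                mul_zero]
          · exact hindt.comp (measurable_const_smul (1 - t))
        · rw [indicator_of_notMem ht]
          have : ∀ x, S.indicator g (b + Ae (t, x)) = 0 := fun x =>
            indicator_of_notMem (fun h => ht (hmem t x h)) g
          simp [this]
    _ = _ := by
        congr 1
        refine lintegral_lintegral_swap (Measurable.aemeasurable ?_)
        have : Measurable fun p : ℝ × E => (1 - p.1) • (b + L p.2) + p.1 • a := by
          have hL := L.continuous
          fun_prop
        exact Measurable.mul (f := fun p : ℝ × E => ENNReal.ofReal ((1 - p.1) ^ n))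
          (by fun_prop) (hg.comp this)

end Cone

/-! ### Trace inequality on a simplex -/

section SimplexTrace

variable {d : ℕ}

@[fun_prop]
theorem continuous_val (q : Poly d) : Continuous (val q) := by
  unfold val
  exact (MvPolynomial.continuous_eval q).comp (by fun_prop)

theorem exists_polynomial_on_line (q : Poly d) (y a : Pt d) :
    ∃ p : Polynomial ℝ, p.natDegree ≤ q.totalDegree ∧
      ∀ t, p.eval t = val q ((1 - t) • y + t • a) := by
  refine ⟨MvPolynomial.aeval
    (fun i => Polynomial.C (y i) + Polynomial.C (a i - y i) * Polynomial.X) q, ?_, fun t => ?_⟩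
  · refine (MvPolynomial.aeval_natDegree_le q le_rfl _ (n := 1) fun i => ?_).trans (by simp)
    compute_degree
  · rw [val, ← Polynomial.coe_evalRingHom, MvPolynomial.aeval_def, MvPolynomial.hom_eval₂]
    rw [MvPolynomial.eval, MvPolynomial.coe_eval₂Hom]
    congr 1
    · ext; simp
    · ext i; simp; ring

/-- An isometric parametrization of the hyperplane of a `n`-simplex. -/
theorem exists_isometry_face {n : ℕ} (F : Affine.Simplex ℝ (Pt d) n) :
    ∃ L : EuclideanSpace ℝ (Fin n) →ₗᵢ[ℝ] Pt d,
      LinearMap.range L.toLinearMap = vectorSpan ℝ (range F.points) := by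
  have hr : Module.finrank ℝ (vectorSpan ℝ (range F.points)) = n :=
    F.independent.finrank_vectorSpan (by simp)
  let B := (stdOrthonormalBasis ℝ (vectorSpan ℝ (range F.points))).reindex (finCongr hr)
  refine ⟨(vectorSpan ℝ (range F.points)).subtypeₗᵢ.comp B.repr.symm.toLinearIsometry, ?_⟩
  ext x
  constructor
  · rintro ⟨y, rfl⟩
    exact (B.repr.symm y).2
  · intro hx
    exact ⟨B.repr ⟨x, hx⟩, by simp⟩

theorem closedInterior_subset_range {n : ℕ} (F : Affine.Simplex ℝ (Pt d) n)
    (L : EuclideanSpace ℝ (Fin n) →ₗᵢ[ℝ] Pt d)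
    (hL : LinearMap.range L.toLinearMap = vectorSpan ℝ (range F.points)) :
    F.closedInterior ⊆ range fun y => F.points 0 + L y := by
  intro x hx
  have h1 := F.closedInterior_subset_affineSpan hx
  have h2 : x -ᵥ F.points 0 ∈ vectorSpan ℝ (range F.points) := by
    rw [← direction_affineSpan]
    exact AffineSubspace.vsub_mem_direction h1 (subset_affineSpan ℝ _ (mem_range_self 0))
  rw [← hL] at h2
  obtain ⟨y, hy⟩ := h2
  exact ⟨y, by simpa [eq_sub_iff_add_eq', add_comm] using hy⟩

/-- The measure `μHE[n]` is preserved by isometries and is Lebesgue measure on `ℝ^n`, so surface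
integrals become integrals over the parameter domain of the face. -/
theorem lintegral_face {n : ℕ} (F : Affine.Simplex ℝ (Pt d) n)
    (L : EuclideanSpace ℝ (Fin n) →ₗᵢ[ℝ] Pt d)
    (hL : LinearMap.range L.toLinearMap = vectorSpan ℝ (range F.points)) (g : Pt d → ENNReal) :
    ∫⁻ x in F.closedInterior, g x ∂μHE[n]
      = ∫⁻ y in (fun y => F.points 0 + L y) ⁻¹' F.closedInterior, g (F.points 0 + L y) := by
  have hiso : Isometry fun y => F.points 0 + L y :=
    (IsometryEquiv.addLeft (F.points 0)).isometry.comp L.isometry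
  have hemb : MeasurableEmbedding fun y => F.points 0 + L y := hiso.isClosedEmbedding.measurableEmbedding
  have hm := hiso.map_euclideanHausdorffMeasure (d := n)
  rw [EuclideanSpace.euclideanHausdorffMeasure_eq_volume] at hm
  have h1 : (μHE[n] : Measure (Pt d)).restrict F.closedInterior
      = (Measure.map (fun y => F.points 0 + L y) volume).restrict F.closedInterior := by
    rw [hm, Measure.restrict_restrict_of_subset (closedInterior_subset_range F L hL)]
  rw [h1, hemb.restrict_map, hemb.lintegral_map]

theorem euclideanHausdorffMeasure_face_lt_top {n : ℕ} (F : Affine.Simplex ℝ (Pt d) n) :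
    (μHE[n] : Measure (Pt d)) F.closedInterior < ⊤ := by
  obtain ⟨L, hL⟩ := exists_isometry_face F
  have h := lintegral_face F L hL 1
  have hiso : Isometry fun y => F.points 0 + L y :=
    (IsometryEquiv.addLeft (F.points 0)).isometry.comp L.isometry
  simp only [Pi.one_apply, lintegral_const, one_mul, Measure.restrict_apply_univ] at h
  rw [h]
  exact (hiso.isClosedEmbedding.isCompact_preimage F.isCompact_closedInterior).measure_lt_top

theorem measurableSet_closedInterior {n : ℕ} (F : Affine.Simplex ℝ (Pt d) n) :
    MeasurableSet F.closedInterior := F.isClosed_closedInterior.measurableSet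

theorem integrableOn_face {n : ℕ} (F : Affine.Simplex ℝ (Pt d) n) {g : Pt d → ℝ}
    (hg : Continuous g) : IntegrableOn g F.closedInterior μHE[n] := by
  obtain ⟨C, hC⟩ := F.isCompact_closedInterior.exists_bound_of_continuousOn hg.continuousOn
  exact Measure.integrableOn_of_bounded (euclideanHausdorffMeasure_face_lt_top F).ne
    hg.aestronglyMeasurable
    ((ae_restrict_iff' (measurableSet_closedInterior F)).2 (Filter.Eventually.of_forall hC))

/-- A count of vertices: `n + 2` against `n + 1` leaves exactly one, and affine independence keeps
it off the hyperplane of `F`. -/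
theorem exists_apex {n : ℕ} (F : Affine.Simplex ℝ (Pt d) n) (S : Affine.Simplex ℝ (Pt d) (n + 1))
    (h : range F.points ⊆ range S.points) :
    ∃ a, a ∉ affineSpan ℝ (range F.points) ∧ insert a (range F.points) = range S.points := by
  have hF : (range F.points).ncard = n + 1 := by
    rw [← image_univ, ncard_image_of_injective _ F.independent.injective]; simp
  have hS : (range S.points).ncard = n + 2 := by
    rw [← image_univ, ncard_image_of_injective _ S.independent.injective]; simp
  obtain ⟨a, ha, hins⟩ := (exists_eq_insert_iff_ncard (finite_range _)).2 ⟨h, by rw [hF, hS]⟩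
  refine ⟨a, fun hmem => ha ?_, hins⟩
  obtain ⟨j, rfl⟩ : a ∈ range S.points := hins ▸ mem_insert a _
  have himg : S.points '' {i | S.points i ∈ range F.points} = range F.points := by
    ext x
    constructor
    · rintro ⟨i, hi, rfl⟩; exact hi
    · intro hx
      obtain ⟨i, rfl⟩ := h hx
      exact ⟨i, hx, rfl⟩
  rw [← himg, S.independent.mem_affineSpan_iff] at hmem
  exact hmem

/-- Trace inequality for a polynomial on a simplex, with the constant that is uniform in the shape
of the simplex and quadratic in the degree. -/
theorem simplex_trace {n : ℕ} (hd : d = n + 1) (F : Affine.Simplex ℝ (Pt d) n)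
    (S : Affine.Simplex ℝ (Pt d) d) (h : range F.points ⊆ range S.points) (p : ℕ) (hp : 1 ≤ p)
    (q : Poly d) (hq : q.totalDegree ≤ p) :
    volume.real S.closedInterior * ∫ x in F.closedInterior, val q x ^ 2 ∂μHE[n]
      ≤ 2 ^ (n + 3) * p ^ 2 * (μHE[n].real F.closedInterior
        * ∫ x in S.closedInterior, val q x ^ 2) := by
  subst hd
  obtain ⟨a, ha, hins⟩ := exists_apex F S h
  obtain ⟨L, hL⟩ := exists_isometry_face F
  set b := F.points 0 with hb
  have hiso : Isometry fun y => b + L y :=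
    (IsometryEquiv.addLeft b).isometry.comp L.isometry
  set K : Set (EuclideanSpace ℝ (Fin n)) := (fun y => b + L y) ⁻¹' F.closedInterior with hK
  have hKm : MeasurableSet K := hiso.continuous.measurable (measurableSet_closedInterior F)
  have hcone : S.closedInterior
      = {z | ∃ y ∈ K, ∃ t ∈ Icc (0 : ℝ) 1, z = (1 - t) • (b + L y) + t • a} := by
    rw [← S.convexHull_eq_closedInterior, ← hins, convexHull_insert (range_nonempty _),
      F.convexHull_eq_closedInterior]
    ext z
    simp only [mem_convexJoin, mem_singleton_iff, exists_eq_left, mem_ofPred_eq]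
    constructor
    · rintro ⟨f, hf, s, t, hs, ht, hst, rfl⟩
      obtain ⟨y, rfl⟩ := closedInterior_subset_range F L hL hf
      refine ⟨y, hf, s, ⟨hs, by linarith⟩, ?_⟩
      rw [← hst]; simp [add_comm, hb]
    · rintro ⟨y, hy, t, ht, rfl⟩
      exact ⟨_, hy, t, 1 - t, ht.1, by linarith [ht.2], by ring, add_comm _ _⟩
  have hab : a - b ∉ LinearMap.range L.toLinearMap := by
    rw [hL]
    intro hmem
    apply ha
    have := AffineSubspace.vadd_mem_of_mem_direction
      (s := affineSpan ℝ (range F.points)) (by rw [direction_affineSpan]; exact hmem)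
      (subset_affineSpan ℝ _ (mem_range_self 0))
    simpa [hb] using this
  obtain ⟨c, hc, hcint⟩ := lintegral_cone L a b (by simp) hab hKm
    (measurableSet_closedInterior S) hcone
  have hfin : Module.finrank ℝ (EuclideanSpace ℝ (Fin n)) = n := by simp
  rw [hfin] at hcint
  set C : ℝ := 2 ^ (n + 3) * p ^ 2 with hC
  have hC0 : 0 ≤ C := by positivity
  -- the measure of the simplex
  have hvol : volume S.closedInterior ≤ c * μHE[n] F.closedInterior := by
    have h1 := hcint 1 measurable_const
    have h2 := lintegral_face F L hL 1
    simp only [Pi.one_apply, lintegral_const, one_mul, Measure.restrict_apply_univ, mul_one]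
      at h1 h2
    rw [h1, h2]
    gcongr
    have : ∫⁻ t in Icc (0 : ℝ) 1, ENNReal.ofReal ((1 - t) ^ n) ≤ ∫⁻ t in Icc (0 : ℝ) 1, 1 := by
      refine setLIntegral_mono measurable_const fun t ht => ?_
      rw [← ENNReal.ofReal_one]
      exact ENNReal.ofReal_le_ofReal (pow_le_one₀ (by linarith [ht.2]) (by linarith [ht.1]))
    calc (∫⁻ t in Icc (0 : ℝ) 1, ENNReal.ofReal ((1 - t) ^ n)) * volume K
        ≤ 1 * volume K := by gcongr; simpa using this
      _ = volume K := one_mul _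
  -- On each segment from a point of the face to the apex, `q` is a univariate polynomial of degree
  -- at most `p`. The one-dimensional bound with weight `(1-t)^n` is integrated over the base.
  have htr : c * ∫⁻ x in F.closedInterior, ENNReal.ofReal (val q x ^ 2) ∂μHE[n]
      ≤ ENNReal.ofReal C * ∫⁻ x in S.closedInterior, ENNReal.ofReal (val q x ^ 2) := by
    rw [hcint _ (by fun_prop), lintegral_face F L hL, mul_left_comm]
    gcongr
    rw [← lintegral_const_mul' _ _ ENNReal.ofReal_ne_top]
    refine lintegral_mono fun y => ?_
    obtain ⟨r, hr, hre⟩ := exists_polynomial_on_line q (b + L y) a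
    have h1 := sq_eval_zero_le_weighted p n hp r (hr.trans hq)
    have h2 : ∫⁻ t in Icc (0 : ℝ) 1, ENNReal.ofReal ((1 - t) ^ n)
          * ENNReal.ofReal (val q ((1 - t) • (b + L y) + t • a) ^ 2)
        = ENNReal.ofReal (∫ t in (0 : ℝ)..1, (1 - t) ^ n * r.eval t ^ 2) := by
      rw [intervalIntegral.integral_of_le zero_le_one, ← integral_Icc_eq_integral_Ioc,
        ofReal_integral_eq_lintegral_ofReal]
      · refine setLIntegral_congr_fun measurableSet_Icc fun t ht => ?_
        rw [← hre, ENNReal.ofReal_mul (pow_nonneg (by linarith [ht.2]) _)]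
      · exact (Continuous.continuousOn (by fun_prop)).integrableOn_compact isCompact_Icc
      · refine (ae_restrict_iff' measurableSet_Icc).2 (Filter.Eventually.of_forall fun t ht => ?_)
        exact mul_nonneg (pow_nonneg (by linarith [ht.2]) _) (sq_nonneg _)
    dsimp only
    rw [h2, ← ENNReal.ofReal_mul hC0]
    refine ENNReal.ofReal_le_ofReal ?_
    have h3 := hre 0
    simp only [sub_zero, one_smul, zero_smul, add_zero] at h3
    rw [← h3]
    exact h1
  have hFi : ∫⁻ x in F.closedInterior, ENNReal.ofReal (val q x ^ 2) ∂μHE[n]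
      = ENNReal.ofReal (∫ x in F.closedInterior, val q x ^ 2 ∂μHE[n]) :=
    (ofReal_integral_eq_lintegral_ofReal (integrableOn_face F (by fun_prop))
      (Filter.Eventually.of_forall fun x => sq_nonneg _)).symm
  have hSi : ∫⁻ x in S.closedInterior, ENNReal.ofReal (val q x ^ 2)
      = ENNReal.ofReal (∫ x in S.closedInterior, val q x ^ 2) :=
    (ofReal_integral_eq_lintegral_ofReal
      ((Continuous.continuousOn (by fun_prop)).integrableOn_compact S.isCompact_closedInterior)
      (Filter.Eventually.of_forall fun x => sq_nonneg _)).symm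
  rw [hFi, hSi] at htr
  lift c to NNReal using hc
  have hF0 : 0 ≤ ∫ x in F.closedInterior, val q x ^ 2 ∂μHE[n] :=
    integral_nonneg fun x => sq_nonneg _
  have hS0 : 0 ≤ ∫ x in S.closedInterior, val q x ^ 2 := integral_nonneg fun x => sq_nonneg _
  have htr' : (c : ℝ) * ∫ x in F.closedInterior, val q x ^ 2 ∂μHE[n]
      ≤ C * ∫ x in S.closedInterior, val q x ^ 2 := by
    have := ENNReal.toReal_mono (ENNReal.mul_ne_top ENNReal.ofReal_ne_top ENNReal.ofReal_ne_top) htr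
    simpa [ENNReal.toReal_mul, ENNReal.toReal_ofReal, hF0, hS0, hC0] using this
  have hvol' : volume.real S.closedInterior ≤ c * μHE[n].real F.closedInterior := by
    have := ENNReal.toReal_mono (ENNReal.mul_ne_top ENNReal.coe_ne_top
      (euclideanHausdorffMeasure_face_lt_top F).ne) hvol
    simpa [ENNReal.toReal_mul, Measure.real] using this
  have hm0 : 0 ≤ μHE[n].real F.closedInterior := measureReal_nonneg
  -- The Jacobian `c` bounds `|S| / |F|` from above and also multiplies the trace in `htr'`.
  -- Eliminating it leaves a constant that does not depend on the shape of `S`.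
  calc volume.real S.closedInterior * ∫ x in F.closedInterior, val q x ^ 2 ∂μHE[n]
      ≤ (c * μHE[n].real F.closedInterior)
          * ∫ x in F.closedInterior, val q x ^ 2 ∂μHE[n] := by gcongr
    _ = μHE[n].real F.closedInterior
          * (c * ∫ x in F.closedInterior, val q x ^ 2 ∂μHE[n]) := by ring
    _ ≤ μHE[n].real F.closedInterior * (C * ∫ x in S.closedInterior, val q x ^ 2) := by gcongr
    _ = _ := by ring

end SimplexTrace

/-! ## Trace inequality on the elements of a polytopic regular mesh -/

section MeshTrace

variable {d : ℕ}

/-- Regularity speaks of interiors in barycentric coordinates, integration wants open sets.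
Topologically interior points have positive coordinates with sum 1, and since `d ≥ 1` there are at
least two, so each is also below 1. -/
theorem interior_closedInterior_subset (hd : 1 ≤ d) (S : Affine.Simplex ℝ (Pt d) d) :
    interior S.closedInterior ⊆ S.interior := by
  have htop : affineSpan ℝ (range S.points) = ⊤ :=
    S.independent.affineSpan_eq_top_iff_card_eq_finrank_add_one.2 (by simp)
  let B : AffineBasis (Fin (d + 1)) ℝ (Pt d) := ⟨S.points, S.independent, htop⟩
  intro x hx
  rw [← S.convexHull_eq_closedInterior] at hx
  have hx' : x ∈ interior (convexHull ℝ (range B)) := hx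
  rw [B.interior_convexHull] at hx'
  refine ⟨fun i => B.coord i x, B.sum_coord_apply_eq_one x, fun i => ⟨hx' i, ?_⟩,
    B.affineCombination_coord_eq_self x⟩
  rw [← B.sum_coord_apply_eq_one x]
  have : Nontrivial (Fin (d + 1)) := Fin.nontrivial_iff_two_le.2 (by omega)
  obtain ⟨j, hj⟩ := exists_ne i
  exact Finset.single_lt_sum hj (Finset.mem_univ _) (Finset.mem_univ _) (hx' j)
    fun k _ _ => (hx' k).le

theorem interior_ae_eq_closedInterior (S : Affine.Simplex ℝ (Pt d) d) :
    (interior S.closedInterior : Set (Pt d)) =ᵐ[volume] S.closedInterior := by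
  refine interior_ae_eq_of_null_frontier (Convex.addHaar_frontier _ ?_)
  rw [← S.convexHull_eq_closedInterior]
  exact convex_convexHull _ _

/-- The `d` vertices span a proper affine subspace. For `d = 0` the truncated `d - 1` would make the
face the whole space. -/
theorem volume_face_eq_zero (hd : 1 ≤ d) (F : Affine.Simplex ℝ (Pt d) (d - 1)) :
    volume F.closedInterior = 0 := by
  refine measure_mono_null F.closedInterior_subset_affineSpan
    (Measure.addHaar_affineSubspace _ _ fun htop => ?_)
  have h := F.independent.affineSpan_eq_top_iff_card_eq_finrank_add_one.1 htop
  simp at h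
  omega

namespace PolytopicMesh

variable (M : PolytopicMesh d)

theorem volume_frontier_cell (hd : 1 ≤ d) (κ : M.Elem) : volume (frontier (M.cell κ)) = 0 := by
  rw [M.frontier_cell]
  exact (measure_biUnion_null_iff (to_countable _)).2 fun F _ => volume_face_eq_zero hd _

theorem integrableOn_cell (κ : M.Elem) {g : Pt d → ℝ} (hg : Continuous g) :
    IntegrableOn g (M.cell κ) :=
  (hg.continuousOn.integrableOn_compact (M.isBounded_cell κ).isCompact_closure).mono_set
    subset_closure

theorem diam_pos (hd : 1 ≤ d) (κ : M.Elem) : 0 < M.diam κ := by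
  have : NeZero d := ⟨by omega⟩
  obtain ⟨x, hx⟩ := (M.isConnected_cell κ).nonempty
  obtain ⟨ε, hε, hball⟩ := Metric.isOpen_iff.1 (M.isOpen_cell κ) x hx
  refine Metric.diam_pos ?_ (M.isBounded_cell κ)
  have hne : (Metric.ball x ε).Nontrivial := by
    obtain ⟨v, hv⟩ := exists_ne (0 : Pt d)
    refine ⟨x, Metric.mem_ball_self hε, x + (ε / 2 / ‖v‖) • v, ?_, ?_⟩
    · have : 0 < ‖v‖ := norm_pos_iff.2 hv
      simp [norm_smul, abs_of_pos hε]
      field_simp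
      norm_num
    · have : 0 < ‖v‖ := norm_pos_iff.2 hv
      have : ε / 2 / ‖v‖ ≠ 0 := by positivity
      simp [this, hv]
  exact hne.mono hball

variable {M} in
/-- Summed trace inequality over the faces of an element. -/
theorem IsPolytopicRegular.trace (hd : 1 ≤ d) {creg : ℝ}
    (hreg : M.IsPolytopicRegular creg) (κ : M.Elem) (A : Finset M.Face)
    (hA : ∀ F ∈ A, F ∈ M.facesOf κ) (p : ℕ) (hp : 1 ≤ p) (q : Poly d) (hq : q.totalDegree ≤ p) :
    M.diam κ * ∑ F ∈ A, ∫ x in (M.face F).closedInterior, val q x ^ 2 ∂μHE[d - 1]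
      ≤ |creg| * d * 2 ^ (d + 2) * p ^ 2 * ∫ x in M.cell κ, val q x ^ 2 := by
  obtain ⟨S, hS, hdis⟩ := hreg κ
  have hint : ∀ s : Set (Pt d), s ⊆ closure (M.cell κ) → IntegrableOn (fun x => val q x ^ 2) s :=
    fun s hs => ((show Continuous fun x => val q x ^ 2 by
      fun_prop).continuousOn.integrableOn_compact
      (M.isBounded_cell κ).isCompact_closure).mono_set hs
  have hface : ∀ F ∈ A,
      M.diam κ * ∫ x in (M.face F).closedInterior, val q x ^ 2 ∂μHE[d - 1]
        ≤ |creg| * d * 2 ^ (d + 2) * p ^ 2 * ∫ x in (S F).closedInterior, val q x ^ 2 := by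
    intro F hF
    obtain ⟨h1, -, h3⟩ := hS F (hA F hF)
    have htr := simplex_trace (show d = (d - 1) + 1 by omega) (M.face F) (S F) h1 p hp q hq
    rw [show d - 1 + 3 = d + 2 by omega] at htr
    set I := ∫ x in (M.face F).closedInterior, val q x ^ 2 ∂μHE[d - 1]
    set J := ∫ x in (S F).closedInterior, val q x ^ 2
    set a := volume.real (S F).closedInterior
    set m := μHE[d - 1].real (M.face F).closedInterior
    have hI : 0 ≤ I := integral_nonneg fun x => sq_nonneg _
    have hJ : 0 ≤ J := integral_nonneg fun x => sq_nonneg _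
    have ha : 0 ≤ a := measureReal_nonneg
    have hm : 0 ≤ m := measureReal_nonneg
    -- Valid for `m = 0` as well, so positivity of the surface measure of a face is not needed.
    have hm' : m⁻¹ * m ≤ 1 := inv_mul_le_one
    calc M.diam κ * I ≤ (|creg| * (d * a * m⁻¹)) * I := by
          refine mul_le_mul_of_nonneg_right (h3.trans ?_) hI
          exact mul_le_mul_of_nonneg_right (le_abs_self _) (by positivity)
      _ = |creg| * d * m⁻¹ * (a * I) := by ring
      _ ≤ |creg| * d * m⁻¹ * (2 ^ (d + 2) * p ^ 2 * (m * J)) := by gcongr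
      _ = |creg| * d * 2 ^ (d + 2) * p ^ 2 * J * (m⁻¹ * m) := by ring
      _ ≤ |creg| * d * 2 ^ (d + 2) * p ^ 2 * J * 1 := by gcongr
      _ = _ := by ring
  rw [Finset.mul_sum]
  refine (Finset.sum_le_sum hface).trans ?_
  rw [← Finset.mul_sum]
  refine mul_le_mul_of_nonneg_left ?_ (by positivity)
  -- The simplices do not overlap, so their integrals add up to an integral over a part of the
  -- element. Hence the constant is independent of the number of faces.
  have e1 : ∑ F ∈ A, ∫ x in (S F).closedInterior, val q x ^ 2
      = ∫ x in ⋃ F ∈ A, interior (S F).closedInterior, val q x ^ 2 := by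
    rw [integral_biUnion_finset A (fun F _ => isOpen_interior.measurableSet)]
    · exact Finset.sum_congr rfl fun F _ =>
        setIntegral_congr_set (interior_ae_eq_closedInterior (S F)).symm
    · intro F hF G hG hFG
      exact (hdis F (hA F hF) G (hA G hG) hFG).mono (interior_closedInterior_subset hd _)
        (interior_closedInterior_subset hd _)
    · exact fun F hF => hint _ (interior_subset.trans (hS F (hA F hF)).2.1)
  have hcl : (M.cell κ : Set (Pt d)) =ᵐ[volume] closure (M.cell κ) := by
    have := closure_ae_eq_of_null_frontier (M.volume_frontier_cell hd κ)
    exact this.symm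
  rw [e1, setIntegral_congr_set hcl]
  refine setIntegral_mono_set (hint _ subset_rfl)
    (Filter.Eventually.of_forall fun x => sq_nonneg _) (LE.le.eventuallyLE ?_)
  exact iUnion₂_subset fun F hF => interior_subset.trans (hS F (hA F hF)).2.1

end PolytopicMesh

end MeshTrace

/-! ## Values and degrees of elementwise polynomials -/

section Values

variable {d : ℕ}

@[simp] theorem val_zero (x : Pt d) : val (0 : Poly d) x = 0 := by simp [val]
@[simp] theorem val_add (p q : Poly d) (x : Pt d) : val (p + q) x = val p x + val q x := by
  simp [val]
@[simp] theorem val_mul (p q : Poly d) (x : Pt d) : val (p * q) x = val p x * val q x := by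
  simp [val]
@[simp] theorem val_C (r : ℝ) (x : Pt d) : val (MvPolynomial.C r : Poly d) x = r := by simp [val]
@[simp] theorem val_sum {ι : Type*} (s : Finset ι) (p : ι → Poly d) (x : Pt d) :
    val (∑ i ∈ s, p i) x = ∑ i ∈ s, val (p i) x := by simp [val]
@[simp] theorem val_ite (P : Prop) [Decidable P] (p q : Poly d) (x : Pt d) :
    val (if P then p else q) x = if P then val p x else val q x := by split_ifs <;> rfl
@[simp] theorem val_one (x : Pt d) : val (1 : Poly d) x = 1 := by simp [val]
@[simp] theorem val_smul (r : ℝ) (p : Poly d) (x : Pt d) : val (r • p) x = r * val p x := by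
  simp [val]

theorem totalDegree_pderiv_le (i : Fin d) (p : Poly d) :
    (MvPolynomial.pderiv i p).totalDegree ≤ p.totalDegree := by
  conv_lhs => rw [p.as_sum, map_sum]
  refine MvPolynomial.totalDegree_finsetSum_le fun v hv => ?_
  rw [MvPolynomial.pderiv_monomial]
  refine (MvPolynomial.totalDegree_monomial_le _ _).trans ?_
  refine le_trans ?_ (MvPolynomial.le_totalDegree hv)
  exact Finsupp.degree_mono tsub_le_self

theorem totalDegree_C_mul_le (r : ℝ) (p : Poly d) :
    (MvPolynomial.C r * p).totalDegree ≤ p.totalDegree :=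
  (MvPolynomial.totalDegree_mul _ _).trans (by simp)

theorem totalDegree_ite_mul_le (P : Prop) [Decidable P] (p : Poly d) :
    (p * (if P then 1 else 0)).totalDegree ≤ p.totalDegree := by split_ifs <;> simp

namespace CoupledMesh

variable (M : CoupledMesh d)

theorem totalDegree_dvg_le {v : M.VField} {κ : M.Elem} {n : ℕ}
    (hv : ∀ i, (v κ i).totalDegree ≤ n) : (M.dvg v κ).totalDegree ≤ n :=
  MvPolynomial.totalDegree_finsetSum_le fun i _ => (totalDegree_pderiv_le i _).trans (hv i)

theorem totalDegree_strain_le {v : M.VField} {κ : M.Elem} {n : ℕ}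
    (hv : ∀ i, (v κ i).totalDegree ≤ n) (i j : Fin d) : (M.strain v i j κ).totalDegree ≤ n :=
  (totalDegree_C_mul_le _ _).trans ((MvPolynomial.totalDegree_add _ _).trans
    (max_le ((totalDegree_pderiv_le _ _).trans (hv i)) ((totalDegree_pderiv_le _ _).trans (hv j))))

@[fun_prop]
theorem continuous_jump (ψ : M.SField) (F : M.Face) (i : Fin d) : Continuous (M.jump ψ F i) := by
  unfold jump
  split <;> fun_prop

@[fun_prop]
theorem continuous_jumpT (v : M.VField) (F : M.Face) (i j : Fin d) :
    Continuous (M.jumpT v F i j) := by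
  unfold jumpT; fun_prop

@[fun_prop]
theorem continuous_jumpN (v : M.VField) (F : M.Face) : Continuous (M.jumpN v F) := by
  unfold jumpN; fun_prop

@[fun_prop]
theorem continuous_avg (ψ : M.SField) (F : M.Face) : Continuous (M.avg ψ F) := by
  unfold avg
  split <;> fun_prop

@[fun_prop]
theorem continuous_flux (v : M.VField) (F : M.Face) : Continuous (M.flux v F) := by
  unfold flux; fun_prop

/-! ## Integrals over elements and faces -/

theorem cellInt_add (κ : M.Elem) {f g : Pt d → ℝ} (hf : Continuous f) (hg : Continuous g) :
    M.cellInt κ (fun x => f x + g x) = M.cellInt κ f + M.cellInt κ g :=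
  integral_add (M.integrableOn_cell κ hf) (M.integrableOn_cell κ hg)

theorem cellInt_const_mul (κ : M.Elem) (r : ℝ) (f : Pt d → ℝ) :
    M.cellInt κ (fun x => r * f x) = r * M.cellInt κ f := integral_const_mul r f

theorem cellInt_sum {ι : Type*} (s : Finset ι) (κ : M.Elem) {f : ι → Pt d → ℝ}
    (hf : ∀ i, Continuous (f i)) :
    M.cellInt κ (fun x => ∑ i ∈ s, f i x) = ∑ i ∈ s, M.cellInt κ (f i) :=
  integral_finsetSum s fun i _ => M.integrableOn_cell κ (hf i)

theorem cellInt_mono (κ : M.Elem) {f g : Pt d → ℝ} (hf : Continuous f) (hg : Continuous g)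
    (h : ∀ x, f x ≤ g x) : M.cellInt κ f ≤ M.cellInt κ g :=
  integral_mono (M.integrableOn_cell κ hf) (M.integrableOn_cell κ hg) h

theorem cellInt_nonneg (κ : M.Elem) {f : Pt d → ℝ} (h : ∀ x, 0 ≤ f x) : 0 ≤ M.cellInt κ f :=
  integral_nonneg h

theorem faceInt_add (F : M.Face) {f g : Pt d → ℝ} (hf : Continuous f) (hg : Continuous g) :
    M.faceInt F (fun x => f x + g x) = M.faceInt F f + M.faceInt F g :=
  integral_add (integrableOn_face _ hf) (integrableOn_face _ hg)

theorem faceInt_const_mul (F : M.Face) (r : ℝ) (f : Pt d → ℝ) :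
    M.faceInt F (fun x => r * f x) = r * M.faceInt F f := integral_const_mul r f

theorem faceInt_sum {ι : Type*} (s : Finset ι) (F : M.Face) {f : ι → Pt d → ℝ}
    (hf : ∀ i, Continuous (f i)) :
    M.faceInt F (fun x => ∑ i ∈ s, f i x) = ∑ i ∈ s, M.faceInt F (f i) :=
  integral_finsetSum s fun i _ => integrableOn_face _ (hf i)

theorem faceInt_mono (F : M.Face) {f g : Pt d → ℝ} (hf : Continuous f) (hg : Continuous g)
    (h : ∀ x, f x ≤ g x) : M.faceInt F f ≤ M.faceInt F g :=
  integral_mono (integrableOn_face _ hf) (integrableOn_face _ hg) h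

theorem faceInt_nonneg (F : M.Face) {f : Pt d → ℝ} (h : ∀ x, 0 ≤ f x) : 0 ≤ M.faceInt F f :=
  integral_nonneg h

/-! ## Absorbing the consistency terms into the penalty terms -/

/-- The constant of the trace inequality on a polytopic regular mesh. -/
def _root_.PoroAcoustic.traceConst (d : ℕ) (creg : ℝ) : ℝ := |creg| * d * 2 ^ (d + 2)

variable {M}

open Classical in
-- One estimate for all face families. `G` is the discrete flux (stress, `m ∇·X` or `ρ_a ∇φ`), `a`
-- its trace or average on a face, `J` the penalized jump, `D` the material weight in the penalty,
-- `vol` the volume energy. The volume term gets only the factor 1/4 because the pore-pressure form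
-- uses it twice, for the internal and Dirichlet faces and for the sealed ones.
theorem abs_consistency_le (hd : 1 ≤ d) {creg : ℝ} (hreg : M.IsPolytopicRegular creg)
    {ι : Type*} [Fintype ι] (Es : Finset M.Elem) (Fs : Finset M.Face) (G : ι → M.SField)
    (hG : ∀ i, ∀ κ ∈ Es, (G i κ).totalDegree ≤ M.deg κ)
    (a J : ι → M.Face → Pt d → ℝ) (hac : ∀ i F, Continuous (a i F)) (hJc : ∀ i F, Continuous (J i F))
    (ha : ∀ F ∈ Fs, ∀ x, ∑ i, a i F x ^ 2
      ≤ ∑ κ ∈ Es with F ∈ M.facesOf κ, ∑ i, val (G i κ) x ^ 2)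
    (D vol : M.Elem → ℝ) (hD : ∀ κ ∈ Es, 0 < D κ)
    (hvol : ∀ κ ∈ Es, ∑ i, M.cellInt κ (fun x => val (G i κ) x ^ 2) ≤ D κ * vol κ)
    (pen : M.Face → ℝ) (s : ℝ) (hs : 8 * traceConst d creg + 1 ≤ s) (hpos : ∀ F ∈ Fs, 0 < pen F)
    (hpen : ∀ F ∈ Fs, ∀ κ ∈ Es, F ∈ M.facesOf κ →
      s * (D κ * (M.deg κ : ℝ) ^ 2 * (M.diam κ)⁻¹) ≤ pen F) :
    |2 * ∑ F ∈ Fs, M.faceInt F (fun x => ∑ i, a i F x * J i F x)|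
      ≤ 1 / 4 * ∑ κ ∈ Es, vol κ
        + 1 / 2 * ∑ F ∈ Fs, M.faceInt F (fun x => pen F * ∑ i, J i F x ^ 2) := by
  set Ct := traceConst d creg with hCt
  have hCt0 : 0 ≤ Ct := by rw [hCt, traceConst]; positivity
  have hs0 : 0 < s := by linarith
  have hdeg : ∀ κ : M.Elem, (0 : ℝ) < (M.deg κ : ℝ) ^ 2 := fun κ => by
    have : 0 < M.deg κ := M.one_le_deg κ
    positivity
  have hdiam : ∀ κ : M.Elem, 0 < M.diam κ := fun κ => M.diam_pos hd κ
  -- pointwise Young inequality, integrated over a face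
  have hface : ∀ F ∈ Fs, |2 * M.faceInt F (fun x => ∑ i, a i F x * J i F x)|
      ≤ (∑ κ ∈ Es with F ∈ M.facesOf κ, 2 * (s * (D κ * (M.deg κ : ℝ) ^ 2 * (M.diam κ)⁻¹))⁻¹ *
          ∑ i, M.faceInt F (fun x => val (G i κ) x ^ 2))
        + 1 / 2 * M.faceInt F (fun x => pen F * ∑ i, J i F x ^ 2) := by
    intro F hF
    have hp := hpos F hF
    have hyoung : ∀ x, |2 * ∑ i, a i F x * J i F x|
        ≤ 2 * (pen F)⁻¹ * (∑ κ ∈ Es with F ∈ M.facesOf κ, ∑ i, val (G i κ) x ^ 2)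
          + 1 / 2 * (pen F * ∑ i, J i F x ^ 2) := by
      intro x
      calc |2 * ∑ i, a i F x * J i F x|
          ≤ ∑ i, |2 * (a i F x * J i F x)| := by
            rw [Finset.mul_sum]; exact Finset.abs_sum_le_sum_abs _ _
        _ ≤ ∑ i, (2 * (pen F)⁻¹ * a i F x ^ 2 + 1 / 2 * (pen F * J i F x ^ 2)) := by
            refine Finset.sum_le_sum fun i _ => ?_
            -- Young's inequality `2|aJ| ≤ 2 a²/pen + pen J²/2`, with one square for each sign.
            have h1 : 0 ≤ (pen F)⁻¹ * (2 * a i F x - pen F * J i F x) ^ 2 := by positivity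
            have h2 : 0 ≤ (pen F)⁻¹ * (2 * a i F x + pen F * J i F x) ^ 2 := by positivity
            have e1 : (pen F)⁻¹ * (2 * a i F x - pen F * J i F x) ^ 2
                = 2 * (2 * (pen F)⁻¹ * a i F x ^ 2 + 1 / 2 * (pen F * J i F x ^ 2)
                  - 2 * (a i F x * J i F x)) := by field_simp; ring
            have e2 : (pen F)⁻¹ * (2 * a i F x + pen F * J i F x) ^ 2
                = 2 * (2 * (pen F)⁻¹ * a i F x ^ 2 + 1 / 2 * (pen F * J i F x ^ 2)
                  + 2 * (a i F x * J i F x)) := by field_simp; ring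
            rw [abs_le]
            constructor <;> linarith
        _ = 2 * (pen F)⁻¹ * ∑ i, a i F x ^ 2 + 1 / 2 * (pen F * ∑ i, J i F x ^ 2) := by
            rw [Finset.sum_add_distrib, Finset.mul_sum, Finset.mul_sum, Finset.mul_sum]
        _ ≤ _ := by
            have := ha F hF x
            gcongr
    rw [← faceInt_const_mul]
    calc |M.faceInt F fun x => 2 * ∑ i, a i F x * J i F x|
        ≤ M.faceInt F fun x => |2 * ∑ i, a i F x * J i F x| := abs_integral_le_integral_abs
      _ ≤ M.faceInt F fun x =>
            2 * (pen F)⁻¹ * (∑ κ ∈ Es with F ∈ M.facesOf κ, ∑ i, val (G i κ) x ^ 2)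
              + 1 / 2 * (pen F * ∑ i, J i F x ^ 2) :=
          M.faceInt_mono F (by fun_prop) (by fun_prop) hyoung
      _ = 2 * (pen F)⁻¹ * (∑ κ ∈ Es with F ∈ M.facesOf κ,
              ∑ i, M.faceInt F fun x => val (G i κ) x ^ 2)
            + 1 / 2 * M.faceInt F (fun x => pen F * ∑ i, J i F x ^ 2) := by
          rw [faceInt_add _ _ (by fun_prop) (by fun_prop), faceInt_const_mul, faceInt_const_mul,
            faceInt_sum _ _ _ (by fun_prop)]
          congr 3
          ext κ
          rw [faceInt_sum _ _ _ (by fun_prop)]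
      _ ≤ _ := by
          gcongr ?_ + _
          rw [Finset.mul_sum]
          refine Finset.sum_le_sum fun κ hκ => ?_
          rw [Finset.mem_filter] at hκ
          have h1 := hpen F hF κ hκ.1 hκ.2
          have h2 : 0 < s * (D κ * (M.deg κ : ℝ) ^ 2 * (M.diam κ)⁻¹) := by
            have := hD κ hκ.1; have := hdeg κ; have := hdiam κ; positivity
          have h3 : 0 ≤ ∑ i, M.faceInt F fun x => val (G i κ) x ^ 2 :=
            Finset.sum_nonneg fun i _ => M.faceInt_nonneg F fun x => sq_nonneg _
          gcongr
  rw [Finset.mul_sum]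
  refine (Finset.abs_sum_le_sum_abs _ _).trans ((Finset.sum_le_sum hface).trans ?_)
  rw [Finset.sum_add_distrib, ← Finset.mul_sum]
  gcongr ?_ + _
  simp only [Finset.sum_filter]
  -- Exchanging faces and elements collects all faces of one element, the form in which the trace
  -- inequality is available.
  rw [Finset.sum_comm, Finset.mul_sum]
  refine Finset.sum_le_sum fun κ hκ => ?_
  have hDκ := hD κ hκ
  have hpκ := hdeg κ
  have hhκ := hdiam κ
  have hvol0 : 0 ≤ D κ * vol κ := le_trans
    (Finset.sum_nonneg fun i _ => M.cellInt_nonneg κ fun x => sq_nonneg _) (hvol κ hκ)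
  have hv0 : 0 ≤ vol κ := nonneg_of_mul_nonneg_right hvol0 hDκ
  rw [← Finset.sum_filter, ← Finset.mul_sum, Finset.sum_comm]
  have htr : M.diam κ * ∑ i, ∑ F ∈ Fs with F ∈ M.facesOf κ, M.faceInt F (fun x => val (G i κ) x ^ 2)
      ≤ Ct * (M.deg κ : ℝ) ^ 2 * (D κ * vol κ) := by
    refine le_trans ?_ (mul_le_mul_of_nonneg_left (hvol κ hκ) (by positivity))
    rw [Finset.mul_sum, Finset.mul_sum]
    refine Finset.sum_le_sum fun i _ => ?_
    exact hreg.trace hd κ _ (fun F hF => (Finset.mem_filter.1 hF).2) (M.deg κ) (M.one_le_deg κ)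
      (G i κ) (hG i κ hκ)
  set X := ∑ i, ∑ F ∈ Fs with F ∈ M.facesOf κ, M.faceInt F (fun x => val (G i κ) x ^ 2)
  -- Degree, diameter and material weight cancel against the penalty, leaving `2 Ct / s`. This is at
  -- most 1/4 because `s ≥ 8 Ct + 1`; the summand 1 keeps `s` positive even if `Ct = 0`.
  calc 2 * (s * (D κ * (M.deg κ : ℝ) ^ 2 * (M.diam κ)⁻¹))⁻¹ * X
      = 2 * (s * (D κ * (M.deg κ : ℝ) ^ 2))⁻¹ * (M.diam κ * X) := by field_simp
    _ ≤ 2 * (s * (D κ * (M.deg κ : ℝ) ^ 2))⁻¹ * (Ct * (M.deg κ : ℝ) ^ 2 * (D κ * vol κ)) := by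
        gcongr
    _ = 2 * Ct / s * vol κ := by
        have : (M.deg κ : ℝ) ≠ 0 := fun h => by simp [h] at hpκ
        field_simp
    _ ≤ 1 / 4 * vol κ := by
        refine mul_le_mul_of_nonneg_right ?_ hv0
        rw [div_le_iff₀ hs0]
        linarith

end CoupledMesh

end Values

/-! ## The stiffness tensor -/

section Stiffness

variable {d : ℕ}

theorem sum_stress_mul (lam mu t : ℝ) (e : Fin d → Fin d → ℝ) :
    ∑ i, ∑ j, (lam * t * (if i = j then 1 else 0) + 2 * mu * e i j) * e i j
      = lam * t * (∑ i, e i i) + 2 * mu * ∑ i, ∑ j, e i j ^ 2 := by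
  have : ∀ i j, (lam * t * (if i = j then 1 else 0) + 2 * mu * e i j) * e i j
      = (if i = j then lam * t * e i j else 0) + 2 * mu * e i j ^ 2 := fun i j => by
    split_ifs <;> ring
  simp only [this, Finset.sum_add_distrib, Finset.sum_ite_eq, Finset.mem_univ, if_true,
    Finset.mul_sum]

theorem sum_stress_sq (lam mu t : ℝ) (e : Fin d → Fin d → ℝ) :
    ∑ i, ∑ j, (lam * t * (if i = j then 1 else 0) + 2 * mu * e i j) ^ 2
      = d * (lam * t) ^ 2 + 4 * mu * (lam * t) * (∑ i, e i i)
        + 4 * mu ^ 2 * ∑ i, ∑ j, e i j ^ 2 := by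
  have : ∀ i j, (lam * t * (if i = j then 1 else 0) + 2 * mu * e i j) ^ 2
      = ((if i = j then (lam * t) ^ 2 else 0) + (if i = j then 4 * mu * (lam * t) * e i j else 0))
        + 4 * mu ^ 2 * e i j ^ 2 := fun i j => by
    split_ifs <;> ring
  simp only [this, Finset.sum_add_distrib, Finset.sum_ite_eq, Finset.mem_univ, if_true,
    Finset.mul_sum]
  simp

theorem sq_trace_le (e : Fin d → Fin d → ℝ) :
    (∑ i, e i i) ^ 2 ≤ d * ∑ i, ∑ j, e i j ^ 2 := by
  have h := sq_sum_le_card_mul_sum_sq (s := Finset.univ) (f := fun i : Fin d => e i i)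
  simp only [Finset.card_univ, Fintype.card_fin] at h
  refine h.trans ?_
  gcongr with i
  exact Finset.single_le_sum (f := fun j => e i j ^ 2) (fun j _ => sq_nonneg _) (Finset.mem_univ i)

/-- The value is attained at the normalized identity `I / √d`. The upper bound through `sq_trace_le`
is there to make the supremum meaningful. -/
theorem le_stiffnessNorm (hd : 1 ≤ d) {lam mu : ℝ} (hlam : 0 ≤ lam) :
    lam * d + 2 * mu ≤ stiffnessNorm d lam mu := by
  have hd' : (0 : ℝ) < d := by exact_mod_cast hd
  refine le_csSup ⟨lam * d + 2 * mu, ?_⟩ ?_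
  · rintro r ⟨e, -, he, rfl⟩
    rw [sum_stress_mul, he]
    have := sq_trace_le e
    rw [he] at this
    nlinarith
  · refine ⟨fun i j => if i = j then (Real.sqrt d)⁻¹ else 0, fun i j => by simp [eq_comm], ?_, ?_⟩
    · simp [ite_pow, Real.sq_sqrt hd'.le, hd'.ne']
    · rw [sum_stress_mul]
      have hs : Real.sqrt d * Real.sqrt d = d := Real.mul_self_sqrt hd'.le
      have hs0 : Real.sqrt d ≠ 0 := by positivity
      simp [ite_pow, Real.sq_sqrt hd'.le, hd'.ne']
      field_simp
      nlinarith

/-- An instance of `|𝔻ε|² ≤ |𝔻| (𝔻ε : ε)`. With `λ d + 2μ` in place of `|𝔻|` the difference of the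
two sides is `2λμ (d |ε|² - (tr ε)²)`, nonnegative by Cauchy–Schwarz. -/
theorem stress_sq_le (hd : 1 ≤ d) {lam mu : ℝ} (hlam : 0 ≤ lam) (hmu : 0 ≤ mu)
    (e : Fin d → Fin d → ℝ) :
    ∑ i, ∑ j, (lam * (∑ k, e k k) * (if i = j then 1 else 0) + 2 * mu * e i j) ^ 2
      ≤ stiffnessNorm d lam mu *
        ∑ i, ∑ j, (lam * (∑ k, e k k) * (if i = j then 1 else 0) + 2 * mu * e i j) * e i j := by
  rw [sum_stress_mul, sum_stress_sq]
  set t := ∑ k, e k k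
  set N := ∑ i, ∑ j, e i j ^ 2
  have ht : t ^ 2 ≤ d * N := sq_trace_le e
  have hN : 0 ≤ N := Finset.sum_nonneg fun i _ => Finset.sum_nonneg fun j _ => sq_nonneg _
  have h1 := le_stiffnessNorm (mu := mu) hd hlam
  calc d * (lam * t) ^ 2 + 4 * mu * (lam * t) * t + 4 * mu ^ 2 * N
      ≤ (lam * d + 2 * mu) * (lam * t * t + 2 * mu * N) := by
        nlinarith [mul_le_mul_of_nonneg_left ht (mul_nonneg hlam hmu)]
    _ ≤ _ := by
        refine mul_le_mul_of_nonneg_right h1 ?_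
        have : 0 ≤ lam * t * t := by rw [mul_assoc]; exact mul_nonneg hlam (mul_self_nonneg t)
        positivity

end Stiffness

/-! ## Equivalence of the discontinuous Galerkin forms and norms -/

section Coercivity

variable {d : ℕ} {M : CoupledMesh d}

namespace CoupledMesh

theorem mem_poroElems {κ : M.Elem} : κ ∈ M.poroElems ↔ κ ∈ M.poro := by simp [poroElems]

theorem mem_acouElems {κ : M.Elem} : κ ∈ M.acouElems ↔ κ ∉ M.poro := by simp [acouElems]

theorem mem_poroElems_of_poroFaces {F : M.Face} (hF : F ∈ M.poroFaces) {κ : M.Elem}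
    (h : F ∈ M.facesOf κ) : κ ∈ M.poroElems := by
  simp only [poroFaces, Finset.mem_filter, Finset.mem_univ, true_and] at hF
  rw [mem_poroElems]
  rcases h with rfl | h
  · exact hF.1
  · rcases hF.2 with ⟨κ', hκ', h'⟩ | hD
    · rw [h] at h'; cases h'; exact hκ'
    · rw [M.dirichlet_boundary F hD] at h; cases h

theorem mem_acouElems_of_acouFaces {F : M.Face} (hF : F ∈ M.acouFaces) {κ : M.Elem}
    (h : F ∈ M.facesOf κ) : κ ∈ M.acouElems := by
  simp only [acouFaces, Finset.mem_filter, Finset.mem_univ, true_and] at hF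
  rw [mem_acouElems]
  rcases h with rfl | h
  · exact hF.1
  · rcases hF.2 with ⟨κ', hκ', h'⟩ | hD
    · rw [h] at h'; cases h'; exact hκ'
    · rw [M.dirichlet_boundary F hD] at h; cases h

/-- The second element of an interface face is acoustic. Thus the only poro-elastic trace on a
sealed face comes from `κ⁺`, and the one-sided penalty `gammaSealed` is large enough. -/
theorem eq_plus_of_interfaceFaces {F : M.Face} (hF : F ∈ M.interfaceFaces) {κ : M.Elem}
    (hκ : κ ∈ M.poroElems) (h : F ∈ M.facesOf κ) : κ = M.plus F := by
  simp only [interfaceFaces, Finset.mem_filter, Finset.mem_univ, true_and] at hF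
  rw [mem_poroElems] at hκ
  rcases h with rfl | h
  · rfl
  · obtain ⟨κ', hκ', h'⟩ := hF.2
    rw [h] at h'; cases h'; exact absurd hκ hκ'

theorem plus_mem_of_interfaceFaces {F : M.Face} (hF : F ∈ M.interfaceFaces) :
    M.plus F ∈ M.poroElems := by
  simp only [interfaceFaces, Finset.mem_filter, Finset.mem_univ, true_and] at hF
  exact mem_poroElems.2 hF.1

theorem le_faceMax (q : M.Elem → ℝ) {F : M.Face} {κ : M.Elem} (h : F ∈ M.facesOf κ) :
    q κ ≤ M.faceMax q F := by
  unfold faceMax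
  rcases h with rfl | h
  · split
    · exact le_rfl
    · exact le_max_left _ _
  · rw [h]; exact le_max_right _ _

open Classical in
theorem sum_avg_sq_le {ι : Type*} [Fintype ι] (G : ι → M.SField) (Es : Finset M.Elem) {F : M.Face}
    (h : ∀ κ, F ∈ M.facesOf κ → κ ∈ Es) (x : Pt d) :
    ∑ i, M.avg (G i) F x ^ 2 ≤ ∑ κ ∈ Es with F ∈ M.facesOf κ, ∑ i, val (G i κ) x ^ 2 := by
  have hp : M.plus F ∈ Finset.filter (fun κ => F ∈ M.facesOf κ) Es :=
    Finset.mem_filter.2 ⟨h _ (Or.inl rfl), Or.inl rfl⟩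
  have hnn : ∀ κ : M.Elem, 0 ≤ ∑ i, val (G i κ) x ^ 2 := fun κ =>
    Finset.sum_nonneg fun i _ => sq_nonneg _
  unfold avg
  rcases hm : M.minus F with _ | κ
  · exact Finset.single_le_sum (f := fun κ => ∑ i, val (G i κ) x ^ 2) (fun κ _ => hnn κ) hp
  · have hκ : κ ∈ Finset.filter (fun κ => F ∈ M.facesOf κ) Es :=
      Finset.mem_filter.2 ⟨h _ (Or.inr hm), Or.inr hm⟩
    -- The two neighbours must differ in order to count as two terms of the sum over adjacent
    -- elements.
    have hne : M.plus F ≠ κ := fun he => M.minus_ne_plus F (by rw [hm, he])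
    refine le_trans ?_ (Finset.add_le_sum (f := fun κ => ∑ i, val (G i κ) x ^ 2)
      (fun κ _ => hnn κ) hp hκ hne)
    rw [← Finset.sum_add_distrib]
    refine Finset.sum_le_sum fun i _ => ?_
    dsimp only
    nlinarith [sq_nonneg (val (G i (M.plus F)) x - val (G i κ) x),
      sq_nonneg (val (G i (M.plus F)) x), sq_nonneg (val (G i κ) x)]

end CoupledMesh

namespace Coeffs

variable (c : Coeffs M)

theorem penalty_pos (hd : 1 ≤ d) {D : ℝ} (hD : 0 < D) (κ : M.Elem) :
    0 < D * (M.deg κ : ℝ) ^ 2 * (M.diam κ)⁻¹ := by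
  have h1 : 0 < M.deg κ := M.one_le_deg κ
  have h2 := M.diam_pos hd κ
  positivity

theorem faceMax_penalty_pos (hd : 1 ≤ d) (D : M.Elem → ℝ) {F : M.Face} (hD : 0 < D (M.plus F)) :
    0 < M.faceMax (fun κ => D κ * (M.deg κ : ℝ) ^ 2 * (M.diam κ)⁻¹) F :=
  (penalty_pos hd hD _).trans_le
    (CoupledMesh.le_faceMax (fun κ => D κ * (M.deg κ : ℝ) ^ 2 * (M.diam κ)⁻¹) (Or.inl rfl))

/-- Expressing the divergence as the trace of the strain makes the stress a pointwise function of
the strain, so that the tensor inequalities apply. -/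
theorem val_stress (v : M.VField) (κ : M.Elem) (i j : Fin d) (x : Pt d) :
    val (c.stress v i j κ) x = c.lam κ * (∑ k, val (M.strain v k k κ) x)
        * (if i = j then 1 else 0) + 2 * c.mu κ * val (M.strain v i j κ) x := by
  have : ∀ k, val (M.strain v k k κ) x = val (MvPolynomial.pderiv k (v κ k)) x := fun k => by
    simp [CoupledMesh.strain]; ring
  simp only [this, stress, CoupledMesh.dvg, val_add, val_mul, val_C, val_sum, val_ite, val_one,
    val_zero]

variable {c} in
-- On the diagonal the two consistency terms coincide, so the form is the norm minus `2 X`. The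
-- two-sided bound serves as coercivity at time `t` and as continuity at time 0, with constants 1/2
-- and 3/2 for every size of the penalties above the threshold.
theorem abs_elasticForm_sub_le (hd : 1 ≤ d) {creg lo hi : ℝ} (hreg : M.IsPolytopicRegular creg)
    (hc : c.IsAdmissible lo hi) {P : Penalties} (hP : 8 * traceConst d creg + 1 ≤ P.sigma0)
    {u : M.VField} (hu : M.IsPoroDiscrete u) :
    |c.elasticForm P u u - c.dgElastic P u| ≤ 1 / 2 * c.dgElastic P u := by
  have hCt : 0 ≤ traceConst d creg := by rw [traceConst]; positivity
  have hlam : ∀ κ ∈ M.poroElems, 0 < c.lam κ := fun κ hκ =>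
    (hc.poro_pos κ (CoupledMesh.mem_poroElems.1 hκ)).2.2.1
  have hmu : ∀ κ ∈ M.poroElems, 0 < c.mu κ := fun κ hκ =>
    (hc.poro_pos κ (CoupledMesh.mem_poroElems.1 hκ)).2.2.2.1
  have hd' : (1 : ℝ) ≤ d := by exact_mod_cast hd
  have hD : ∀ κ ∈ M.poroElems, 0 < stiffnessNorm d (c.lam κ) (c.mu κ) := fun κ hκ => by
    have h1 := hlam κ hκ
    have h2 := hmu κ hκ
    exact lt_of_lt_of_le (by positivity) (le_stiffnessNorm hd h1.le)
  have hG : ∀ ij : Fin d × Fin d, ∀ κ ∈ M.poroElems,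
      (c.stress u ij.1 ij.2 κ).totalDegree ≤ M.deg κ := fun ij κ hκ => by
    have hdeg := hu.1 κ (CoupledMesh.mem_poroElems.1 hκ)
    refine (MvPolynomial.totalDegree_add _ _).trans (max_le ?_ ?_)
    · exact (totalDegree_ite_mul_le _ _).trans ((totalDegree_C_mul_le _ _).trans
        (M.totalDegree_dvg_le hdeg))
    · exact (totalDegree_C_mul_le _ _).trans (M.totalDegree_strain_le hdeg _ _)
  have hvol : ∀ κ ∈ M.poroElems,
      ∑ ij : Fin d × Fin d, M.cellInt κ (fun x => val (c.stress u ij.1 ij.2 κ) x ^ 2)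
        ≤ stiffnessNorm d (c.lam κ) (c.mu κ) * M.cellInt κ fun x =>
          ∑ i, ∑ j, val (c.stress u i j κ) x * val (M.strain u i j κ) x := fun κ hκ => by
    rw [← CoupledMesh.cellInt_sum _ _ _ (by fun_prop), ← CoupledMesh.cellInt_const_mul]
    refine M.cellInt_mono κ (by fun_prop) (by fun_prop) fun x => ?_
    rw [Fintype.sum_prod_type]
    simp only [val_stress]
    exact stress_sq_le hd (hlam κ hκ).le (hmu κ hκ).le fun i j => val (M.strain u i j κ) x
  have key := CoupledMesh.abs_consistency_le hd hreg (ι := Fin d × Fin d) M.poroElems M.poroFaces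
    (fun ij => c.stress u ij.1 ij.2)
    hG
    (fun ij F x => M.avg (c.stress u ij.1 ij.2) F x) (fun ij F x => M.jumpT u F ij.1 ij.2 x)
    (fun _ _ => by fun_prop) (fun _ _ => by fun_prop)
    (fun F hF x => CoupledMesh.sum_avg_sq_le (fun ij : Fin d × Fin d => c.stress u ij.1 ij.2) _
      (fun κ => CoupledMesh.mem_poroElems_of_poroFaces hF) x)
    (fun κ => stiffnessNorm d (c.lam κ) (c.mu κ))
    (fun κ => M.cellInt κ fun x => ∑ i, ∑ j, val (c.stress u i j κ) x * val (M.strain u i j κ) x)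
    hD
    hvol
    (c.etaPen P) P.sigma0 hP
    (fun F hF => mul_pos (by linarith) (faceMax_penalty_pos hd (fun κ => stiffnessNorm d (c.lam κ) (c.mu κ)) (hD _
      (CoupledMesh.mem_poroElems_of_poroFaces hF (Or.inl rfl)))))
    (fun F hF κ hκ h => mul_le_mul_of_nonneg_left
      (CoupledMesh.le_faceMax (fun κ => stiffnessNorm d (c.lam κ) (c.mu κ)
        * (M.deg κ : ℝ) ^ 2 * (M.diam κ)⁻¹) h) (by linarith))
  simp only [Fintype.sum_prod_type] at key
  set X := ∑ F ∈ M.poroFaces, M.faceInt F (fun x =>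
      ∑ i, ∑ j, M.avg (c.stress u i j) F x * M.jumpT u F i j x) with hX
  have e : c.elasticForm P u u - c.dgElastic P u = -(2 * X) := by
    rw [elasticForm, dgElastic, hX]
    simp only [mul_comm (M.jumpT u _ _ _ _) (M.avg _ _ _), ← pow_two]
    ring
  have hV : 0 ≤ ∑ κ ∈ M.poroElems, M.cellInt κ fun x =>
      ∑ i, ∑ j, val (c.stress u i j κ) x * val (M.strain u i j κ) x := by
    refine Finset.sum_nonneg fun κ hκ => M.cellInt_nonneg κ fun x => ?_
    simp only [val_stress, sum_stress_mul]
    have h1 := (hlam κ hκ).le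
    have h2 := (hmu κ hκ).le
    rw [mul_assoc]
    have := mul_self_nonneg (∑ k, val (M.strain u k k κ) x)
    positivity
  rw [e, abs_neg, dgElastic]
  linarith

variable {c} in
/-- The pore-pressure form, including the terms on the sealed faces, is equivalent to its norm. -/
theorem abs_poreForm_sub_le (hd : 1 ≤ d) {creg lo hi : ℝ} (hreg : M.IsPolytopicRegular creg)
    (hc : c.IsAdmissible lo hi) {P : Penalties} (hP : 8 * traceConst d creg + 1 ≤ P.m0)
    (S : SealedTerm) (τ : M.Face → ℝ)
    {u w : M.VField} (hu : M.IsPoroDiscrete u) (hw : M.IsPoroDiscrete w) :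
    |c.poreForm P S τ u w u w - (c.dgPore P (c.tot u w) + ∑ F ∈ M.sealedFaces τ,
        M.faceInt F (fun x => c.gammaSealed P F * c.sealedFlux S u w F x ^ 2))|
      ≤ 1 / 2 * (c.dgPore P (c.tot u w) + ∑ F ∈ M.sealedFaces τ,
        M.faceInt F (fun x => c.gammaSealed P F * c.sealedFlux S u w F x ^ 2)) := by
  have hCt : 0 ≤ traceConst d creg := by rw [traceConst]; positivity
  have hm : ∀ κ ∈ M.poroElems, 0 < c.biot κ := fun κ hκ =>
    (hc.poro_pos κ (CoupledMesh.mem_poroElems.1 hκ)).2.2.2.2.2.2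
  set X := c.tot u w with hX
  have hdegX : ∀ κ ∈ M.poroElems, ∀ i, (X κ i).totalDegree ≤ M.deg κ := fun κ hκ i =>
    (MvPolynomial.totalDegree_add _ _).trans (max_le ((totalDegree_C_mul_le _ _).trans
      (hu.1 κ (CoupledMesh.mem_poroElems.1 hκ) i)) (hw.1 κ (CoupledMesh.mem_poroElems.1 hκ) i))
  have hG : ∀ _ : Unit, ∀ κ ∈ M.poroElems, (c.mDvg X κ).totalDegree ≤ M.deg κ := fun _ κ hκ =>
    (totalDegree_C_mul_le _ _).trans (M.totalDegree_dvg_le (hdegX κ hκ))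
  have hvol : ∀ κ ∈ M.poroElems, ∑ _ : Unit, M.cellInt κ (fun x => val (c.mDvg X κ) x ^ 2)
      ≤ c.biot κ * M.cellInt κ fun x => c.biot κ * val (M.dvg X κ) x ^ 2 := fun κ _ => by
    rw [← CoupledMesh.cellInt_const_mul]
    simp only [Finset.univ_unique, Finset.sum_singleton]
    refine M.cellInt_mono κ (by fun_prop) (by fun_prop) fun x => le_of_eq ?_
    simp only [mDvg, val_mul, val_C]; ring
  have hfl : ∀ F, Continuous (c.sealedFlux S u w F) := fun F => by
    cases S
    exacts [M.continuous_flux _ _, M.continuous_flux _ _]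
  have hsub : ∀ F ∈ M.sealedFaces τ, F ∈ M.interfaceFaces := fun F hF => by
    classical exact (Finset.mem_filter.1 hF).1
  have key1 := CoupledMesh.abs_consistency_le hd hreg (ι := Unit) M.poroElems M.poroFaces
    (fun _ => c.mDvg X) hG
    (fun _ F x => M.avg (c.mDvg X) F x) (fun _ F x => M.jumpN X F x)
    (fun _ _ => by fun_prop) (fun _ _ => by fun_prop)
    (fun F hF x => CoupledMesh.sum_avg_sq_le (fun _ : Unit => c.mDvg X) _
      (fun κ => CoupledMesh.mem_poroElems_of_poroFaces hF) x)
    c.biot (fun κ => M.cellInt κ fun x => c.biot κ * val (M.dvg X κ) x ^ 2) hm hvol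
    (c.gammaPen P) P.m0 hP
    (fun F hF => mul_pos (by linarith) (faceMax_penalty_pos hd c.biot (hm _
      (CoupledMesh.mem_poroElems_of_poroFaces hF (Or.inl rfl)))))
    (fun F hF κ hκ h => mul_le_mul_of_nonneg_left
      (CoupledMesh.le_faceMax (fun κ => c.biot κ * (M.deg κ : ℝ) ^ 2 * (M.diam κ)⁻¹) h)
      (by linarith))
  -- This uses the second quarter of the volume term. The flux against which the sealed penalty acts
  -- enters as an arbitrary continuous `J`, while the consistency term always carries the trace of
  -- `m ∇·X`; therefore both sealed variants are covered at once.
  have key2 := CoupledMesh.abs_consistency_le hd hreg (ι := Unit) M.poroElems (M.sealedFaces τ)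
    (fun _ => c.mDvg X) hG
    (fun _ F x => val (c.mDvg X (M.plus F)) x) (fun _ F x => c.sealedFlux S u w F x)
    (fun _ _ => by fun_prop) (fun _ F => hfl F)
    (fun F hF x => by
      classical
      exact Finset.single_le_sum (f := fun κ => ∑ _ : Unit, val (c.mDvg X κ) x ^ 2)
        (fun κ _ => Finset.sum_nonneg fun _ _ => sq_nonneg _)
        (Finset.mem_filter.2 ⟨CoupledMesh.plus_mem_of_interfaceFaces (hsub F hF), Or.inl rfl⟩))
    c.biot (fun κ => M.cellInt κ fun x => c.biot κ * val (M.dvg X κ) x ^ 2) hm hvol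
    (c.gammaSealed P) P.m0 hP
    (fun F hF => mul_pos (by linarith) (penalty_pos hd
      (hm _ (CoupledMesh.plus_mem_of_interfaceFaces (hsub F hF))) _))
    (fun F hF κ hκ h => by
      rw [CoupledMesh.eq_plus_of_interfaceFaces (hsub F hF) hκ h, gammaSealed])
  simp only [Finset.univ_unique, Finset.sum_singleton] at key1 key2
  set X1 := ∑ F ∈ M.poroFaces, M.faceInt F (fun x =>
      M.avg (c.mDvg X) F x * M.jumpN X F x) with hX1
  set X2 := ∑ F ∈ M.sealedFaces τ, M.faceInt F (fun x =>
      val (c.mDvg X (M.plus F)) x * c.sealedFlux S u w F x) with hX2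
  have e : c.poreForm P S τ u w u w - (c.dgPore P X + ∑ F ∈ M.sealedFaces τ,
      M.faceInt F (fun x => c.gammaSealed P F * c.sealedFlux S u w F x ^ 2))
      = -(2 * X1 + 2 * X2) := by
    rw [poreForm, dgPore, hX1, hX2, ← hX]
    simp only [mul_comm (M.jumpN X _ _) (M.avg _ _ _), mul_comm (c.sealedFlux S u w _ _) (val _ _),
      mul_assoc, ← pow_two]
    ring
  have hV : 0 ≤ ∑ κ ∈ M.poroElems, M.cellInt κ fun x => c.biot κ * val (M.dvg X κ) x ^ 2 :=
    Finset.sum_nonneg fun κ hκ => M.cellInt_nonneg κ fun x =>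
      mul_nonneg (hm κ hκ).le (sq_nonneg _)
  rw [e, abs_neg, dgPore]
  have := abs_add_le (2 * X1) (2 * X2)
  linarith

variable {c} in
theorem abs_acousticForm_sub_le (hd : 1 ≤ d) {creg lo hi : ℝ} (hreg : M.IsPolytopicRegular creg)
    (hc : c.IsAdmissible lo hi) {P : Penalties} (hP : 8 * traceConst d creg + 1 ≤ P.rho0)
    {φ : M.SField} (hφ : M.IsAcouDiscrete φ) :
    |c.acousticForm P φ φ - c.dgAcoustic P φ| ≤ 1 / 2 * c.dgAcoustic P φ := by
  have hCt : 0 ≤ traceConst d creg := by rw [traceConst]; positivity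
  have hD : ∀ κ ∈ M.acouElems, 0 < c.rhoA κ := fun κ hκ =>
    (hc.acou_pos κ (CoupledMesh.mem_acouElems.1 hκ)).1
  have key := CoupledMesh.abs_consistency_le hd hreg (ι := Fin d) M.acouElems M.acouFaces
    (fun i κ => c.rhoGrad φ κ i)
    (fun i κ hκ => (totalDegree_C_mul_le _ _).trans ((totalDegree_pderiv_le _ _).trans
      (hφ.1 κ (CoupledMesh.mem_acouElems.1 hκ))))
    (fun i F x => M.avg (fun κ => c.rhoGrad φ κ i) F x) (fun i F x => M.jump φ F i x)
    (fun _ _ => by fun_prop) (fun _ _ => by fun_prop)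
    (fun F hF x => CoupledMesh.sum_avg_sq_le (fun i κ => c.rhoGrad φ κ i) _
      (fun κ => CoupledMesh.mem_acouElems_of_acouFaces hF) x)
    c.rhoA
    (fun κ => M.cellInt κ fun x => c.rhoA κ * ∑ i, val (M.grad φ κ i) x ^ 2)
    hD
    (fun κ hκ => by
      rw [← CoupledMesh.cellInt_sum _ _ _ (by fun_prop), ← CoupledMesh.cellInt_const_mul]
      refine M.cellInt_mono κ (by fun_prop) (by fun_prop) fun x => le_of_eq ?_
      rw [← mul_assoc, Finset.mul_sum]
      refine Finset.sum_congr rfl fun i _ => ?_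
      simp only [rhoGrad, val_mul, val_C]; ring)
    (c.chiPen P) P.rho0 hP
    (fun F hF => mul_pos (by linarith) (faceMax_penalty_pos hd c.rhoA (hD _
      (CoupledMesh.mem_acouElems_of_acouFaces hF (Or.inl rfl)))))
    (fun F hF κ hκ h => mul_le_mul_of_nonneg_left
      (CoupledMesh.le_faceMax (fun κ => c.rhoA κ * (M.deg κ : ℝ) ^ 2 * (M.diam κ)⁻¹) h)
      (by linarith))
  set X := ∑ F ∈ M.acouFaces, M.faceInt F (fun x =>
      ∑ i, M.avg (fun κ => c.rhoGrad φ κ i) F x * M.jump φ F i x) with hX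
  have e : c.acousticForm P φ φ - c.dgAcoustic P φ = -(2 * X) := by
    have hvol : ∀ κ x, ∑ i, val (c.rhoGrad φ κ i) x * val (M.grad φ κ i) x
        = c.rhoA κ * ∑ i, val (M.grad φ κ i) x ^ 2 := fun κ x => by
      rw [Finset.mul_sum]
      refine Finset.sum_congr rfl fun i _ => ?_
      simp only [rhoGrad, val_mul, val_C]; ring
    rw [acousticForm, dgAcoustic, hX]
    simp only [hvol, mul_comm (M.jump φ _ _ _) (M.avg _ _ _), ← pow_two]
    ring
  have hV : 0 ≤ ∑ κ ∈ M.acouElems, M.cellInt κ fun x =>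
      c.rhoA κ * ∑ i, val (M.grad φ κ i) x ^ 2 :=
    Finset.sum_nonneg fun κ hκ => M.cellInt_nonneg κ fun x =>
      mul_nonneg (hD κ hκ).le (Finset.sum_nonneg fun i _ => sq_nonneg _)
  rw [e, abs_neg, dgAcoustic]
  linarith

end Coeffs

end Coercivity

/-! ## Absolutely continuous paths in finite-dimensional spaces -/

section Paths

/-- `y` is absolutely continuous on `[0,T]` with a.e. derivative `yt`. -/
def IsScalarPrimitive (T : ℝ) (y yt : ℝ → ℝ) : Prop :=
  IntervalIntegrable yt volume 0 T ∧ ∀ t ∈ Icc 0 T, y t = y 0 + ∫ s in (0 : ℝ)..t, yt s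

theorem IsScalarPrimitive.continuousOn {T : ℝ} (hT : 0 ≤ T) {y yt : ℝ → ℝ}
    (h : IsScalarPrimitive T y yt) : ContinuousOn y (Icc 0 T) := by
  have h1 := (h.1.absolutelyContinuousOnInterval_intervalIntegral (c := 0) (by simp)).continuousOn
  rw [uIcc_of_le hT] at h1
  exact (continuousOn_const.add h1).congr h.2

/-- The product rule is applied to the indefinite integrals `Y` and `Z`: they are absolutely
continuous, and agree with `y` and `z` on `[0,T]`, outside of which nothing is known about `y` and
`z`. -/
theorem IsScalarPrimitive.mul {T : ℝ} (hT : 0 ≤ T) {y yt z zt : ℝ → ℝ} (hy : IsScalarPrimitive T y yt)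
    (hz : IsScalarPrimitive T z zt) :
    IsScalarPrimitive T (fun t => y t * z t) (fun t => yt t * z t + y t * zt t) := by
  have hcy := hy.continuousOn hT
  have hcz := hz.continuousOn hT
  refine ⟨?_, fun t ht => ?_⟩
  · rw [← uIcc_of_le hT] at hcy hcz
    exact (hy.1.mul_continuousOn hcz).add (hz.1.continuousOn_mul hcy)
  · have hsub : uIcc 0 t ⊆ uIcc 0 T := by
      rw [uIcc_of_le hT, uIcc_of_le ht.1]; exact Icc_subset_Icc_right ht.2
    have hyi := hy.1.mono_set hsub
    have hzi := hz.1.mono_set hsub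
    set Y : ℝ → ℝ := fun t => y 0 + ∫ s in (0 : ℝ)..t, yt s
    set Z : ℝ → ℝ := fun t => z 0 + ∫ s in (0 : ℝ)..t, zt s
    have hYac : AbsolutelyContinuousOnInterval Y 0 t :=
      (LipschitzOnWith.absolutelyContinuousOnInterval (LipschitzWith.const (y 0)).lipschitzOnWith).add
        (hyi.absolutelyContinuousOnInterval_intervalIntegral (c := 0) (by simp))
    have hZac : AbsolutelyContinuousOnInterval Z 0 t :=
      (LipschitzOnWith.absolutelyContinuousOnInterval (LipschitzWith.const (z 0)).lipschitzOnWith).add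
        (hzi.absolutelyContinuousOnInterval_intervalIntegral (c := 0) (by simp))
    have key := hYac.integral_deriv_mul_eq_sub hZac
    have hYd := hyi.ae_hasDerivAt_integral
    have hZd := hzi.ae_hasDerivAt_integral
    have e : ∫ s in (0 : ℝ)..t, deriv Y s * Z s + Y s * deriv Z s
        = ∫ s in (0 : ℝ)..t, yt s * z s + y s * zt s := by
      refine intervalIntegral.integral_congr_ae ?_
      filter_upwards [hYd, hZd] with s h1 h2 hs
      have hs' : s ∈ uIcc 0 t := uIoc_subset_uIcc hs
      have hs'' : s ∈ Icc 0 T := by rw [← uIcc_of_le hT]; exact hsub hs'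
      have e1 : deriv Y s = yt s := ((h1 hs' 0 (by simp)).const_add (y 0)).deriv
      have e2 : deriv Z s = zt s := ((h2 hs' 0 (by simp)).const_add (z 0)).deriv
      rw [e1, e2, hy.2 s hs'', hz.2 s hs'']
    have hY0 : Y 0 = y 0 := by simp [Y]
    have hZ0 : Z 0 = z 0 := by simp [Z]
    have hyt : y t = Y t := hy.2 t ht
    have hzt : z t = Z t := hz.2 t ht
    dsimp only
    rw [← e, key, hY0, hZ0, hyt, hzt]
    ring

theorem IsScalarPrimitive.add {T : ℝ} (hT : 0 ≤ T) {y yt z zt : ℝ → ℝ}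
    (hy : IsScalarPrimitive T y yt) (hz : IsScalarPrimitive T z zt) :
    IsScalarPrimitive T (fun t => y t + z t) (fun t => yt t + zt t) := by
  refine ⟨hy.1.add hz.1, fun t ht => ?_⟩
  have hsub : uIcc 0 t ⊆ uIcc 0 T := by
    rw [uIcc_of_le hT, uIcc_of_le ht.1]; exact Icc_subset_Icc_right ht.2
  dsimp only
  rw [intervalIntegral.integral_add (hy.1.mono_set hsub) (hz.1.mono_set hsub), hy.2 t ht, hz.2 t ht]
  ring

theorem IsScalarPrimitive.sum {T : ℝ} (hT : 0 ≤ T) {ι : Type*} [Fintype ι] {y yt : ι → ℝ → ℝ}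
    (h : ∀ i, IsScalarPrimitive T (y i) (yt i)) :
    IsScalarPrimitive T (fun t => ∑ i, y i t) (fun t => ∑ i, yt i t) := by
  refine ⟨?_, fun t ht => ?_⟩
  · have := IntervalIntegrable.sum Finset.univ fun i _ => (h i).1
    simpa only [← Finset.sum_apply] using this
  · rw [intervalIntegral.integral_finsetSum fun i _ => (h i).1.mono_set (by
      rw [uIcc_of_le hT, uIcc_of_le ht.1]; exact Icc_subset_Icc_right ht.2),
      ← Finset.sum_add_distrib]
    exact Finset.sum_congr rfl fun i _ => (h i).2 t ht

theorem IsScalarPrimitive.mul_const {T : ℝ} {y yt : ℝ → ℝ} (h : IsScalarPrimitive T y yt) (r : ℝ) :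
    IsScalarPrimitive T (fun t => y t * r) (fun t => yt t * r) := by
  refine ⟨h.1.mul_const r, fun t ht => ?_⟩
  dsimp only
  rw [intervalIntegral.integral_mul_const, h.2 t ht, add_mul]

theorem IsScalarPrimitive.congr {T : ℝ} (hT : 0 ≤ T) {y yt z zt : ℝ → ℝ}
    (h : IsScalarPrimitive T y yt) (hz : ∀ t ∈ Icc 0 T, z t = y t)
    (hzt : ∀ᵐ t ∂(volume.restrict (Ioc 0 T)), zt t = yt t) : IsScalarPrimitive T z zt := by
  have hzt' : zt =ᵐ[volume.restrict (Ioc 0 T)] yt := hzt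
  refine ⟨h.1.congr_ae (by rw [uIoc_of_le hT]; exact hzt'.symm), fun t ht => ?_⟩
  rw [hz t ht, hz 0 ⟨le_rfl, hT⟩, h.2 t ht]
  congr 1
  rw [intervalIntegral.integral_of_le ht.1, intervalIntegral.integral_of_le ht.1]
  exact integral_congr_ae
    (ae_restrict_of_ae_restrict_of_subset (Ioc_subset_Ioc_right ht.2) hzt'.symm)

/-- Bilinearity of an unbundled real function of two variables. -/
structure IsBilin {V W : Type*} [AddCommGroup V] [Module ℝ V] [AddCommGroup W] [Module ℝ W]
    (f : V → W → ℝ) : Prop where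
  left : ∀ b, IsLinearMap ℝ fun a => f a b
  right : ∀ a, IsLinearMap ℝ (f a)

variable {V W : Type*} [AddCommGroup V] [Module ℝ V] [AddCommGroup W] [Module ℝ W]

namespace IsBilin

theorem zero : IsBilin fun (_ : V) (_ : W) => (0 : ℝ) :=
  ⟨fun _ => ⟨by simp, by simp⟩, fun _ => ⟨by simp, by simp⟩⟩

theorem add {f g : V → W → ℝ} (hf : IsBilin f) (hg : IsBilin g) :
    IsBilin fun a b => f a b + g a b :=
  ⟨fun b => ⟨fun x y => by simp only [(hf.left b).map_add, (hg.left b).map_add]; ring,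
    fun r x => by simp only [(hf.left b).map_smul, (hg.left b).map_smul, smul_add]⟩,
  fun a => ⟨fun x y => by simp only [(hf.right a).map_add, (hg.right a).map_add]; ring,
    fun r x => by simp only [(hf.right a).map_smul, (hg.right a).map_smul, smul_add]⟩⟩

theorem const_mul {f : V → W → ℝ} (hf : IsBilin f) (r : ℝ) : IsBilin fun a b => r * f a b :=
  ⟨fun b => ⟨fun x y => by simp only [(hf.left b).map_add]; ring,
    fun r x => by simp only [(hf.left b).map_smul, smul_eq_mul]; ring⟩,
  fun a => ⟨fun x y => by simp only [(hf.right a).map_add]; ring,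
    fun r x => by simp only [(hf.right a).map_smul, smul_eq_mul]; ring⟩⟩

theorem sub {f g : V → W → ℝ} (hf : IsBilin f) (hg : IsBilin g) :
    IsBilin fun a b => f a b - g a b := by
  simpa [sub_eq_add_neg] using hf.add (hg.const_mul (-1))

theorem mul {f : V → ℝ} {g : W → ℝ} (hf : IsLinearMap ℝ f) (hg : IsLinearMap ℝ g) :
    IsBilin fun a b => f a * g b :=
  ⟨fun b => ⟨fun x y => by simp only [hf.map_add]; ring,
    fun r x => by simp only [hf.map_smul, smul_eq_mul]; ring⟩,
  fun a => ⟨fun x y => by simp only [hg.map_add]; ring,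
    fun r x => by simp only [hg.map_smul, smul_eq_mul]; ring⟩⟩

theorem sum {ι : Type*} (s : Finset ι) {f : ι → V → W → ℝ} (hf : ∀ i, IsBilin (f i)) :
    IsBilin fun a b => ∑ i ∈ s, f i a b := by
  classical
  induction s using Finset.induction_on with
  | empty => simpa using zero
  | insert i s hi ih => simpa [Finset.sum_insert hi] using (hf i).add ih

theorem integral {X : Type*} [MeasurableSpace X] {μ : Measure X} {q : V → W → X → ℝ}
    (hq : ∀ x, IsBilin fun a b => q a b x) (hi : ∀ a b, Integrable (q a b) μ) :
    IsBilin fun a b => ∫ x, q a b x ∂μ :=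
  ⟨fun b => ⟨fun x y => by
      simp only [((hq _).left b).map_add]
      exact integral_add (hi _ _) (hi _ _),
    fun r x => by
      simp only [((hq _).left b).map_smul]
      exact integral_smul _ _⟩,
  fun a => ⟨fun x y => by
      simp only [((hq _).right a).map_add]
      exact integral_add (hi _ _) (hi _ _),
    fun r x => by
      simp only [((hq _).right a).map_smul]
      exact integral_smul _ _⟩⟩

theorem sum_smul_sum_smul {f : V → W → ℝ} (hf : IsBilin f) {ι κ : Type*} [Fintype ι] [Fintype κ]
    (y : ι → ℝ) (e : ι → V) (z : κ → ℝ) (g : κ → W) :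
    f (∑ i, y i • e i) (∑ j, z j • g j) = ∑ i, ∑ j, y i * z j * f (e i) (g j) := by
  have h1 : ∀ b, f (∑ i, y i • e i) b = ∑ i, y i * f (e i) b := fun b => by
    refine (map_sum ((hf.left b).mk' _) (fun i => y i • e i) Finset.univ).trans ?_
    exact Finset.sum_congr rfl fun i _ => (hf.left b).map_smul _ _
  have h2 : ∀ a, f a (∑ j, z j • g j) = ∑ j, z j * f a (g j) := fun a => by
    refine (map_sum ((hf.right a).mk' _) (fun j => z j • g j) Finset.univ).trans ?_
    exact Finset.sum_congr rfl fun j _ => (hf.right a).map_smul _ _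
  rw [h1]
  refine Finset.sum_congr rfl fun i _ => ?_
  rw [h2, Finset.mul_sum]
  exact Finset.sum_congr rfl fun j _ => by ring

end IsBilin

/-- `Q` is an absolutely continuous path on `[0,T]` in a finite-dimensional subspace of `V`, with
a.e. derivative `Qt`. -/
def IsPath (T : ℝ) (Q Qt : ℝ → V) : Prop :=
  ∃ (ι : Type) (_ : Fintype ι) (e : ι → V) (y yt : ι → ℝ → ℝ),
    (∀ i, IsScalarPrimitive T (y i) (yt i)) ∧ (∀ t ∈ Icc 0 T, Q t = ∑ i, y i t • e i) ∧
      ∀ᵐ t ∂(volume.restrict (Ioc 0 T)), Qt t = ∑ i, yt i t • e i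

namespace IsPath

variable {T : ℝ}

theorem map {Q Qt : ℝ → V} (h : IsPath T Q Qt) (L : V →ₗ[ℝ] W) :
    IsPath T (fun t => L (Q t)) (fun t => L (Qt t)) := by
  obtain ⟨ι, _, e, y, yt, hy, hQ, hQt⟩ := h
  refine ⟨ι, inferInstance, fun i => L (e i), y, yt, hy, fun t ht => ?_, ?_⟩
  · simp [hQ t ht, map_sum]
  · filter_upwards [hQt] with t ht
    simp [ht, map_sum]

theorem sum {K : Type} [Fintype K] {Q Qt : K → ℝ → V} (h : ∀ k, IsPath T (Q k) (Qt k)) :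
    IsPath T (fun t => ∑ k, Q k t) (fun t => ∑ k, Qt k t) := by
  choose ι inst e y yt hy hQ hQt using h
  refine ⟨Σ k, ι k, inferInstance, fun p => e p.1 p.2, fun p => y p.1 p.2, fun p => yt p.1 p.2,
    fun p => hy p.1 p.2, fun t ht => ?_, ?_⟩
  · rw [Fintype.sum_sigma]
    exact Finset.sum_congr rfl fun k _ => hQ k t ht
  · filter_upwards [ae_all_iff.2 hQt] with t ht
    rw [Fintype.sum_sigma]
    exact Finset.sum_congr rfl fun k _ => ht k

theorem add {Q Qt R Rt : ℝ → V} (hQ : IsPath T Q Qt) (hR : IsPath T R Rt) :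
    IsPath T (fun t => Q t + R t) (fun t => Qt t + Rt t) := by
  have := IsPath.sum (K := Bool) (Q := fun b => if b then Q else R)
    (Qt := fun b => if b then Qt else Rt) (T := T) (by rintro (_ | _) <;> simpa)
  simpa using this

theorem pi {K : Type} [Fintype K] {W : K → Type*} [∀ k, AddCommGroup (W k)] [∀ k, Module ℝ (W k)]
    {Q Qt : ℝ → ∀ k, W k} (h : ∀ k, IsPath T (fun t => Q t k) (fun t => Qt t k)) :
    IsPath T Q Qt := by
  classical
  have := IsPath.sum fun k => (h k).map (LinearMap.single ℝ W k)
  simpa [Finset.univ_sum_single] using this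

theorem prodMk {Q Qt : ℝ → V} {R Rt : ℝ → W} (hQ : IsPath T Q Qt) (hR : IsPath T R Rt) :
    IsPath T (fun t => (Q t, R t)) (fun t => (Qt t, Rt t)) := by
  simpa using (hQ.map (LinearMap.inl ℝ V W)).add (hR.map (LinearMap.inr ℝ V W))

/-- Product rule for a bilinear function of two paths. -/
theorem bilin (hT : 0 ≤ T) {f : V → W → ℝ} (hf : IsBilin f) {Q Qt : ℝ → V} {R Rt : ℝ → W}
    (hQ : IsPath T Q Qt) (hR : IsPath T R Rt) :
    IsScalarPrimitive T (fun t => f (Q t) (R t)) (fun t => f (Qt t) (R t) + f (Q t) (Rt t)) := by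
  obtain ⟨ι, _, e, y, yt, hy, hQ, hQt⟩ := hQ
  obtain ⟨κ, _, g, z, zt, hz, hR, hRt⟩ := hR
  -- In coordinates the form is a finite sum of products of scalar functions, so the scalar product
  -- rule suffices and `V`, `W` need no topology.
  have h := IsScalarPrimitive.sum hT fun i => IsScalarPrimitive.sum hT fun j =>
    ((hy i).mul hT (hz j)).mul_const (f (e i) (g j))
  refine h.congr hT (fun t ht => ?_) ?_
  · rw [hQ t ht, hR t ht, hf.sum_smul_sum_smul]
  · filter_upwards [hQt, hRt, ae_restrict_mem measurableSet_Ioc] with t h1 h2 h3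
    have h3' : t ∈ Icc 0 T := Ioc_subset_Icc_self h3
    rw [h1, h2, hQ t h3', hR t h3', hf.sum_smul_sum_smul, hf.sum_smul_sum_smul,
      ← Finset.sum_add_distrib]
    refine Finset.sum_congr rfl fun i _ => ?_
    rw [← Finset.sum_add_distrib]
    exact Finset.sum_congr rfl fun j _ => by ring

end IsPath

end Paths

/-! ## Paths of polynomials -/

section PolyPaths

variable {d : ℕ} {T : ℝ} {q qt : ℝ → Poly d}

/-- All integrals of the derivative over `[0,t]` vanish, so the derivative vanishes almost
everywhere by Lebesgue differentiation. -/
theorem IsPrimitive.coeff_ae_eq_zero (hT : 0 ≤ T) (h : IsPrimitive T q qt) {α : Fin d →₀ ℕ}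
    (h0 : ∀ t ∈ Icc 0 T, (q t).coeff α = 0) :
    ∀ᵐ t ∂(volume.restrict (Ioc 0 T)), (qt t).coeff α = 0 := by
  obtain ⟨hi, he⟩ := h α
  have hI : ∀ t ∈ Icc 0 T, ∫ s in (0 : ℝ)..t, (qt s).coeff α = 0 := fun t ht => by
    have := he t ht
    rw [h0 t ht, h0 0 ⟨le_rfl, hT⟩] at this
    linarith
  have hne : ∀ᵐ t : ℝ, t ≠ T := by simp [ae_iff]
  rw [ae_restrict_iff' measurableSet_Ioc]
  filter_upwards [hi.ae_hasDerivAt_integral, hne] with t ht hne hmem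
  have hmem' : t ∈ Ioo 0 T := ⟨hmem.1, lt_of_le_of_ne hmem.2 hne⟩
  have h1 := ht (by rw [uIcc_of_le hT]; exact Ioc_subset_Icc_self hmem) 0 (by simp)
  have h2 : (fun x => ∫ s in (0 : ℝ)..x, (qt s).coeff α) =ᶠ[𝓝 t] fun _ => 0 := by
    filter_upwards [Ioo_mem_nhds hmem'.1 hmem'.2] with x hx
    exact hI x (Ioo_subset_Icc_self hx)
  exact h1.unique ((hasDerivAt_const t (0 : ℝ)).congr_of_eventuallyEq h2)

/-- When the derivative is itself a primitive it is continuous, and "almost everywhere" becomes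
"everywhere". -/
theorem IsPrimitive.coeff_eq_zero (hT : 0 < T) (h : IsPrimitive T q qt) {qtt : ℝ → Poly d}
    (h' : IsPrimitive T qt qtt) {α : Fin d →₀ ℕ}
    (h0 : ∀ t ∈ Icc 0 T, (q t).coeff α = 0) : ∀ t ∈ Icc 0 T, (qt t).coeff α = 0 := by
  have hae := h.coeff_ae_eq_zero hT.le h0
  have hc : ContinuousOn (fun t => (qt t).coeff α) (Icc 0 T) :=
    IsScalarPrimitive.continuousOn hT.le (h' α)
  rw [Measure.restrict_congr_set Ioc_ae_eq_Icc] at hae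
  exact Measure.eqOn_Icc_of_ae_eq volume hT.ne hae hc continuousOn_const

theorem coeff_eq_zero_of_totalDegree_le {p : Poly d} {n : ℕ} (hp : p.totalDegree ≤ n)
    {α : Fin d →₀ ℕ} (hα : n < α.degree) : p.coeff α = 0 := by
  by_contra h
  exact absurd ((MvPolynomial.le_totalDegree (MvPolynomial.mem_support_iff.2 h)).trans hp)
    (not_le.2 hα)

theorem totalDegree_le_of_coeff_eq_zero {p : Poly d} {n : ℕ}
    (h : ∀ α : Fin d →₀ ℕ, n < α.degree → p.coeff α = 0) : p.totalDegree ≤ n := by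
  refine Finset.sup_le fun α hα => ?_
  by_contra hlt
  exact MvPolynomial.mem_support_iff.1 hα (h α (not_le.1 hlt))

/-- Needed to see that velocities stay in the discrete space at every time and are therefore
admissible test functions. -/
theorem IsPrimitive.totalDegree_le (hT : 0 < T) (h : IsPrimitive T q qt) {qtt : ℝ → Poly d}
    (h' : IsPrimitive T qt qtt) {n : ℕ} (h0 : ∀ t ∈ Icc 0 T, (q t).totalDegree ≤ n) :
    ∀ t ∈ Icc 0 T, (qt t).totalDegree ≤ n := fun t ht =>
  totalDegree_le_of_coeff_eq_zero fun _ hα => h.coeff_eq_zero hT h'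
    (fun s hs => coeff_eq_zero_of_totalDegree_le (h0 s hs) hα) t ht

theorem IsPrimitive.eq_zero (hT : 0 < T) (h : IsPrimitive T q qt) {qtt : ℝ → Poly d}
    (h' : IsPrimitive T qt qtt) (h0 : ∀ t ∈ Icc 0 T, q t = 0) :
    ∀ t ∈ Icc 0 T, qt t = 0 := fun t ht =>
  MvPolynomial.ext _ _ fun α => by
    rw [MvPolynomial.coeff_zero]
    exact h.coeff_eq_zero hT h' (fun s hs => by rw [h0 s hs, MvPolynomial.coeff_zero]) t ht

theorem sum_monomial_eq {p : Poly d} (A : Finset (Fin d →₀ ℕ)) (hA : ∀ α ∉ A, p.coeff α = 0) :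
    p = ∑ α : A, p.coeff α.1 • MvPolynomial.monomial α.1 (1 : ℝ) := by
  conv_lhs => rw [p.as_sum]
  rw [Finset.sum_coe_sort A fun α => p.coeff α • MvPolynomial.monomial α (1 : ℝ)]
  have hsub : p.support ⊆ A := fun α hα => by
    by_contra h
    exact MvPolynomial.mem_support_iff.1 hα (hA α h)
  rw [← Finset.sum_subset hsub fun α _ hα => by
    rw [MvPolynomial.notMem_support_iff.1 hα, zero_smul]]
  exact Finset.sum_congr rfl fun α _ => by simp [MvPolynomial.smul_monomial]

theorem IsPrimitive.isPath (hT : 0 ≤ T) (h : IsPrimitive T q qt) {n : ℕ}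
    (h0 : ∀ t ∈ Icc 0 T, (q t).totalDegree ≤ n) : IsPath T q qt := by
  -- A finite box of exponents that contains every exponent of total degree at most `n`; the
  -- superfluous ones do no harm.
  let A : Finset (Fin d →₀ ℕ) := Finset.Iic (Finsupp.equivFunOnFinite.symm fun _ => n)
  have hA : ∀ α ∉ A, n < α.degree := fun α hα => by
    by_contra hle
    apply hα
    rw [Finset.mem_Iic]
    intro i
    exact (Finsupp.le_degree i α).trans (not_lt.1 hle)
  refine ⟨A, inferInstance, fun α => MvPolynomial.monomial α.1 (1 : ℝ),
    fun α t => (q t).coeff α.1, fun α t => (qt t).coeff α.1, fun α => h α.1, fun t ht => ?_, ?_⟩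
  · exact sum_monomial_eq A fun α hα => coeff_eq_zero_of_totalDegree_le (h0 t ht) (hA α hα)
  · have : ∀ᵐ t ∂(volume.restrict (Ioc 0 T)), ∀ α ∉ A, (qt t).coeff α = 0 := by
      refine ae_all_iff.2 fun α => ?_
      by_cases hα : α ∈ A
      · exact Filter.Eventually.of_forall fun t h => absurd hα h
      · filter_upwards [h.coeff_ae_eq_zero hT fun t ht =>
          coeff_eq_zero_of_totalDegree_le (h0 t ht) (hA α hα)] with t ht _
        exact ht
    filter_upwards [this] with t ht
    exact sum_monomial_eq A ht

end PolyPaths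

/-! ## Bilinearity and symmetry of the forms -/

section Bilinear

variable {d : ℕ}

theorem isLinearMap_comp {U V W : Type*} [AddCommGroup U] [Module ℝ U] [AddCommGroup V]
    [Module ℝ V] [AddCommGroup W] [Module ℝ W] {f : V → W} {g : U → V} (hf : IsLinearMap ℝ f)
    (hg : IsLinearMap ℝ g) : IsLinearMap ℝ fun a => f (g a) :=
  ⟨fun x y => by rw [hg.map_add, hf.map_add], fun r x => by rw [hg.map_smul, hf.map_smul]⟩

/-- The discrete unknowns `(u, w, φ)`. -/
abbrev State (M : CoupledMesh d) := M.VField × M.VField × M.SField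

namespace CoupledMesh

variable (M : CoupledMesh d)

theorem isLinearMap_fst : IsLinearMap ℝ fun U : State M => U.1 := (LinearMap.fst ℝ _ _).isLinear

theorem isLinearMap_mid : IsLinearMap ℝ fun U : State M => U.2.1 :=
  ((LinearMap.fst ℝ _ _).comp (LinearMap.snd ℝ _ _)).isLinear

theorem isLinearMap_last : IsLinearMap ℝ fun U : State M => U.2.2 :=
  ((LinearMap.snd ℝ _ _).comp (LinearMap.snd ℝ _ _)).isLinear

theorem isLinearMap_val (κ : M.Elem) (x : Pt d) : IsLinearMap ℝ fun ψ : M.SField => val (ψ κ) x :=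
  ⟨fun _ _ => by simp, fun _ _ => by simp⟩

theorem isLinearMap_comp_val (κ : M.Elem) (i : Fin d) (x : Pt d) :
    IsLinearMap ℝ fun v : M.VField => val (v κ i) x :=
  ⟨fun _ _ => by simp, fun _ _ => by simp⟩

theorem isLinearMap_dvg : IsLinearMap ℝ fun v : M.VField => M.dvg v :=
  ⟨fun u v => by ext1 κ; simp [dvg, Finset.sum_add_distrib],
    fun r v => by ext1 κ; simp [dvg, Finset.smul_sum]⟩

theorem isLinearMap_strain (i j : Fin d) : IsLinearMap ℝ fun v : M.VField => M.strain v i j :=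
  ⟨fun u v => by ext1 κ; simp only [strain, Pi.add_apply, map_add]; ring,
    fun r v => by
      ext1 κ
      simp only [strain, Pi.smul_apply, (MvPolynomial.pderiv j).map_smul,
        (MvPolynomial.pderiv i).map_smul, ← smul_add, mul_smul_comm]⟩

theorem isLinearMap_grad : IsLinearMap ℝ fun ψ : M.SField => M.grad ψ :=
  ⟨fun u v => by ext1 κ; ext1 i; simp [grad], fun r v => by ext1 κ; ext1 i; simp [grad]⟩

theorem isLinearMap_jump (F : M.Face) (i : Fin d) (x : Pt d) :
    IsLinearMap ℝ fun ψ : M.SField => M.jump ψ F i x := by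
  unfold jump
  rcases M.minus F with _ | κ
  · exact ⟨fun _ _ => by simp; ring, fun _ _ => by simp; ring⟩
  · exact ⟨fun _ _ => by simp; ring, fun _ _ => by simp; ring⟩

theorem isLinearMap_component (i : Fin d) :
    IsLinearMap ℝ fun (v : M.VField) (κ : M.Elem) => v κ i := ⟨fun _ _ => rfl, fun _ _ => rfl⟩

theorem isLinearMap_jumpT (F : M.Face) (i j : Fin d) (x : Pt d) :
    IsLinearMap ℝ fun v : M.VField => M.jumpT v F i j x :=
  isLinearMap_comp (M.isLinearMap_jump F j x) (M.isLinearMap_component i)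

theorem isLinearMap_jumpN (F : M.Face) (x : Pt d) :
    IsLinearMap ℝ fun v : M.VField => M.jumpN v F x :=
  have h := fun i => isLinearMap_comp (M.isLinearMap_jump F i x) (M.isLinearMap_component i)
  ⟨fun u v => by simp only [jumpN, (h _).map_add, Finset.sum_add_distrib],
    fun r v => by simp only [jumpN, (h _).map_smul, Finset.smul_sum]⟩

theorem isLinearMap_avg (F : M.Face) (x : Pt d) : IsLinearMap ℝ fun ψ : M.SField => M.avg ψ F x := by
  unfold avg
  rcases M.minus F with _ | κ
  · exact ⟨fun _ _ => by simp, fun _ _ => by simp⟩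
  · exact ⟨fun _ _ => by simp; ring, fun _ _ => by simp; ring⟩

theorem isLinearMap_flux (F : M.Face) (x : Pt d) :
    IsLinearMap ℝ fun v : M.VField => M.flux v F x :=
  ⟨fun u v => by simp [flux, add_mul, Finset.sum_add_distrib],
    fun r v => by simp [flux, mul_assoc, Finset.mul_sum]⟩

end CoupledMesh

namespace Coeffs

variable {M : CoupledMesh d} (c : Coeffs M)

theorem isLinearMap_stress (i j : Fin d) : IsLinearMap ℝ fun v : M.VField => c.stress v i j :=
  ⟨fun u v => by
      ext1 κ
      simp only [stress, (M.isLinearMap_dvg).map_add, (M.isLinearMap_strain i j).map_add,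
        Pi.add_apply]
      ring,
    fun r v => by
      ext1 κ
      simp only [stress, (M.isLinearMap_dvg).map_smul, (M.isLinearMap_strain i j).map_smul,
        Pi.smul_apply, smul_add, mul_smul_comm, smul_mul_assoc]⟩

theorem isLinearMap_mDvg : IsLinearMap ℝ fun v : M.VField => c.mDvg v :=
  ⟨fun u v => by
      ext1 κ; simp only [mDvg, (M.isLinearMap_dvg).map_add, Pi.add_apply, mul_add],
    fun r v => by
      ext1 κ; simp only [mDvg, (M.isLinearMap_dvg).map_smul, Pi.smul_apply, mul_smul_comm]⟩

theorem isLinearMap_rhoGrad : IsLinearMap ℝ fun ψ : M.SField => c.rhoGrad ψ :=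
  ⟨fun u v => by
      ext1 κ; ext1 i
      simp only [rhoGrad, (M.isLinearMap_grad).map_add, Pi.add_apply, mul_add],
    fun r v => by
      ext1 κ; ext1 i
      simp only [rhoGrad, (M.isLinearMap_grad).map_smul, Pi.smul_apply, mul_smul_comm]⟩

theorem isLinearMap_tot : IsLinearMap ℝ fun U : State M => c.tot U.1 U.2.1 :=
  ⟨fun u v => by
      ext1 κ; ext1 i
      simp only [tot, Prod.fst_add, Prod.snd_add, Pi.add_apply]
      ring,
    fun r v => by
      ext1 κ; ext1 i
      simp only [tot, Prod.smul_fst, Prod.smul_snd, Pi.smul_apply, mul_smul_comm, smul_add]⟩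

@[fun_prop]
theorem continuous_sealedFlux (S : SealedTerm) (u w : M.VField) (F : M.Face) :
    Continuous (c.sealedFlux S u w F) := by
  cases S
  exacts [M.continuous_flux _ _, M.continuous_flux _ _]

theorem isLinearMap_sealedFlux (S : SealedTerm) (F : M.Face) (x : Pt d) :
    IsLinearMap ℝ fun U : State M => c.sealedFlux S U.1 U.2.1 F x := by
  have h1 := isLinearMap_comp (M.isLinearMap_flux F x) M.isLinearMap_mid
  have h2 := isLinearMap_comp (M.isLinearMap_flux F x) c.isLinearMap_tot
  cases S
  exacts [h1, h2]

end Coeffs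

section

variable {M : CoupledMesh d} {V W : Type*} [AddCommGroup V] [Module ℝ V] [AddCommGroup W]
  [Module ℝ W]

theorem IsBilin.cellInt {κ : M.Elem} {q : V → W → Pt d → ℝ}
    (hq : ∀ x, IsBilin fun a b => q a b x) (hc : ∀ a b, Continuous (q a b)) :
    IsBilin fun a b => M.cellInt κ (q a b) :=
  IsBilin.integral hq fun a b => M.integrableOn_cell κ (hc a b)

theorem IsBilin.faceInt {F : M.Face} {q : V → W → Pt d → ℝ}
    (hq : ∀ x, IsBilin fun a b => q a b x) (hc : ∀ a b, Continuous (q a b)) :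
    IsBilin fun a b => M.faceInt F (q a b) :=
  IsBilin.integral hq fun a b => integrableOn_face _ (hc a b)

end

namespace Coeffs

variable {M : CoupledMesh d} (c : Coeffs M)

open CoupledMesh

theorem isBilin_massForm : IsBilin fun U V : State M =>
    c.massForm U.1 U.2.1 U.2.2 V.1 V.2.1 V.2.2 := by
  have hu := fun κ i x => isLinearMap_comp (M.isLinearMap_comp_val κ i x) M.isLinearMap_fst
  have hw := fun κ i x => isLinearMap_comp (M.isLinearMap_comp_val κ i x) M.isLinearMap_mid
  have hφ := fun κ x => isLinearMap_comp (M.isLinearMap_val κ x) M.isLinearMap_last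
  unfold massForm
  refine (IsBilin.sum _ fun κ => IsBilin.cellInt (fun x => IsBilin.sum _ fun i => ?_)
    fun U V => by fun_prop).add
    (IsBilin.sum _ fun κ => IsBilin.cellInt (fun x => ?_) fun U V => by fun_prop)
  · have h1 := ((IsBilin.mul (hu κ i x) (hu κ i x)).const_mul (c.rho κ)).add
      ((IsBilin.mul (hw κ i x) (hu κ i x)).const_mul (c.rhoF κ))
    have h2 := ((IsBilin.mul (hu κ i x) (hw κ i x)).const_mul (c.rhoF κ)).add
      ((IsBilin.mul (hw κ i x) (hw κ i x)).const_mul (c.rhoW κ))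
    simpa only [add_mul, mul_assoc] using h1.add h2
  · simpa only [mul_assoc] using
      ((IsBilin.mul (hφ κ x) (hφ κ x)).const_mul (c.vel κ ^ 2)⁻¹).const_mul (c.rhoA κ)

theorem isBilin_elasticForm (P : Penalties) : IsBilin fun U V : State M =>
    c.elasticForm P U.1 V.1 := by
  have hst := fun i j => isLinearMap_comp (c.isLinearMap_stress i j) M.isLinearMap_fst
  have hsn := fun i j => isLinearMap_comp (M.isLinearMap_strain i j) M.isLinearMap_fst
  have hj := fun F i j x => isLinearMap_comp (M.isLinearMap_jumpT F i j x) M.isLinearMap_fst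
  have ha := fun F i j x => isLinearMap_comp (M.isLinearMap_avg F x) (hst i j)
  have hv := fun i j κ x => isLinearMap_comp (M.isLinearMap_val κ x) (hst i j)
  have hw := fun i j κ x => isLinearMap_comp (M.isLinearMap_val κ x) (hsn i j)
  unfold elasticForm
  refine (((IsBilin.sum _ fun κ => IsBilin.cellInt (fun x => IsBilin.sum _ fun i =>
      IsBilin.sum _ fun j => ?_) fun U V => by fun_prop).sub
    (IsBilin.sum _ fun F => IsBilin.faceInt (fun x => IsBilin.sum _ fun i =>
      IsBilin.sum _ fun j => ?_) fun U V => by fun_prop)).sub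
    (IsBilin.sum _ fun F => IsBilin.faceInt (fun x => IsBilin.sum _ fun i =>
      IsBilin.sum _ fun j => ?_) fun U V => by fun_prop)).add
    (IsBilin.sum _ fun F => IsBilin.faceInt (fun x => IsBilin.const_mul (IsBilin.sum _ fun i =>
      IsBilin.sum _ fun j => ?_) _) fun U V => by fun_prop)
  · exact IsBilin.mul (hv i j κ x) (hw i j κ x)
  · exact IsBilin.mul (ha F i j x) (hj F i j x)
  · exact IsBilin.mul (hj F i j x) (ha F i j x)
  · exact IsBilin.mul (hj F i j x) (hj F i j x)

theorem isBilin_poreForm (P : Penalties) (S : SealedTerm) (τ : M.Face → ℝ) :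
    IsBilin fun U V : State M => c.poreForm P S τ U.1 U.2.1 V.1 V.2.1 := by
  have hd := fun κ x => isLinearMap_comp (M.isLinearMap_val κ x)
    (isLinearMap_comp M.isLinearMap_dvg c.isLinearMap_tot)
  have hm := isLinearMap_comp c.isLinearMap_mDvg c.isLinearMap_tot
  have ha := fun F x => isLinearMap_comp (M.isLinearMap_avg F x) hm
  have hv := fun κ x => isLinearMap_comp (M.isLinearMap_val κ x) hm
  have hj := fun F x => isLinearMap_comp (M.isLinearMap_jumpN F x) c.isLinearMap_tot
  have hs := c.isLinearMap_sealedFlux S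
  unfold poreForm
  refine (((IsBilin.sum _ fun κ => IsBilin.cellInt (fun x => ?_) fun U V => by fun_prop).sub
    ((IsBilin.sum _ fun F => IsBilin.faceInt (fun x => ?_) fun U V => by fun_prop).add
      (IsBilin.sum _ fun F => IsBilin.faceInt (fun x => ?_) fun U V => by fun_prop))).sub
    ((IsBilin.sum _ fun F => IsBilin.faceInt (fun x => ?_) fun U V => by fun_prop).add
      (IsBilin.sum _ fun F => IsBilin.faceInt (fun x => ?_) fun U V => by fun_prop))).add
    ((IsBilin.sum _ fun F => IsBilin.faceInt (fun x => ?_) fun U V => by fun_prop).add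
      (IsBilin.sum _ fun F => IsBilin.faceInt (fun x => ?_) fun U V => by fun_prop))
  · simpa only [mul_assoc] using (IsBilin.mul (hd κ x) (hd κ x)).const_mul (c.biot κ)
  · exact IsBilin.mul (ha F x) (hj F x)
  · exact IsBilin.mul (hv (M.plus F) x) (hs F x)
  · exact IsBilin.mul (hj F x) (ha F x)
  · exact IsBilin.mul (hs F x) (hv (M.plus F) x)
  · simpa only [mul_assoc] using (IsBilin.mul (hj F x) (hj F x)).const_mul (c.gammaPen P F)
  · simpa only [mul_assoc] using (IsBilin.mul (hs F x) (hs F x)).const_mul (c.gammaSealed P F)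

theorem isBilin_acousticForm (P : Penalties) : IsBilin fun U V : State M =>
    c.acousticForm P U.2.2 V.2.2 := by
  have hg := isLinearMap_comp M.isLinearMap_grad M.isLinearMap_last
  have hr := isLinearMap_comp c.isLinearMap_rhoGrad M.isLinearMap_last
  have hj := fun F i x => isLinearMap_comp (M.isLinearMap_jump F i x) M.isLinearMap_last
  have ha := fun F i x => isLinearMap_comp (M.isLinearMap_avg F x)
    (isLinearMap_comp (M.isLinearMap_component i) hr)
  have hv := fun κ i x => isLinearMap_comp (M.isLinearMap_comp_val κ i x) hr
  have hw := fun κ i x => isLinearMap_comp (M.isLinearMap_comp_val κ i x) hg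
  unfold acousticForm
  refine (((IsBilin.sum _ fun κ => IsBilin.cellInt (fun x => IsBilin.sum _ fun i => ?_)
      fun U V => by fun_prop).sub
    (IsBilin.sum _ fun F => IsBilin.faceInt (fun x => IsBilin.sum _ fun i => ?_)
      fun U V => by fun_prop)).sub
    (IsBilin.sum _ fun F => IsBilin.faceInt (fun x => IsBilin.sum _ fun i => ?_)
      fun U V => by fun_prop)).add
    (IsBilin.sum _ fun F => IsBilin.faceInt (fun x => IsBilin.const_mul
      (IsBilin.sum _ fun i => ?_) _) fun U V => by fun_prop)
  · exact IsBilin.mul (hv κ i x) (hw κ i x)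
  · exact IsBilin.mul (ha F i x) (hj F i x)
  · exact IsBilin.mul (hj F i x) (ha F i x)
  · exact IsBilin.mul (hj F i x) (hj F i x)

theorem isBilin_stiffForm (P : Penalties) (S : SealedTerm) (τ : M.Face → ℝ) :
    IsBilin fun U V : State M => c.stiffForm P S τ U.1 U.2.1 U.2.2 V.1 V.2.1 V.2.2 :=
  ((c.isBilin_elasticForm P).add (c.isBilin_poreForm P S τ)).add (c.isBilin_acousticForm P)

/-- The volume part of the damping form. -/
def dampCell (w z : M.VField) : ℝ :=
  ∑ κ ∈ M.poroElems, M.cellInt κ (fun x =>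
      c.visc κ / c.perm κ * ∑ i, val (w κ i) x * val (z κ i) x)

/-- The interface part of the damping form. -/
def dampFace (τ : M.Face → ℝ) (w z : M.VField) : ℝ :=
  ∑ F ∈ M.openFaces τ, M.faceInt F (fun x =>
      (τ F)⁻¹ * (1 - τ F) * M.flux w F x * M.flux z F x)

theorem isBilin_dampCell : IsBilin fun U V : State M => c.dampCell U.2.1 V.2.1 := by
  have hw := fun κ i x => isLinearMap_comp (M.isLinearMap_comp_val κ i x) M.isLinearMap_mid
  unfold dampCell
  refine IsBilin.sum _ fun κ => IsBilin.cellInt (fun x => IsBilin.const_mul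
    (IsBilin.sum _ fun i => ?_) _) fun U V => by fun_prop
  exact IsBilin.mul (hw κ i x) (hw κ i x)

theorem isBilin_dampFace (τ : M.Face → ℝ) :
    IsBilin fun U V : State M => dampFace τ U.2.1 V.2.1 := by
  have hw := fun F x => isLinearMap_comp (M.isLinearMap_flux F x) M.isLinearMap_mid
  unfold dampFace
  refine IsBilin.sum _ fun F => IsBilin.faceInt (fun x => ?_) fun U V => by fun_prop
  simpa only [mul_assoc] using
    ((IsBilin.mul (hw F x) (hw F x)).const_mul (1 - τ F)).const_mul (τ F)⁻¹

theorem massForm_comm (U V : State M) : c.massForm U.1 U.2.1 U.2.2 V.1 V.2.1 V.2.2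
    = c.massForm V.1 V.2.1 V.2.2 U.1 U.2.1 U.2.2 := by
  unfold massForm
  congr 1
  · refine Finset.sum_congr rfl fun κ _ => congrArg _ (funext fun x =>
      Finset.sum_congr rfl fun i _ => ?_)
    ring
  · refine Finset.sum_congr rfl fun κ _ => congrArg _ (funext fun x => ?_)
    ring

/-- Both sides equal `λ tr(e) tr(f) + 2μ e : f`. -/
theorem sum_stress_mul_comm (lam mu : ℝ) (e f : Fin d → Fin d → ℝ) :
    ∑ i, ∑ j, (lam * (∑ k, e k k) * (if i = j then 1 else 0) + 2 * mu * e i j) * f i j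
      = ∑ i, ∑ j, (lam * (∑ k, f k k) * (if i = j then 1 else 0) + 2 * mu * f i j) * e i j := by
  have h : ∀ e f : Fin d → Fin d → ℝ,
      ∑ i, ∑ j, (lam * (∑ k, e k k) * (if i = j then 1 else 0) + 2 * mu * e i j) * f i j
        = lam * (∑ k, e k k) * (∑ k, f k k) + 2 * mu * ∑ i, ∑ j, e i j * f i j := fun e f => by
    have : ∀ i j, (lam * (∑ k, e k k) * (if i = j then 1 else 0) + 2 * mu * e i j) * f i j
        = (if i = j then lam * (∑ k, e k k) * f i j else 0) + 2 * mu * (e i j * f i j) :=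
      fun i j => by split_ifs <;> ring
    simp only [this, Finset.sum_add_distrib, Finset.sum_ite_eq, Finset.mem_univ, if_true,
      ← Finset.mul_sum]
  rw [h, h]
  simp only [mul_comm (f _ _) (e _ _)]
  ring

theorem elasticForm_comm (P : Penalties) (u v : M.VField) :
    c.elasticForm P u v = c.elasticForm P v u := by
  unfold elasticForm
  have h1 : ∀ κ x, ∑ i, ∑ j, val (c.stress u i j κ) x * val (M.strain v i j κ) x
      = ∑ i, ∑ j, val (c.stress v i j κ) x * val (M.strain u i j κ) x := fun κ x => by
    simp only [val_stress]
    exact sum_stress_mul_comm (c.lam κ) (c.mu κ) (fun i j => val (M.strain u i j κ) x)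
      fun i j => val (M.strain v i j κ) x
  simp only [h1, mul_comm (M.jumpT u _ _ _ _), mul_comm (M.jumpT v _ _ _ _) (M.avg _ _ _)]
  ring

theorem poreForm_comm (P : Penalties) (S : SealedTerm) (τ : M.Face → ℝ) (u w v z : M.VField) :
    c.poreForm P S τ u w v z = c.poreForm P S τ v z u w := by
  unfold poreForm
  simp only [mul_assoc, mul_comm (val (M.dvg (c.tot u w) _) _), mul_comm (M.jumpN (c.tot u w) _ _),
    mul_comm (c.sealedFlux S u w _ _), mul_comm (M.jumpN (c.tot v z) _ _) (M.avg _ _ _),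
    mul_comm (c.sealedFlux S v z _ _) (val _ _)]
  ring

theorem acousticForm_comm (P : Penalties) (φ ψ : M.SField) :
    c.acousticForm P φ ψ = c.acousticForm P ψ φ := by
  unfold acousticForm
  have h1 : ∀ κ x, ∑ i, val (c.rhoGrad φ κ i) x * val (M.grad ψ κ i) x
      = ∑ i, val (c.rhoGrad ψ κ i) x * val (M.grad φ κ i) x := fun κ x =>
    Finset.sum_congr rfl fun i _ => by simp only [rhoGrad, val_mul, val_C]; ring
  simp only [h1, mul_comm (M.jump φ _ _ _), mul_comm (M.jump ψ _ _ _) (M.avg _ _ _)]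
  ring

theorem stiffForm_comm (P : Penalties) (S : SealedTerm) (τ : M.Face → ℝ) (U V : State M) :
    c.stiffForm P S τ U.1 U.2.1 U.2.2 V.1 V.2.1 V.2.2
      = c.stiffForm P S τ V.1 V.2.1 V.2.2 U.1 U.2.1 U.2.2 := by
  rw [stiffForm, stiffForm, elasticForm_comm, poreForm_comm, acousticForm_comm]

end Coeffs

end Bilinear

/-! ## Integral form of Gronwall's inequality -/

/-- The function `exp (-s) (A + ∫₀ˢ y)` is nonincreasing, its derivative being `exp (-s)` times `y -
(A + ∫ y) ≤ 0`. No sign of `y` or `A` is required. -/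
theorem le_mul_exp_of_le_add_integral {y : ℝ → ℝ} {t A : ℝ} (ht : 0 ≤ t)
    (hy : ContinuousOn y (Icc 0 t))
    (h : ∀ s ∈ Icc 0 t, y s ≤ A + ∫ r in (0 : ℝ)..s, y r) : y t ≤ A * Real.exp t := by
  -- A continuous extension of `y` to the whole line, so that the integral is differentiable at the
  -- end points too.
  set z : ℝ → ℝ := IccExtend ht ((Icc 0 t).domRestrict y) with hz
  have hzc : Continuous z := (continuousOn_iff_continuous_domRestrict.1 hy).Icc_extend'
  have hzy : ∀ s ∈ Icc 0 t, z s = y s := fun s hs => by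
    rw [hz, IccExtend_of_mem ht _ hs, domRestrict_apply]
  have hint : ∀ s ∈ Icc 0 t, ∫ r in (0 : ℝ)..s, y r = ∫ r in (0 : ℝ)..s, z r := fun s hs =>
    intervalIntegral.integral_congr fun r hr => by
      rw [uIcc_of_le hs.1] at hr
      exact (hzy r ⟨hr.1, hr.2.trans hs.2⟩).symm
  set Z : ℝ → ℝ := fun s => Real.exp (-s) * (A + ∫ r in (0 : ℝ)..s, z r) with hZ
  have hd : ∀ s, HasDerivAt Z (Real.exp (-s) * (-1) * (A + ∫ r in (0 : ℝ)..s, z r)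
      + Real.exp (-s) * z s) s := fun s =>
    ((hasDerivAt_id s).neg.exp).mul
      ((intervalIntegral.integral_hasDerivAt_right (hzc.intervalIntegrable _ _)
        (hzc.stronglyMeasurableAtFilter _ _) hzc.continuousAt).const_add A)
  have hanti : AntitoneOn Z (Icc 0 t) := by
    refine antitoneOn_of_deriv_nonpos (convex_Icc 0 t)
      (fun s _ => (hd s).continuousAt.continuousWithinAt)
      (fun s _ => (hd s).differentiableAt.differentiableWithinAt) fun s hs => ?_
    rw [interior_Icc] at hs
    have hs' := Ioo_subset_Icc_self hs
    have := h s hs'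
    rw [hint s hs', ← hzy s hs'] at this
    rw [(hd s).deriv]
    nlinarith [Real.exp_pos (-s)]
  have h1 := hanti ⟨le_rfl, ht⟩ ⟨ht, le_rfl⟩ ht
  have h2 := h t ⟨ht, le_rfl⟩
  rw [hint t ⟨ht, le_rfl⟩] at h2
  have h3 : Real.exp (-t) * (A + ∫ r in (0 : ℝ)..t, z r) ≤ A := by simpa [hZ] using h1
  rw [Real.exp_neg] at h3
  rw [inv_mul_le_iff₀ (Real.exp_pos t)] at h3
  linarith

/-! ## Bounds for the source terms -/

/-- If `f` is not integrable its integral is 0 by convention, and the bound still holds. Thus only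
`‖f‖²` has to be integrable at a fixed time, and measurability of the product of a source with a
velocity is never discussed. -/
theorem integral_le_of_le_of_nonneg {α : Type*} [MeasurableSpace α] {μ : Measure α} {f g : α → ℝ}
    (h : ∀ x, f x ≤ g x) (hg : Integrable g μ) (h0 : ∀ x, 0 ≤ g x) :
    ∫ x, f x ∂μ ≤ ∫ x, g x ∂μ := by
  by_cases hf : Integrable f μ
  · exact integral_mono hf hg h
  · rw [integral_undef hf]
    exact integral_nonneg h0

namespace CoupledMesh

variable {d : ℕ} {M : CoupledMesh d}

/-- Common frame for vector and scalar sources: a pointwise Young bound is integrated, and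
disjointness of the elements merges the data terms into one integral over the domain. -/
theorem sum_cellInt_le_of_le {Es : Finset M.Elem} {r : ℝ} {p : M.Elem → Pt d → ℝ} {G : Pt d → ℝ}
    {q : M.Elem → Pt d → ℝ} (hr : 0 < r)
    (hG : IntegrableOn G (⋃ κ ∈ Es, M.cell κ)) (hG0 : ∀ x, 0 ≤ G x)
    (hq : ∀ κ, Continuous (q κ)) (hq0 : ∀ κ x, 0 ≤ q κ x)
    (h : ∀ κ x, p κ x ≤ (2 * r)⁻¹ * G x + r / 2 * q κ x) :
    ∑ κ ∈ Es, M.cellInt κ (p κ) ≤ (2 * r)⁻¹ * (∫ x in ⋃ κ ∈ Es, M.cell κ, G x)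
      + r / 2 * ∑ κ ∈ Es, M.cellInt κ (q κ) := by
  have hGκ : ∀ κ ∈ Es, IntegrableOn G (M.cell κ) := fun κ hκ =>
    hG.mono_set (subset_biUnion_of_mem (u := fun κ => M.cell κ) hκ)
  rw [integral_biUnion_finset Es (fun κ _ => (M.isOpen_cell κ).measurableSet)
    (fun κ _ κ' _ hne => M.disjoint_cell hne) hGκ, Finset.mul_sum, Finset.mul_sum,
    ← Finset.sum_add_distrib]
  refine Finset.sum_le_sum fun κ hκ => ?_
  have hi1 : IntegrableOn (fun x => (2 * r)⁻¹ * G x) (M.cell κ) := (hGκ κ hκ).const_mul _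
  have hi2 : IntegrableOn (fun x => r / 2 * q κ x) (M.cell κ) :=
    (M.integrableOn_cell κ (hq κ)).const_mul _
  refine (integral_le_of_le_of_nonneg (h κ) (hi1.add hi2) fun x => ?_).trans_eq ?_
  · have := hG0 x
    have := hq0 κ x
    positivity
  · rw [show (fun x => (2 * r)⁻¹ * G x + r / 2 * q κ x)
      = (fun x => (2 * r)⁻¹ * G x) + fun x => r / 2 * q κ x from rfl]
    rw [integral_add' hi1 hi2, integral_const_mul, integral_const_mul]
    rfl

theorem sum_cellInt_inner_le (Es : Finset M.Elem) {r : ℝ} (hr : 0 < r) {f : Pt d → Pt d}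
    (hf : IntegrableOn (fun x => ‖f x‖ ^ 2) (⋃ κ ∈ Es, M.cell κ)) (v : M.VField) :
    ∑ κ ∈ Es, M.cellInt κ (fun x => ∑ i, f x i * val (v κ i) x)
      ≤ (2 * r)⁻¹ * (∫ x in ⋃ κ ∈ Es, M.cell κ, ‖f x‖ ^ 2)
        + r / 2 * ∑ κ ∈ Es, M.cellInt κ (fun x => ∑ i, val (v κ i) x ^ 2) := by
  refine sum_cellInt_le_of_le hr hf (fun x => by positivity) (fun κ => by fun_prop)
    (fun κ x => by positivity) fun κ x => ?_
  rw [EuclideanSpace.real_norm_sq_eq, Finset.mul_sum, Finset.mul_sum, ← Finset.sum_add_distrib]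
  refine Finset.sum_le_sum fun i _ => ?_
  have h := mul_nonneg (inv_nonneg.2 (mul_pos two_pos hr).le) (sq_nonneg (f x i - r * val (v κ i) x))
  have e : (2 * r)⁻¹ * (f x i - r * val (v κ i) x) ^ 2
      = (2 * r)⁻¹ * f x i ^ 2 + r / 2 * val (v κ i) x ^ 2 - f x i * val (v κ i) x := by
    field_simp
    ring
  linarith

theorem sum_cellInt_mul_le (Es : Finset M.Elem) {r : ℝ} (hr : 0 < r) {f : Pt d → ℝ}
    (hf : IntegrableOn (fun x => ‖f x‖ ^ 2) (⋃ κ ∈ Es, M.cell κ)) (ψ : M.SField) :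
    ∑ κ ∈ Es, M.cellInt κ (fun x => f x * val (ψ κ) x)
      ≤ (2 * r)⁻¹ * (∫ x in ⋃ κ ∈ Es, M.cell κ, ‖f x‖ ^ 2)
        + r / 2 * ∑ κ ∈ Es, M.cellInt κ (fun x => val (ψ κ) x ^ 2) := by
  refine sum_cellInt_le_of_le hr hf (fun x => by positivity) (fun κ => by fun_prop)
    (fun κ x => by positivity) fun κ x => ?_
  rw [Real.norm_eq_abs, sq_abs]
  have h := mul_nonneg (inv_nonneg.2 (mul_pos two_pos hr).le) (sq_nonneg (f x - r * val (ψ κ) x))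
  have e : (2 * r)⁻¹ * (f x - r * val (ψ κ) x) ^ 2
      = (2 * r)⁻¹ * f x ^ 2 + r / 2 * val (ψ κ) x ^ 2 - f x * val (ψ κ) x := by
    field_simp
    ring
  linarith

end CoupledMesh

/-! ## Kinetic and potential energy -/

namespace Coeffs

variable {d : ℕ} {M : CoupledMesh d} (c : Coeffs M)

/-- The terms of the energy norm that contain the velocities `V = (∂ₜu, ∂ₜw, ∂ₜφ)`. -/
def kinetic (V : State M) : ℝ :=
  ∑ κ ∈ M.poroElems, M.cellInt κ (fun x => c.rhoU κ * ∑ i, val (V.1 κ i) x ^ 2)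
  + ∑ κ ∈ M.poroElems, M.cellInt κ (fun x => c.rhoF κ * c.phi κ *
      ∑ i, (val (V.1 κ i) x + (c.phi κ)⁻¹ * val (V.2.1 κ i) x) ^ 2)
  + ∑ κ ∈ M.acouElems, M.cellInt κ (fun x =>
      c.rhoA κ * (c.vel κ ^ 2)⁻¹ * val (V.2.2 κ) x ^ 2)

/-- The terms of the energy norm that contain the unknowns `U = (u, w, φ)`. -/
def potential (P : Penalties) (S : SealedTerm) (τ : M.Face → ℝ) (U : State M) : ℝ :=
  c.dgElastic P U.1
  + (c.dgPore P (c.tot U.1 U.2.1)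
    + ∑ F ∈ M.sealedFaces τ, M.faceInt F (fun x =>
      c.gammaSealed P F * c.sealedFlux S U.1 U.2.1 F x ^ 2))
  + c.dgAcoustic P U.2.2

variable {c} {lo hi : ℝ}

/-- Completing the square: with `ρ = φ ρ_f + 2 ρ_u`, the density `ρ|u|² + 2 ρ_f u·w + ρ_w|w|²`
equals `φ ρ_f |u + φ⁻¹ w|² + 2 ρ_u |u|² + (a-1) φ⁻¹ ρ_f |w|²`. The kinetic part of the norm takes
one of the two copies of `ρ_u |u|²`. -/
theorem IsAdmissible.massForm_sub_kinetic (hc : c.IsAdmissible lo hi) (V : State M) :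
    c.massForm V.1 V.2.1 V.2.2 V.1 V.2.1 V.2.2 = c.kinetic V
      + ∑ κ ∈ M.poroElems, M.cellInt κ (fun x => ∑ i, (c.rhoU κ * val (V.1 κ i) x ^ 2
        + (c.tort κ - 1) * (c.phi κ)⁻¹ * c.rhoF κ * val (V.2.1 κ i) x ^ 2)) := by
  have h : ∀ a b e f g : ℝ, a + b + e = f → f + g = a + b + g + e := fun a b e f g h => by
    rw [← h]; ring
  rw [massForm, kinetic]
  have e1 : ∀ κ x, c.rhoA κ * (c.vel κ ^ 2)⁻¹ * val (V.2.2 κ) x * val (V.2.2 κ) x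
      = c.rhoA κ * (c.vel κ ^ 2)⁻¹ * val (V.2.2 κ) x ^ 2 := fun κ x => by ring
  simp only [e1]
  refine h _ _ _ _ _ ?_
  rw [← Finset.sum_add_distrib, ← Finset.sum_add_distrib]
  refine Finset.sum_congr rfl fun κ hκ => ?_
  rw [← M.cellInt_add κ (by fun_prop) (by fun_prop), ← M.cellInt_add κ (by fun_prop) (by fun_prop)]
  refine congrArg _ (funext fun x => ?_)
  have hφ := (hc.phi_mem κ (CoupledMesh.mem_poroElems.1 hκ)).1.ne'
  rw [Finset.mul_sum, Finset.mul_sum, ← Finset.sum_add_distrib, ← Finset.sum_add_distrib]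
  refine Finset.sum_congr rfl fun i _ => ?_
  rw [rho, rhoU, rhoW]
  field_simp
  ring

theorem IsAdmissible.kinetic_le_massForm (hlo : 0 < lo) (hc : c.IsAdmissible lo hi) (V : State M) :
    c.kinetic V ≤ c.massForm V.1 V.2.1 V.2.2 V.1 V.2.1 V.2.2 := by
  rw [hc.massForm_sub_kinetic]
  refine le_add_of_nonneg_right (Finset.sum_nonneg fun κ hκ => M.cellInt_nonneg κ fun x =>
    Finset.sum_nonneg fun i _ => ?_)
  have hκ' := CoupledMesh.mem_poroElems.1 hκ
  have h1 := (hc.phi_mem κ hκ').1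
  have h2 := sub_pos.2 (hc.one_lt_tort κ hκ')
  have h3 := hlo.trans_le (hc.poro_bounds κ hκ').1
  have h4 := (hc.poro_pos κ hκ').1
  positivity

theorem IsAdmissible.kinetic_parts_nonneg (hlo : 0 < lo) (hc : c.IsAdmissible lo hi) (V : State M) :
    (0 ≤ ∑ κ ∈ M.poroElems, M.cellInt κ (fun x => c.rhoU κ * ∑ i, val (V.1 κ i) x ^ 2)) ∧
    (0 ≤ ∑ κ ∈ M.poroElems, M.cellInt κ (fun x => c.rhoF κ * c.phi κ *
      ∑ i, (val (V.1 κ i) x + (c.phi κ)⁻¹ * val (V.2.1 κ i) x) ^ 2)) ∧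
    0 ≤ ∑ κ ∈ M.acouElems, M.cellInt κ (fun x =>
      c.rhoA κ * (c.vel κ ^ 2)⁻¹ * val (V.2.2 κ) x ^ 2) := by
  refine ⟨Finset.sum_nonneg fun κ hκ => M.cellInt_nonneg κ fun x => ?_,
    Finset.sum_nonneg fun κ hκ => M.cellInt_nonneg κ fun x => ?_,
    Finset.sum_nonneg fun κ hκ => M.cellInt_nonneg κ fun x => ?_⟩
  · have := hlo.trans_le (hc.poro_bounds κ (CoupledMesh.mem_poroElems.1 hκ)).1
    positivity
  · have := (hc.poro_pos κ (CoupledMesh.mem_poroElems.1 hκ)).1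
    have := (hc.phi_mem κ (CoupledMesh.mem_poroElems.1 hκ)).1
    positivity
  · have := (hc.acou_pos κ (CoupledMesh.mem_acouElems.1 hκ)).1
    positivity

theorem IsAdmissible.kinetic_nonneg (hlo : 0 < lo) (hc : c.IsAdmissible lo hi) (V : State M) :
    0 ≤ c.kinetic V :=
  have h := hc.kinetic_parts_nonneg hlo V
  add_nonneg (add_nonneg h.1 h.2.1) h.2.2

/-- The factor `φ⁻¹` has no uniform bound, so the remainder is written with `s = φ⁻¹ w`, as `(a-1)
ρ_f φ s²`, and `s² ≤ 2 (u+s)² + 2 u²`. The first term is part of the norm; the second is absorbed by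
`ρ_u u²` through `φ < 1`, `ρ_f ≤ hi` and `ρ_u ≥ lo`. The constant uses `|hi|` because without
poro-elastic elements `hi` may be negative. -/
theorem IsAdmissible.massForm_le_kinetic (hlo : 0 < lo) (hc : c.IsAdmissible lo hi) (V : State M) :
    c.massForm V.1 V.2.1 V.2.2 V.1 V.2.1 V.2.2
      ≤ (2 + 2 * |hi| + 2 * hi ^ 2 / lo) * c.kinetic V := by
  obtain ⟨p1, p2, p3⟩ := hc.kinetic_parts_nonneg hlo V
  rw [hc.massForm_sub_kinetic]
  have key : ∑ κ ∈ M.poroElems, M.cellInt κ (fun x => ∑ i, (c.rhoU κ * val (V.1 κ i) x ^ 2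
        + (c.tort κ - 1) * (c.phi κ)⁻¹ * c.rhoF κ * val (V.2.1 κ i) x ^ 2))
      ≤ (1 + 2 * hi ^ 2 / lo) * ∑ κ ∈ M.poroElems, M.cellInt κ (fun x =>
          c.rhoU κ * ∑ i, val (V.1 κ i) x ^ 2)
        + 2 * |hi| * ∑ κ ∈ M.poroElems, M.cellInt κ (fun x => c.rhoF κ * c.phi κ *
          ∑ i, (val (V.1 κ i) x + (c.phi κ)⁻¹ * val (V.2.1 κ i) x) ^ 2) := by
    rw [Finset.mul_sum, Finset.mul_sum, ← Finset.sum_add_distrib]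
    refine Finset.sum_le_sum fun κ hκ => ?_
    rw [← M.cellInt_const_mul, ← M.cellInt_const_mul,
      ← M.cellInt_add κ (by fun_prop) (by fun_prop)]
    refine M.cellInt_mono κ (by fun_prop) (by fun_prop) fun x => ?_
    simp only [Finset.mul_sum]
    rw [← Finset.sum_add_distrib]
    refine Finset.sum_le_sum fun i _ => ?_
    have hκ' := CoupledMesh.mem_poroElems.1 hκ
    obtain ⟨hφ, hφ1⟩ := hc.phi_mem κ hκ'
    have ha := hc.one_lt_tort κ hκ'
    obtain ⟨hu, -, hf, ht⟩ := hc.poro_bounds κ hκ'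
    have hf0 := (hc.poro_pos κ hκ').1
    have hhi : 0 < hi := by linarith
    rw [abs_of_pos hhi]
    set a := val (V.1 κ i) x
    set b := val (V.2.1 κ i) x
    obtain ⟨s, hs⟩ : ∃ s, b = c.phi κ * s := ⟨(c.phi κ)⁻¹ * b, by field_simp⟩
    have e1 : (c.tort κ - 1) * (c.phi κ)⁻¹ * c.rhoF κ * b ^ 2
        = (c.tort κ - 1) * (c.rhoF κ * c.phi κ * s ^ 2) := by
      rw [hs]; field_simp
    have e2 : a + (c.phi κ)⁻¹ * b = a + s := by rw [hs]; field_simp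
    rw [e1, e2]
    have hfp : 0 < c.rhoF κ * c.phi κ := mul_pos hf0 hφ
    have hs2 : s ^ 2 ≤ 2 * (a + s) ^ 2 + 2 * a ^ 2 := by nlinarith [sq_nonneg (2 * a + s)]
    have b1 : (c.tort κ - 1) * (c.rhoF κ * c.phi κ * s ^ 2)
        ≤ hi * (c.rhoF κ * c.phi κ * (2 * (a + s) ^ 2 + 2 * a ^ 2)) := by
      gcongr
      linarith
    have b2 : c.rhoF κ * c.phi κ * a ^ 2 ≤ hi * a ^ 2 := by
      gcongr
      nlinarith
    have b3 : hi ^ 2 * a ^ 2 ≤ hi ^ 2 / lo * (c.rhoU κ * a ^ 2) := by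
      rw [div_mul_eq_mul_div, le_div_iff₀ hlo]
      have : hi ^ 2 * a ^ 2 * lo ≤ hi ^ 2 * a ^ 2 * c.rhoU κ := by gcongr
      linarith
    have b4 := mul_le_mul_of_nonneg_left b2 hhi.le
    have : 2 * hi ^ 2 / lo = 2 * (hi ^ 2 / lo) := by ring
    rw [this]
    nlinarith
  have q1 : 0 ≤ |hi| := abs_nonneg hi
  have q2 : 0 ≤ 2 * hi ^ 2 / lo := by positivity
  rw [kinetic]
  nlinarith [mul_nonneg q1 p1, mul_nonneg q1 p3, mul_nonneg q2 p2, mul_nonneg q2 p3]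

theorem abs_stiffForm_sub_le (hd : 1 ≤ d) {creg : ℝ} (hreg : M.IsPolytopicRegular creg)
    (hc : c.IsAdmissible lo hi) {P : Penalties} (h1 : 8 * traceConst d creg + 1 ≤ P.sigma0)
    (h2 : 8 * traceConst d creg + 1 ≤ P.m0) (h3 : 8 * traceConst d creg + 1 ≤ P.rho0)
    (S : SealedTerm) (τ : M.Face → ℝ) {U : State M} (hu : M.IsPoroDiscrete U.1)
    (hw : M.IsPoroDiscrete U.2.1) (hφ : M.IsAcouDiscrete U.2.2) :
    |c.stiffForm P S τ U.1 U.2.1 U.2.2 U.1 U.2.1 U.2.2 - c.potential P S τ U|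
      ≤ 1 / 2 * c.potential P S τ U := by
  have a1 := abs_le.1 (abs_elasticForm_sub_le hd hreg hc h1 hu)
  have a2 := abs_le.1 (abs_poreForm_sub_le hd hreg hc h2 S τ hu hw)
  have a3 := abs_le.1 (abs_acousticForm_sub_le hd hreg hc h3 hφ)
  rw [abs_le, stiffForm, potential]
  constructor <;> linarith [a1.1, a1.2, a2.1, a2.2, a3.1, a3.2]

theorem IsAdmissible.dampCell_nonneg (hlo : 0 < lo) (hc : c.IsAdmissible lo hi) (w : M.VField) :
    0 ≤ c.dampCell w w :=
  Finset.sum_nonneg fun κ hκ => M.cellInt_nonneg κ fun _ =>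
    mul_nonneg (hlo.le.trans (hc.poro_bounds κ (CoupledMesh.mem_poroElems.1 hκ)).2.1)
      (Finset.sum_nonneg fun _ _ => mul_self_nonneg _)

theorem dampFace_nonneg {τ : M.Face → ℝ} (hτ : ∀ F ∈ M.interfaceFaces, 0 ≤ τ F ∧ τ F ≤ 1)
    (w : M.VField) : 0 ≤ dampFace τ w w :=
  Finset.sum_nonneg fun F hF => M.faceInt_nonneg F fun _ => by
    have h := hτ F (Finset.mem_filter.1 hF).1
    rw [mul_assoc]
    exact mul_nonneg (mul_nonneg (inv_nonneg.2 h.1) (sub_nonneg.2 h.2)) (mul_self_nonneg _)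

/-- The source functional is controlled by the data, half of the kinetic energy and half of the
dissipation. -/
theorem IsAdmissible.source_le (hlo : 0 < lo) (hc : c.IsAdmissible lo hi) {f g : Pt d → Pt d}
    {h : Pt d → ℝ} (hf : IntegrableOn (fun x => ‖f x‖ ^ 2) M.poroDomain)
    (hg : IntegrableOn (fun x => ‖g x‖ ^ 2) M.poroDomain)
    (hh : IntegrableOn (fun x => ‖h x‖ ^ 2) M.acouDomain) (V : State M) :
    ∑ κ ∈ M.poroElems, M.cellInt κ (fun x => ∑ i, f x i * val (V.1 κ i) x)
        + ∑ κ ∈ M.poroElems, M.cellInt κ (fun x => ∑ i, g x i * val (V.2.1 κ i) x)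
        + ∑ κ ∈ M.acouElems, M.cellInt κ (fun x => h x * val (V.2.2 κ) x)
      ≤ (2 * lo)⁻¹ * ((∫ x in M.poroDomain, ‖f x‖ ^ 2) + (∫ x in M.poroDomain, ‖g x‖ ^ 2)
          + ∫ x in M.acouDomain, ‖h x‖ ^ 2)
        + 1 / 2 * c.kinetic V + 1 / 2 * c.dampCell V.2.1 V.2.1 := by
  have h1 := CoupledMesh.sum_cellInt_inner_le M.poroElems hlo hf V.1
  have h2 := CoupledMesh.sum_cellInt_inner_le M.poroElems hlo hg V.2.1
  have h3 := CoupledMesh.sum_cellInt_mul_le M.acouElems hlo hh V.2.2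
  have k1 : lo * ∑ κ ∈ M.poroElems, M.cellInt κ (fun x => ∑ i, val (V.1 κ i) x ^ 2)
      ≤ ∑ κ ∈ M.poroElems, M.cellInt κ (fun x => c.rhoU κ * ∑ i, val (V.1 κ i) x ^ 2) := by
    rw [Finset.mul_sum]
    refine Finset.sum_le_sum fun κ hκ => ?_
    rw [M.cellInt_const_mul]
    exact mul_le_mul_of_nonneg_right (hc.poro_bounds κ (CoupledMesh.mem_poroElems.1 hκ)).1
      (M.cellInt_nonneg κ fun x => by positivity)
  -- The filtration velocity tested by `g` is controlled through the viscous damping, as `η/k ≥ lo`;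
  -- the other two sources use kinetic energy.
  have k2 : lo * ∑ κ ∈ M.poroElems, M.cellInt κ (fun x => ∑ i, val (V.2.1 κ i) x ^ 2)
      ≤ c.dampCell V.2.1 V.2.1 := by
    rw [Finset.mul_sum, dampCell]
    refine Finset.sum_le_sum fun κ hκ => ?_
    simp only [← sq]
    rw [M.cellInt_const_mul]
    exact mul_le_mul_of_nonneg_right (hc.poro_bounds κ (CoupledMesh.mem_poroElems.1 hκ)).2.1
      (M.cellInt_nonneg κ fun x => by positivity)
  have k3 : lo * ∑ κ ∈ M.acouElems, M.cellInt κ (fun x => val (V.2.2 κ) x ^ 2)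
      ≤ ∑ κ ∈ M.acouElems, M.cellInt κ (fun x =>
        c.rhoA κ * (c.vel κ ^ 2)⁻¹ * val (V.2.2 κ) x ^ 2) := by
    rw [Finset.mul_sum]
    refine Finset.sum_le_sum fun κ hκ => ?_
    rw [M.cellInt_const_mul, ← div_eq_mul_inv]
    exact mul_le_mul_of_nonneg_right (hc.acou_bounds κ (CoupledMesh.mem_acouElems.1 hκ))
      (M.cellInt_nonneg κ fun x => by positivity)
  have p := (hc.kinetic_parts_nonneg hlo V).2.1
  rw [kinetic]
  rw [CoupledMesh.poroDomain, CoupledMesh.acouDomain]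
  linarith

end Coeffs

/-! ## The energy identity -/

section Energy

variable {d : ℕ} {M : CoupledMesh d} {c : Coeffs M} {P : Penalties} {S : SealedTerm}
  {τ : M.Face → ℝ} {T : ℝ} {f g : ℝ → Pt d → Pt d} {h : ℝ → Pt d → ℝ} {X : Traj M}

namespace Traj

/-- The unknowns at time `t`. -/
def state (X : Traj M) (t : ℝ) : State M := (X.u t, X.w t, X.φ t)

/-- Their first time derivatives. -/
def velocity (X : Traj M) (t : ℝ) : State M := (X.ut t, X.wt t, X.φt t)

/-- Their second time derivatives. -/
def acceleration (X : Traj M) (t : ℝ) : State M := (X.utt t, X.wtt t, X.φtt t)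

/-- The discrete energy. -/
def energy (X : Traj M) (c : Coeffs M) (P : Penalties) (S : SealedTerm) (τ : M.Face → ℝ) (t : ℝ) :
    ℝ :=
  1 / 2 * c.massForm (X.ut t) (X.wt t) (X.φt t) (X.ut t) (X.wt t) (X.φt t)
    + 1 / 2 * c.stiffForm P S τ (X.u t) (X.w t) (X.φ t) (X.u t) (X.w t) (X.φ t)

end Traj

theorem isPoroDiscrete_of_isPrimitive (hT : 0 < T) {v vt vtt : ℝ → M.VField}
    (hv : ∀ t ∈ Icc 0 T, M.IsPoroDiscrete (v t))
    (h1 : ∀ κ i, IsPrimitive T (fun t => v t κ i) (fun t => vt t κ i))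
    (h2 : ∀ κ i, IsPrimitive T (fun t => vt t κ i) (fun t => vtt t κ i)) :
    ∀ t ∈ Icc 0 T, M.IsPoroDiscrete (vt t) := fun t ht =>
  ⟨fun κ hκ i => (h1 κ i).totalDegree_le hT (h2 κ i) (fun s hs => (hv s hs).1 κ hκ i) t ht,
    fun κ hκ => funext fun i => (h1 κ i).eq_zero hT (h2 κ i)
      (fun s hs => by rw [(hv s hs).2 κ hκ]; rfl) t ht⟩

theorem isAcouDiscrete_of_isPrimitive (hT : 0 < T) {ψ ψt ψtt : ℝ → M.SField}
    (hψ : ∀ t ∈ Icc 0 T, M.IsAcouDiscrete (ψ t))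
    (h1 : ∀ κ, IsPrimitive T (fun t => ψ t κ) (fun t => ψt t κ))
    (h2 : ∀ κ, IsPrimitive T (fun t => ψt t κ) (fun t => ψtt t κ)) :
    ∀ t ∈ Icc 0 T, M.IsAcouDiscrete (ψt t) := fun t ht =>
  ⟨fun κ hκ => (h1 κ).totalDegree_le hT (h2 κ) (fun s hs => (hψ s hs).1 κ hκ) t ht,
    fun κ hκ => (h1 κ).eq_zero hT (h2 κ) (fun s hs => (hψ s hs).2 κ hκ) t ht⟩

theorem isPath_of_isPoroDiscrete (hT : 0 ≤ T) {v vt : ℝ → M.VField}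
    (hv : ∀ t ∈ Icc 0 T, M.IsPoroDiscrete (v t))
    (h1 : ∀ κ i, IsPrimitive T (fun t => v t κ i) (fun t => vt t κ i)) : IsPath T v vt :=
  IsPath.pi fun κ => IsPath.pi fun i => (h1 κ i).isPath hT (n := M.deg κ) fun t ht => by
    by_cases hκ : κ ∈ M.poro
    · exact (hv t ht).1 κ hκ i
    · simp [(hv t ht).2 κ hκ]

theorem isPath_of_isAcouDiscrete (hT : 0 ≤ T) {ψ ψt : ℝ → M.SField}
    (hψ : ∀ t ∈ Icc 0 T, M.IsAcouDiscrete (ψ t))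
    (h1 : ∀ κ, IsPrimitive T (fun t => ψ t κ) (fun t => ψt t κ)) : IsPath T ψ ψt :=
  IsPath.pi fun κ => (h1 κ).isPath hT (n := M.deg κ) fun t ht => by
    by_cases hκ : κ ∈ M.poro
    · simp [(hψ t ht).2 κ hκ]
    · exact (hψ t ht).1 κ hκ

namespace IsSolution

theorem ut_mem (hX : IsSolution c P S τ T f g h X) (hT : 0 < T) :
    ∀ t ∈ Icc 0 T, M.IsPoroDiscrete (X.ut t) :=
  isPoroDiscrete_of_isPrimitive hT hX.u_mem hX.u_deriv hX.ut_deriv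

theorem wt_mem (hX : IsSolution c P S τ T f g h X) (hT : 0 < T) :
    ∀ t ∈ Icc 0 T, M.IsPoroDiscrete (X.wt t) :=
  isPoroDiscrete_of_isPrimitive hT hX.w_mem hX.w_deriv hX.wt_deriv

theorem φt_mem (hX : IsSolution c P S τ T f g h X) (hT : 0 < T) :
    ∀ t ∈ Icc 0 T, M.IsAcouDiscrete (X.φt t) :=
  isAcouDiscrete_of_isPrimitive hT hX.φ_mem hX.φ_deriv hX.φt_deriv

theorem isPath_state (hX : IsSolution c P S τ T f g h X) (hT : 0 < T) :
    IsPath T X.state X.velocity :=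
  (isPath_of_isPoroDiscrete hT.le hX.u_mem hX.u_deriv).prodMk
    ((isPath_of_isPoroDiscrete hT.le hX.w_mem hX.w_deriv).prodMk
      (isPath_of_isAcouDiscrete hT.le hX.φ_mem hX.φ_deriv))

theorem isPath_velocity (hX : IsSolution c P S τ T f g h X) (hT : 0 < T) :
    IsPath T X.velocity X.acceleration :=
  (isPath_of_isPoroDiscrete hT.le (hX.ut_mem hT) hX.ut_deriv).prodMk
    ((isPath_of_isPoroDiscrete hT.le (hX.wt_mem hT) hX.wt_deriv).prodMk
      (isPath_of_isAcouDiscrete hT.le (hX.φt_mem hT) hX.φt_deriv))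

/-- The energy identity. Symmetry turns the product rule for the quadratic forms into `ℳ(∂ₜₜ, ∂ₜ) +
𝒜_h(·, ∂ₜ)`, and the scheme is tested with the velocity. The coupling contributes `𝒞_h(φt, ut + wt)`
with both signs and disappears. -/
theorem isScalarPrimitive_energy (hX : IsSolution c P S τ T f g h X) (hT : 0 < T) :
    IsScalarPrimitive T (X.energy c P S τ) fun t =>
      ∑ κ ∈ M.poroElems, M.cellInt κ (fun x => ∑ i, f t x i * val (X.ut t κ i) x)
        + ∑ κ ∈ M.poroElems, M.cellInt κ (fun x => ∑ i, g t x i * val (X.wt t κ i) x)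
        + ∑ κ ∈ M.acouElems, M.cellInt κ (fun x => h t x * val (X.φt t κ) x)
        - c.dampForm τ (X.wt t) (X.wt t) := by
  have hm := IsPath.bilin hT.le (c.isBilin_massForm.const_mul (1 / 2)) (hX.isPath_velocity hT)
    (hX.isPath_velocity hT)
  have hs := IsPath.bilin hT.le ((c.isBilin_stiffForm P S τ).const_mul (1 / 2))
    (hX.isPath_state hT) (hX.isPath_state hT)
  have hsum := hm.add hT.le hs
  refine hsum.congr hT.le (fun t _ => rfl) ?_
  filter_upwards [hX.equation, ae_restrict_mem measurableSet_Ioc] with t ht hmem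
  have hmem' : t ∈ Icc 0 T := Ioc_subset_Icc_self hmem
  rw [← ht (X.ut t) (X.wt t) (X.φt t) (hX.ut_mem hT t hmem') (hX.wt_mem hT t hmem')
    (hX.φt_mem hT t hmem')]
  have e1 := c.massForm_comm (X.velocity t) (X.acceleration t)
  have e2 := c.stiffForm_comm P S τ (X.velocity t) (X.state t)
  rw [e1, e2]
  simp only [Traj.state, Traj.velocity, Traj.acceleration]
  ring

theorem continuousOn_dampCell (hX : IsSolution c P S τ T f g h X) (hT : 0 < T) :
    ContinuousOn (fun t => c.dampCell (X.wt t) (X.wt t)) (Icc 0 T) :=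
  (IsPath.bilin hT.le c.isBilin_dampCell (hX.isPath_velocity hT)
    (hX.isPath_velocity hT)).continuousOn hT.le

theorem continuousOn_dampFace (hX : IsSolution c P S τ T f g h X) (hT : 0 < T) :
    ContinuousOn (fun t => Coeffs.dampFace τ (X.wt t) (X.wt t)) (Icc 0 T) :=
  (IsPath.bilin hT.le (Coeffs.isBilin_dampFace τ) (hX.isPath_velocity hT)
    (hX.isPath_velocity hT)).continuousOn hT.le

theorem energy_le (hX : IsSolution c P S τ T f g h X) (hT : 0 < T) {lo hi creg : ℝ} (hlo : 0 < lo)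
    (hd : 1 ≤ d) (hreg : M.IsPolytopicRegular creg) (hc : c.IsAdmissible lo hi)
    (hτ : ∀ F ∈ M.interfaceFaces, 0 ≤ τ F ∧ τ F ≤ 1)
    (h1 : 8 * traceConst d creg + 1 ≤ P.sigma0) (h2 : 8 * traceConst d creg + 1 ≤ P.m0)
    (h3 : 8 * traceConst d creg + 1 ≤ P.rho0) (hsrc : IsSource M T f g h)
    {t : ℝ} (ht : t ∈ Ioc 0 T) :
    X.energy c P S τ t + 1 / 2 * ∫ s in (0 : ℝ)..t, c.dampForm τ (X.wt s) (X.wt s)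
      ≤ (X.energy c P S τ 0 + (2 * lo)⁻¹ * ∫ s in (0 : ℝ)..t, ((∫ x in M.poroDomain, ‖f s x‖ ^ 2)
        + (∫ x in M.poroDomain, ‖g s x‖ ^ 2) + ∫ x in M.acouDomain, ‖h s x‖ ^ 2)) * Real.exp t := by
  set G : ℝ → ℝ := fun s => (∫ x in M.poroDomain, ‖f s x‖ ^ 2)
    + (∫ x in M.poroDomain, ‖g s x‖ ^ 2) + ∫ x in M.acouDomain, ‖h s x‖ ^ 2 with hG
  set D : ℝ → ℝ := fun s => c.dampForm τ (X.wt s) (X.wt s) with hD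
  set E : ℝ → ℝ := X.energy c P S τ with hE
  have hG0 : ∀ s, 0 ≤ G s := fun s => by
    have i1 : 0 ≤ ∫ x in M.poroDomain, ‖f s x‖ ^ 2 := integral_nonneg fun _ => by positivity
    have i2 : 0 ≤ ∫ x in M.poroDomain, ‖g s x‖ ^ 2 := integral_nonneg fun _ => by positivity
    have i3 : 0 ≤ ∫ x in M.acouDomain, ‖h s x‖ ^ 2 := integral_nonneg fun _ => by positivity
    rw [hG]
    positivity
  have hD0 : ∀ s, 0 ≤ D s := fun s =>
    add_nonneg (hc.dampCell_nonneg hlo _) (Coeffs.dampFace_nonneg hτ _)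
  have mf := hsrc.f_mem.integrable_norm_pow (by norm_num)
  have mg := hsrc.g_mem.integrable_norm_pow (by norm_num)
  have mh := hsrc.h_mem.integrable_norm_pow (by norm_num)
  have hGi : IntervalIntegrable G volume 0 T := by
    rw [intervalIntegrable_iff_integrableOn_Ioc_of_le hT.le]
    exact (mf.integral_prod_left.add mg.integral_prod_left).add mh.integral_prod_left
  have hDc : ContinuousOn D (Icc 0 T) := (hX.continuousOn_dampCell hT).add
    (hX.continuousOn_dampFace hT)
  have hEp := hX.isScalarPrimitive_energy hT
  have hEc : ContinuousOn E (Icc 0 T) := hEp.continuousOn hT.le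
  have sub : ∀ {s}, s ∈ Icc 0 T → uIcc 0 s ⊆ uIcc 0 T := fun {s} hs => by
    rw [uIcc_of_le hT.le, uIcc_of_le hs.1]; exact Icc_subset_Icc_right hs.2
  have hDi : IntervalIntegrable D volume 0 T := by
    apply ContinuousOn.intervalIntegrable; rwa [uIcc_of_le hT.le]
  have hEi : IntervalIntegrable E volume 0 T := by
    apply ContinuousOn.intervalIntegrable; rwa [uIcc_of_le hT.le]
  -- The bound `|stiffForm - potential| ≤ potential / 2` by itself forces the potential to be
  -- nonnegative, and with it the stiffness part of the energy.
  have hkE : ∀ s ∈ Icc 0 T, 1 / 2 * c.kinetic (X.velocity s) ≤ E s := fun s hs => by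
    have k1 := hc.kinetic_le_massForm hlo (X.velocity s)
    have k2 := abs_le.1 (Coeffs.abs_stiffForm_sub_le hd hreg hc h1 h2 h3 S τ (U := X.state s)
      (hX.u_mem s hs) (hX.w_mem s hs) (hX.φ_mem s hs))
    have k3 : 0 ≤ c.potential P S τ (X.state s) := by linarith [k2.1, k2.2]
    have k4 : E s = 1 / 2 * c.massForm (X.velocity s).1 (X.velocity s).2.1 (X.velocity s).2.2
        (X.velocity s).1 (X.velocity s).2.1 (X.velocity s).2.2 + 1 / 2 * c.stiffForm P S τ
        (X.state s).1 (X.state s).2.1 (X.state s).2.2 (X.state s).1 (X.state s).2.1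
        (X.state s).2.2 := rfl
    linarith [k2.1]
  -- The sources cost half of the kinetic energy, which is at most `E`, and half of the volume
  -- damping. What remains of the damping is at least `D / 2`, as the interface part is nonnegative.
  have hstep : ∀ s ∈ Icc 0 T, E s ≤ E 0 + (2 * lo)⁻¹ * (∫ r in (0 : ℝ)..s, G r)
      + (∫ r in (0 : ℝ)..s, E r) - 1 / 2 * ∫ r in (0 : ℝ)..s, D r := fun s hs => by
    have hGs := hGi.mono_set (sub hs)
    have hDs := hDi.mono_set (sub hs)
    have hEs := hEi.mono_set (sub hs)
    have hle : ∫ r in (0 : ℝ)..s, (∑ κ ∈ M.poroElems, M.cellInt κ (fun x =>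
          ∑ i, f r x i * val (X.ut r κ i) x)
        + ∑ κ ∈ M.poroElems, M.cellInt κ (fun x => ∑ i, g r x i * val (X.wt r κ i) x)
        + ∑ κ ∈ M.acouElems, M.cellInt κ (fun x => h r x * val (X.φt r κ) x) - D r)
        ≤ ∫ r in (0 : ℝ)..s, ((2 * lo)⁻¹ * G r + E r - 1 / 2 * D r) := by
      refine intervalIntegral.integral_mono_ae_restrict hs.1 (hEp.1.mono_set (sub hs))
        (((hGs.const_mul _).add hEs).sub (hDs.const_mul _)) ?_
      -- Square integrability in space-time gives, by Fubini, square integrability in space at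
      -- almost every time only.
      have hae : ∀ᵐ r ∂(volume.restrict (Icc 0 T)), IntegrableOn (fun x => ‖f r x‖ ^ 2) M.poroDomain
          ∧ IntegrableOn (fun x => ‖g r x‖ ^ 2) M.poroDomain
          ∧ IntegrableOn (fun x => ‖h r x‖ ^ 2) M.acouDomain := by
        rw [← Measure.restrict_congr_set Ioc_ae_eq_Icc]
        filter_upwards [mf.prod_right_ae, mg.prod_right_ae, mh.prod_right_ae] with r a1 a2 a3
        exact ⟨a1, a2, a3⟩
      filter_upwards [ae_restrict_of_ae_restrict_of_subset (Icc_subset_Icc_right hs.2) hae,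
        ae_restrict_mem measurableSet_Icc] with r hr hmem
      have hb := hc.source_le hlo hr.1 hr.2.1 hr.2.2 (X.velocity r)
      have hk := hkE r ⟨hmem.1, hmem.2.trans hs.2⟩
      have hf0 : D r = c.dampCell (X.wt r) (X.wt r) + Coeffs.dampFace τ (X.wt r) (X.wt r) := rfl
      have hf1 := Coeffs.dampFace_nonneg hτ (X.wt r)
      simp only [Traj.velocity] at hb hk
      have hG' : G r = (∫ x in M.poroDomain, ‖f r x‖ ^ 2)
        + (∫ x in M.poroDomain, ‖g r x‖ ^ 2) + ∫ x in M.acouDomain, ‖h r x‖ ^ 2 := rfl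
      rw [← hG'] at hb
      linarith
    rw [intervalIntegral.integral_sub ((hGs.const_mul _).add hEs) (hDs.const_mul _),
      intervalIntegral.integral_add (hGs.const_mul _) hEs, intervalIntegral.integral_const_mul,
      intervalIntegral.integral_const_mul] at hle
    have := hEp.2 s hs
    rw [← hE] at this
    linarith
  have htT : t ∈ Icc 0 T := Ioc_subset_Icc_self ht
  have hDint : ContinuousOn (fun s => ∫ r in (0 : ℝ)..s, D r) (Icc 0 T) := by
    have := (hDi.absolutelyContinuousOnInterval_intervalIntegral (c := 0) (by simp)).continuousOn
    rwa [uIcc_of_le hT.le] at this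
  have hyc : ContinuousOn (fun s => E s + 1 / 2 * ∫ r in (0 : ℝ)..s, D r) (Icc 0 T) :=
    hEc.add (continuousOn_const.mul hDint)
  -- Gronwall is applied to the energy together with the accumulated damping, so that the
  -- dissipation is estimated along with it.
  refine le_mul_exp_of_le_add_integral (y := fun s => E s + 1 / 2 * ∫ r in (0 : ℝ)..s, D r)
    ht.1.le (hyc.mono (Icc_subset_Icc_right ht.2)) fun s hs => ?_
  have hsT : s ∈ Icc 0 T := ⟨hs.1, hs.2.trans ht.2⟩
  have j1 : ∫ r in (0 : ℝ)..s, G r ≤ ∫ r in (0 : ℝ)..t, G r :=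
    intervalIntegral.integral_mono_interval le_rfl hs.1 hs.2 (ae_of_all _ hG0)
      (hGi.mono_set (sub htT))
  have j2 : ∫ r in (0 : ℝ)..s, E r
      ≤ ∫ r in (0 : ℝ)..s, (E r + 1 / 2 * ∫ q in (0 : ℝ)..r, D q) := by
    refine intervalIntegral.integral_mono_on hs.1 (hEi.mono_set (sub hsT))
      (ContinuousOn.intervalIntegrable ?_) fun r hr => ?_
    · rw [uIcc_of_le hs.1]
      exact hyc.mono (Icc_subset_Icc_right hsT.2)
    · have : 0 ≤ ∫ q in (0 : ℝ)..r, D q :=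
        intervalIntegral.integral_nonneg hr.1 fun q _ => hD0 q
      linarith
  have j3 := mul_le_mul_of_nonneg_left j1 (inv_nonneg.2 (mul_pos two_pos hlo).le)
  have := hstep s hsT
  linarith

end IsSolution

end Energy

/-! ## The energy norm -/

section EnergyNorm

variable {d : ℕ} {M : CoupledMesh d} {c : Coeffs M} {P : Penalties} {S : SealedTerm}
  {τ : M.Face → ℝ} {T : ℝ} {f g : ℝ → Pt d → Pt d} {h : ℝ → Pt d → ℝ} {X : Traj M}

theorem energySq_eq (t : ℝ) : energySq c P S τ X t = c.kinetic (X.velocity t)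
    + c.potential P S τ (X.state t) + c.dampCell (X.w 0) (X.w 0)
    + (∫ s in (0 : ℝ)..t, c.dampCell (X.wt s) (X.wt s))
    + ∫ s in (0 : ℝ)..t, Coeffs.dampFace τ (X.wt s) (X.wt s) := by
  simp only [energySq, Coeffs.kinetic, Coeffs.potential, Coeffs.dampCell, Coeffs.dampFace, sq,
    Traj.velocity, Traj.state, mul_assoc]
  ring

theorem IsSolution.energySq_le (hX : IsSolution c P S τ T f g h X) (hT : 0 < T) {lo hi creg : ℝ}
    (hlo : 0 < lo) (hd : 1 ≤ d) (hreg : M.IsPolytopicRegular creg) (hc : c.IsAdmissible lo hi)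
    (hτ : ∀ F ∈ M.interfaceFaces, 0 ≤ τ F ∧ τ F ≤ 1)
    (h1 : 8 * traceConst d creg + 1 ≤ P.sigma0) (h2 : 8 * traceConst d creg + 1 ≤ P.m0)
    (h3 : 8 * traceConst d creg + 1 ≤ P.rho0) (hsrc : IsSource M T f g h)
    {t : ℝ} (ht : t ∈ Ioc 0 T) :
    0 ≤ energySq c P S τ X 0 ∧ 0 ≤ energySq c P S τ X t ∧
    energySq c P S τ X t
      ≤ (4 * Real.exp t * (2 + 2 * |hi| + 2 * hi ^ 2 / lo + (2 * lo)⁻¹) + 1)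
        * (energySq c P S τ X 0 + ∫ s in (0 : ℝ)..t, ((∫ x in M.poroDomain, ‖f s x‖ ^ 2)
          + (∫ x in M.poroDomain, ‖g s x‖ ^ 2) + ∫ x in M.acouDomain, ‖h s x‖ ^ 2)) := by
  have key := hX.energy_le hT hlo hd hreg hc hτ h1 h2 h3 hsrc ht
  have hJ : 0 ≤ ∫ s in (0 : ℝ)..t, ((∫ x in M.poroDomain, ‖f s x‖ ^ 2)
      + (∫ x in M.poroDomain, ‖g s x‖ ^ 2) + ∫ x in M.acouDomain, ‖h s x‖ ^ 2) :=
    intervalIntegral.integral_nonneg ht.1.le fun s _ => by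
      have i1 : 0 ≤ ∫ x in M.poroDomain, ‖f s x‖ ^ 2 := integral_nonneg fun _ => by positivity
      have i2 : 0 ≤ ∫ x in M.poroDomain, ‖g s x‖ ^ 2 := integral_nonneg fun _ => by positivity
      have i3 : 0 ≤ ∫ x in M.acouDomain, ‖h s x‖ ^ 2 := integral_nonneg fun _ => by positivity
      positivity
  set J := ∫ s in (0 : ℝ)..t, ((∫ x in M.poroDomain, ‖f s x‖ ^ 2)
      + (∫ x in M.poroDomain, ‖g s x‖ ^ 2) + ∫ x in M.acouDomain, ‖h s x‖ ^ 2)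
  have htT : t ∈ Icc 0 T := Ioc_subset_Icc_self ht
  have h0T : (0 : ℝ) ∈ Icc 0 T := ⟨le_rfl, hT.le⟩
  have hpot : ∀ s ∈ Icc 0 T, |c.stiffForm P S τ (X.u s) (X.w s) (X.φ s) (X.u s) (X.w s) (X.φ s)
      - c.potential P S τ (X.state s)| ≤ 1 / 2 * c.potential P S τ (X.state s) := fun s hs =>
    Coeffs.abs_stiffForm_sub_le hd hreg hc h1 h2 h3 S τ (U := X.state s)
      (hX.u_mem s hs) (hX.w_mem s hs) (hX.φ_mem s hs)
  have pt := abs_le.1 (hpot t htT)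
  have p0 := abs_le.1 (hpot 0 h0T)
  have kt : c.kinetic (X.velocity t)
      ≤ c.massForm (X.ut t) (X.wt t) (X.φt t) (X.ut t) (X.wt t) (X.φt t) :=
    hc.kinetic_le_massForm hlo (X.velocity t)
  have k0 : c.massForm (X.ut 0) (X.wt 0) (X.φt 0) (X.ut 0) (X.wt 0) (X.φt 0)
      ≤ (2 + 2 * |hi| + 2 * hi ^ 2 / lo) * c.kinetic (X.velocity 0) :=
    hc.massForm_le_kinetic hlo (X.velocity 0)
  have kt0 := hc.kinetic_nonneg hlo (X.velocity t)
  have k00 := hc.kinetic_nonneg hlo (X.velocity 0)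
  have hw := hc.dampCell_nonneg hlo (X.w 0)
  have sub : uIcc 0 t ⊆ Icc 0 T := by
    rw [uIcc_of_le ht.1.le]; exact Icc_subset_Icc_right ht.2
  have dC : 0 ≤ ∫ s in (0 : ℝ)..t, c.dampCell (X.wt s) (X.wt s) :=
    intervalIntegral.integral_nonneg ht.1.le fun s _ => hc.dampCell_nonneg hlo _
  have dF : 0 ≤ ∫ s in (0 : ℝ)..t, Coeffs.dampFace τ (X.wt s) (X.wt s) :=
    intervalIntegral.integral_nonneg ht.1.le fun s _ => Coeffs.dampFace_nonneg hτ _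
  have dsum : ∫ s in (0 : ℝ)..t, c.dampForm τ (X.wt s) (X.wt s)
      = (∫ s in (0 : ℝ)..t, c.dampCell (X.wt s) (X.wt s))
        + ∫ s in (0 : ℝ)..t, Coeffs.dampFace τ (X.wt s) (X.wt s) :=
    intervalIntegral.integral_add ((hX.continuousOn_dampCell hT).mono sub).intervalIntegrable
      ((hX.continuousOn_dampFace hT).mono sub).intervalIntegrable
  rw [dsum, Traj.energy, Traj.energy] at key
  have e0 : energySq c P S τ X 0 = c.kinetic (X.velocity 0) + c.potential P S τ (X.state 0)
      + c.dampCell (X.w 0) (X.w 0) := by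
    rw [energySq_eq, intervalIntegral.integral_same, intervalIntegral.integral_same, add_zero,
      add_zero]
  rw [e0, energySq_eq t]
  have hCM : 2 ≤ 2 + 2 * |hi| + 2 * hi ^ 2 / lo := by
    have : 0 ≤ 2 * hi ^ 2 / lo := by positivity
    have := abs_nonneg hi
    linarith
  set CM := 2 + 2 * |hi| + 2 * hi ^ 2 / lo
  have ha : 0 ≤ (2 * lo)⁻¹ := by positivity
  set a := (2 * lo)⁻¹
  set E0 := 1 / 2 * c.massForm (X.ut 0) (X.wt 0) (X.φt 0) (X.ut 0) (X.wt 0) (X.φt 0)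
    + 1 / 2 * c.stiffForm P S τ (X.u 0) (X.w 0) (X.φ 0) (X.u 0) (X.w 0) (X.φ 0)
  set k := c.kinetic (X.velocity 0)
  set p := c.potential P S τ (X.state 0)
  set w := c.dampCell (X.w 0) (X.w 0)
  have hp : 0 ≤ p := by linarith [p0.1, p0.2]
  -- The stiffness form is at most 3/2 of the potential, so its half contributes `3/4 p`, which `CM
  -- ≥ 2` covers.
  have hE0 : E0 ≤ CM * (k + p) := by
    have q1 := mul_le_mul_of_nonneg_right hCM hp
    have q2 := mul_le_mul_of_nonneg_right hCM k00
    simp only [E0]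
    linarith [p0.2]
  have hex := Real.exp_pos t
  refine ⟨by linarith, by linarith [pt.1, pt.2], ?_⟩
  have b1 : E0 + a * J ≤ (CM + a) * (k + p + w + J) := by
    nlinarith [mul_nonneg ha k00, mul_nonneg ha hp, mul_nonneg ha hw]
  have b2 : (E0 + a * J) * Real.exp t ≤ (CM + a) * (k + p + w + J) * Real.exp t := by gcongr
  -- The factor 4: the potential is at most twice the stiffness form, which enters the energy with
  -- weight 1/2; the kinetic and damping terms need only 2. The summand 1 in the constant pays for
  -- the `w(0)` term, which is the same at time `t` and at time 0.
  nlinarith [pt.1]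

end EnergyNorm

end PoroAcoustic

end

/-! ### The stability estimate -/

open PoroAcoustic in
theorem proposition6p1 (d : ℕ) (hd : d = 2 ∨ d = 3) (creg : ℝ) :
    ∃ sigmaStar mStar rhoStar : ℝ, 0 < sigmaStar ∧ 0 < mStar ∧ 0 < rhoStar ∧
      ∀ lo hi : ℝ, 0 < lo →
        ∃ C : ℝ → ℝ, (∀ t, 0 < C t) ∧
          ∀ (M : CoupledMesh d), M.IsPolytopicRegular creg →
          ∀ (c : Coeffs M), c.IsAdmissible lo hi →
          ∀ (τ : M.Face → ℝ), (∀ F ∈ M.interfaceFaces, 0 ≤ τ F ∧ τ F ≤ 1) →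
          ∀ (P : Penalties), sigmaStar ≤ P.sigma0 → mStar ≤ P.m0 → rhoStar ≤ P.rho0 →
          ∀ (S : SealedTerm) (T : ℝ) (f g : ℝ → Pt d → Pt d) (h : ℝ → Pt d → ℝ), 0 < T →
            IsSource M T f g h →
          ∀ X : Traj M, IsSolution c P S τ T f g h X →
            ∀ t ∈ Set.Ioc 0 T,
              energyNorm c P S τ X t ^ 2 ≤ C t * (energyNorm c P S τ X 0 ^ 2
                + ∫ s in (0 : ℝ)..t, ((∫ x in M.poroDomain, ‖f s x‖ ^ 2)
                  + (∫ x in M.poroDomain, ‖g s x‖ ^ 2) + ∫ x in M.acouDomain, ‖h s x‖ ^ 2)) ∧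
              (f = 0 → g = 0 → h = 0 →
                energyNorm c P S τ X t ≤ C t * energyNorm c P S τ X 0) := by
  have hd1 : 1 ≤ d := by omega
  have hK : 0 < 8 * traceConst d creg + 1 := by rw [traceConst]; positivity
  -- All three thresholds are `8 * traceConst d creg + 1`, fixed before the material bounds are
  -- chosen.
  refine ⟨_, _, _, hK, hK, hK, fun lo hi hlo => ⟨fun t =>
    4 * Real.exp t * (2 + 2 * |hi| + 2 * hi ^ 2 / lo + (2 * lo)⁻¹) + 1, fun t => by positivity,
    fun M hreg c hc τ hτ P h1 h2 h3 S T f g h hT hsrc X hX t ht => ?_⟩⟩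
  obtain ⟨n0, nt, key⟩ := hX.energySq_le hT hlo hd1 hreg hc hτ h1 h2 h3 hsrc ht
  -- From `C t ≥ 1` follows `C t ≤ (C t)²`, so the same constant serves for the unsquared norms when
  -- the sources vanish.
  have hC : 1 ≤ 4 * Real.exp t * (2 + 2 * |hi| + 2 * hi ^ 2 / lo + (2 * lo)⁻¹) + 1 :=
    le_add_of_nonneg_left (by positivity)
  have s0 : energyNorm c P S τ X 0 ^ 2 = energySq c P S τ X 0 := Real.sq_sqrt n0
  have st : energyNorm c P S τ X t ^ 2 = energySq c P S τ X t := Real.sq_sqrt nt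
  refine ⟨by rw [s0, st]; exact key, fun hf hg hh => ?_⟩
  subst hf hg hh
  have key' : energySq c P S τ X t
      ≤ (4 * Real.exp t * (2 + 2 * |hi| + 2 * hi ^ 2 / lo + (2 * lo)⁻¹) + 1)
        * energySq c P S τ X 0 := by simpa using key
  refine Real.sqrt_le_iff.2 ⟨mul_nonneg (by positivity) (Real.sqrt_nonneg _), ?_⟩
  rw [mul_pow, s0]
  refine key'.trans (mul_le_mul_of_nonneg_right ?_ n0)
  exact le_self_pow₀ hC two_ne_zero
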